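/- For integers $0\le k\le n$ let $[n]=\{1,\dots,n\}$. A family $\mathcal F$ of $k$-element subsets of $[n]$ is *intersecting* if any two of its members intersect, and *non-trivial* if no element of $[n]$ belongs to all its members. The degree of a set $S\subset[n]$ in $\mathcal F$ is the number of members of $\mathcal F$ containing $S$, and the minimum $t$-degree $\delta_t(\mathcal F)$ is the minimum of the degrees of all $t$-element subsets of $[n]$. **Theorem.** Let $n,k,t$ be positive integers such that either $t=1$, $n\ge 2k+5$ and $k\ge 35$, or $1<t\le \frac k4-2$ and $n\ge 2k+14t$. Then every non-trivial intersecting family $\mathcal F$ of $k$-element subsets of $[n]$ satisfies $$\delta_t(\mathcal F)\le \binom{n-t-1}{k-t-1}-\binom{n-t-k-1}{k-t-1}.$$ Moreover, the right-hand side is exactly the minimum $t$-degree of the Hilton–Milner family, which consists of the set $\{2,\dots,k+1\}$ and of all $k$-element subsets of $[n]$ that contain $1$ and intersect $\{2,\dots,k+1\}$. -/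

import Mathlib

/-- The degree of a subset `S` in the family `F`: the number of members of `F` containing `S`. -/
def subsetDegree {n : ℕ} (F : Finset (Finset (Fin n))) (S : Finset (Fin n)) : ℕ :=
  (F.filter (fun A => S ⊆ A)).card

/-- The minimum `t`-degree of the family `F`: the minimum of the degrees of the `t`-element
subsets of the ground set. (Here the ground set has `n` elements; for `t ≤ n` there is at least
one such subset, so that the infimum is an attained minimum.) -/
noncomputable def minDegree {n : ℕ} (t : ℕ) (F : Finset (Finset (Fin n))) : ℕ :=
  sInf {d : ℕ | ∃ S : Finset (Fin n), S.card = t ∧ subsetDegree F S = d}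

/-- A family is non-trivial if no element of the ground set lies in all its members. -/
def NontrivialFamily {n : ℕ} (F : Finset (Finset (Fin n))) : Prop :=
  ¬ ∃ x : Fin n, ∀ A ∈ F, x ∈ A

/-- The interval `{2, …, k + 1}` of `{1, …, n}`; the element `i + 1` of `{1, …, n}` is
represented by `i : Fin n`. -/
def hmSet (n k : ℕ) : Finset (Fin n) :=
  Finset.univ.filter (fun i => 1 ≤ (i : ℕ) ∧ (i : ℕ) ≤ k)

/-- The Hilton–Milner family: the set `{2, …, k + 1}` together with all `k`-element sets that
contain `1` and intersect `{2, …, k + 1}`. The element `1` of `{1, …, n}` is represented by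
the `i : Fin n` with value `0`. -/
def hiltonMilner (n k : ℕ) : Finset (Finset (Fin n)) :=
  insert (hmSet n k)
    ((Finset.powersetCard k Finset.univ).filter
      (fun A => (∃ i ∈ A, (i : ℕ) = 0) ∧ (A ∩ hmSet n k).Nonempty))

/-! Suppose every `t`-degree of a non-trivial intersecting `F` exceeds the Hilton–Milner value. Two
things are needed: an element `i` that few members avoid, and then a comparison of `F` with a
Hilton–Milner family centred at `i`.

Finding `i` (`exists_card_filter_notMem_lt`). Assume instead that at least C(n-3,k-2) members avoid
each element, and look at the levels of the up-set generated by `F`, from l = max(k, ⌈n/4⌉) to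
⌊n/2⌋. Kruskal–Katona in the links of `t`-sets carries the degree bounds upwards, so every vertex
degree at level j is at least C(n-1,j-1)(j/n - θ) with θ small. Hence level l has density at least
l/n - θ, while Erdős–Ko–Rado caps the density of level ⌊n/2⌋ by ⌊n/2⌋/n. By pigeonhole some two
consecutive levels differ in density by at most (1+κ)/n. The spectral inequality
`card_mul_le_of_degree_deviation` says that so small a boundary forces very uneven vertex degrees:
the indicator must have much weight on linear functions. But the degrees are bounded below by the
previous estimate and above by the assumption on avoiding members. `level_inequality` quantifies
this and `numeric_contradiction` refutes it.

Using `i`. Let D be the set of members avoiding `i`; it is non-empty by non-triviality, and |D| <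
C(n-3,k-2). If |D| < C(n-k-1+2t,2t), fix A in D and average over the `t`-sets disjoint from A ∪ {i}:
a second member B of D forbids more sets through `i` than D can compensate
(`exists_subsetDegree_add_le`). If |D| is larger, average over all `t`-sets avoiding `i`:
complements of sets lying above D are forbidden through `i`, and Kruskal–Katona shows that this loss
outweighs the gain from D (`exists_subsetDegree_add_le_of_choose_le`).

The exact value for the Hilton–Milner family is a direct count, `minDegree_hiltonMilner`. -/

section HiltonMilnerDegree

open Finset
open scoped FinsetFamily

/-! ### Kruskal–Katona: recursive, Hilton–Milner-shaped and linearly interpolated forms. -/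

/-- There are initial segments of the colexicographic order of every admissible size. -/
theorem exists_isInitSeg_card {n r c : ℕ} (hc : c ≤ n.choose r) :
    ∃ C : Finset (Finset (Fin n)), Colex.IsInitSeg C r ∧ #C = c := by
  induction c with
  | zero => exact ⟨∅, Colex.isInitSeg_empty, rfl⟩
  | succ c ih =>
    obtain ⟨C, hC, hcard⟩ := ih (by omega)
    have hne : (powersetCard r univ \ C).Nonempty := by
      rw [← Finset.card_pos]
      have := le_card_sdiff C (powersetCard r (univ : Finset (Fin n)))
      rw [card_powersetCard, card_univ, Fintype.card_fin] at this
      omega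
    obtain ⟨A, hA, hmin⟩ := exists_min_image _ (fun s => toColex s) hne
    rw [mem_sdiff, mem_powersetCard_univ] at hA
    refine ⟨insert A C, ⟨?_, ?_⟩, by rw [card_insert_of_notMem hA.2, hcard]⟩
    · intro s hs
      rcases mem_insert.1 hs with rfl | hs
      · exact hA.1
      · exact hC.1 hs
    · rintro s s' hs ⟨hlt, hs'⟩
      rcases mem_insert.1 hs with rfl | hs
      · by_contra hcon
        have := hmin s' (mem_sdiff.2 ⟨mem_powersetCard_univ.2 hs',
          fun h => hcon (mem_insert_of_mem h)⟩)
        exact absurd hlt (not_lt.2 this)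
      · exact mem_insert_of_mem (hC.2 hs ⟨hlt, hs'⟩)

/-- The first `m` elements of `Fin n`. -/
def initialPart (n m : ℕ) : Finset (Fin n) := univ.filter fun x => (x : ℕ) < m

theorem mem_initialPart {n m : ℕ} {x : Fin n} : x ∈ initialPart n m ↔ (x : ℕ) < m := by
  simp [initialPart]

theorem card_initialPart {n m : ℕ} (h : m ≤ n) : #(initialPart n m) = m := by
  have : initialPart n m = attachFin (range m) fun i hi => by
      rw [mem_range] at hi; omega := by
    ext x; simp [mem_initialPart]
  rw [this, card_attachFin, card_range]

theorem isInitSeg_powersetCard_initialPart (n m r : ℕ) :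
    Colex.IsInitSeg (powersetCard r (initialPart n m)) r := by
  refine ⟨Set.sized_powersetCard _ _, ?_⟩
  rintro s s' hs ⟨hlt, hs'⟩
  rw [mem_powersetCard] at hs ⊢
  refine ⟨?_, hs'⟩
  by_cases hm : m < n
  · have := Colex.forall_lt_mono (a := (⟨m, hm⟩ : Fin n)) hlt.le
      (fun b hb => by simpa [Fin.lt_def] using mem_initialPart.1 (hs.1 hb))
    intro b hb
    simpa [mem_initialPart, Fin.lt_def] using this b hb
  · intro b _
    rw [mem_initialPart]; omega

theorem mem_iterate_shadow_of_subset {α : Type*} [DecidableEq α] {𝒜 : Finset (Finset α)} {i : ℕ}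
    {A B : Finset α} (hA : A ∈ 𝒜) (hBA : B ⊆ A) (hc : #A = #B + i) : B ∈ ∂^[i] 𝒜 :=
  mem_shadow_iterate_iff_exists_mem_card_add.2 ⟨A, hA, hBA, hc⟩

theorem powersetCard_subset_iterate_shadow {α : Type*} [DecidableEq α] {S : Finset α} {r i : ℕ}
    (hr : r ≤ #S) (hi : i ≤ r) :
    powersetCard (r - i) S ⊆ ∂^[i] (powersetCard r S) := by
  intro B hB
  rw [mem_powersetCard] at hB
  obtain ⟨A, hBA, hAS, hA⟩ := exists_subsuperset_card_eq (n := r) hB.1 (by omega) hr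
  exact mem_iterate_shadow_of_subset (mem_powersetCard.2 ⟨hAS, hA⟩) hBA (by omega)

/-- A recursive form of the Kruskal–Katona theorem. -/
theorem add_le_card_iterate_shadow {n m r i a b : ℕ} {𝒜 : Finset (Finset (Fin n))}
    (h𝒜 : (𝒜 : Set (Finset (Fin n))).Sized (r + 1)) (hm : m < n) (hrm : r + 1 ≤ m) (hi : i ≤ r)
    (hcard : m.choose (r + 1) + a ≤ #𝒜) (ha : a ≤ m.choose r)
    (H : ∀ ℬ ⊆ powersetCard r (initialPart n m), a ≤ #ℬ → b ≤ #(∂^[i] ℬ)) :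
    m.choose (r + 1 - i) + b ≤ #(∂^[i] 𝒜) := by
  have hle : #𝒜 ≤ n.choose (r + 1) := by simpa using h𝒜.card_le
  obtain ⟨𝒞, h𝒞, h𝒞c⟩ := exists_isInitSeg_card hle
  -- Kruskal–Katona allows replacing `𝒜` by a colex segment of the same size, whose structure is
  -- explicit: all sets inside the first `m` points, then sets through the next point `x`.
  refine le_trans ?_ (iterated_kk h𝒜 h𝒞c.le h𝒞)
  rw [← h𝒞c] at hcard
  set I := initialPart n m with hI
  have hIc : #I = m := card_initialPart hm.le
  set x : Fin n := ⟨m, hm⟩ with hx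
  have hxI : x ∉ I := by simp [hI, mem_initialPart, hx]
  have hsub : powersetCard (r + 1) I ⊆ 𝒞 := by
    rcases h𝒞.total (isInitSeg_powersetCard_initialPart n m (r + 1)) with h | h
    · have : #(powersetCard (r + 1) I) ≤ #𝒞 := by
        rw [card_powersetCard, hIc]; omega
      exact (eq_of_subset_of_card_le h this).ge
    · exact h
  set ℬ := (powersetCard r I).filter (fun B => insert x B ∈ 𝒞) with hℬ
  have hinsI : insert x I = initialPart n (m + 1) := by
    ext y
    simp only [mem_insert, hI, mem_initialPart, hx, Fin.ext_iff]
    omega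
  have hℬa : a ≤ #ℬ := by
    -- Initial segments are nested. Either `𝒞` lives on the first `m + 1` points, and then the link
    -- of `x` accounts for the excess `a`, or `𝒞` contains every set there, and then the link is
    -- complete and `ha` applies.
    rcases h𝒞.total (isInitSeg_powersetCard_initialPart n (m + 1) (r + 1)) with h | h
    · have h1 : 𝒞 ⊆ powersetCard (r + 1) I ∪ ℬ.image (insert x) := by
        intro A hA
        have hA' := mem_powersetCard.1 (h hA)
        rw [← hinsI] at hA'
        rw [mem_union]
        by_cases hxA : x ∈ A
        · right
          refine mem_image.2 ⟨A.erase x, mem_filter.2 ⟨mem_powersetCard.2 ⟨?_, ?_⟩, ?_⟩, ?_⟩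
          · rw [← subset_insert_iff]; exact hA'.1
          · rw [card_erase_of_mem hxA, hA'.2]; rfl
          · rwa [insert_erase hxA]
          · exact insert_erase hxA
        · left
          exact mem_powersetCard.2 ⟨(subset_insert_iff_of_notMem hxA).1 hA'.1, hA'.2⟩
      have h2 := (card_le_card h1).trans (card_union_le _ _)
      have h3 : #(ℬ.image (insert x)) ≤ #ℬ := card_image_le
      rw [card_powersetCard, hIc] at h2
      omega
    · have : ℬ = powersetCard r I := by
        refine filter_true_of_mem fun B hB => h ?_
        rw [mem_powersetCard] at hB
        rw [← hinsI, mem_powersetCard]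
        exact ⟨insert_subset_insert _ hB.1,
          by rw [card_insert_of_notMem (fun h => hxI (hB.1 h)), hB.2]⟩
      rw [this, card_powersetCard, hIc]; exact ha
  have hb := H ℬ (filter_subset _ _) hℬa
  have hℬI : ∀ B ∈ ∂^[i] ℬ, x ∉ B := by
    intro B hB hxB
    obtain ⟨A, hA, hBA, -⟩ := mem_shadow_iterate_iff_exists_mem_card_add.1 hB
    exact hxI ((mem_powersetCard.1 (mem_filter.1 hA).1).1 (hBA hxB))
  -- The shadow is split according to whether a set contains `x`; the two pieces are disjoint, so
  -- their sizes add.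
  have hsub2 : powersetCard (r + 1 - i) I ∪ (∂^[i] ℬ).image (insert x) ⊆ ∂^[i] 𝒞 := by
    apply union_subset
    · refine (powersetCard_subset_iterate_shadow (by rw [hIc]; exact hrm) (by omega)).trans ?_
      exact (shadow_monotone.iterate i) hsub
    · intro C hC
      obtain ⟨B, hB, rfl⟩ := mem_image.1 hC
      have hxB := hℬI B hB
      obtain ⟨A, hA, hBA, hAc⟩ := mem_shadow_iterate_iff_exists_mem_card_add.1 hB
      have hA' := mem_filter.1 hA
      have hxA : x ∉ A := fun h => hxI ((mem_powersetCard.1 hA'.1).1 h)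
      refine mem_iterate_shadow_of_subset hA'.2 (insert_subset_insert _ hBA) ?_
      rw [card_insert_of_notMem hxA, card_insert_of_notMem hxB]; omega
  refine le_trans ?_ (card_le_card hsub2)
  rw [card_union_of_disjoint, card_powersetCard, hIc, card_image_of_injOn]
  · omega
  · intro B hB B' hB' h
    have h' := congrArg (fun s => s.erase x) h
    simpa [erase_insert (hℬI B hB), erase_insert (hℬI B' hB')] using h'
  · rw [disjoint_left]
    intro A hA hA'
    obtain ⟨B, -, rfl⟩ := mem_image.1 hA'
    exact hxI ((mem_powersetCard.1 hA).1 (mem_insert_self _ _))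

/-- Kruskal–Katona for families at least as large as the family of the `r`-subsets of an `a`-set
that do not contain a given `s`-set. -/
theorem sub_le_card_iterate_shadow {n i : ℕ} (s : ℕ) : ∀ {a r : ℕ} {𝒜 : Finset (Finset (Fin n))},
    (𝒜 : Set (Finset (Fin n))).Sized r → a ≤ n → r + 1 ≤ a → i + s ≤ r →
    a.choose r - (a - s).choose (r - s) ≤ #𝒜 →
    a.choose (r - i) - (a - s).choose (r - i - s) ≤ #(∂^[i] 𝒜) := by
  induction s with
  | zero => intros; simp
  | succ s ih =>
    intro a r 𝒜 h𝒜 han hra hi hcard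
    obtain ⟨a, rfl⟩ : ∃ a', a = a' + 1 := ⟨a - 1, by omega⟩
    obtain ⟨r, rfl⟩ : ∃ r', r = r' + 1 := ⟨r - 1, by omega⟩
    have e1 : r + 1 - i = (r - i) + 1 := by omega
    have e2 : r - i + 1 - (s + 1) = r - i - s := by omega
    have h1 : (a - s).choose (r - s) ≤ a.choose r := by
      calc (a - s).choose (r - s) = (a - s).choose (a - r) := by
            rw [← Nat.choose_symm (by omega)]; congr 1; omega
        _ ≤ a.choose (a - r) := Nat.choose_le_choose _ (by omega)
        _ = a.choose r := Nat.choose_symm (by omega)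
    have h2 : (a - s).choose (r - i - s) ≤ a.choose (r - i) := by
      calc (a - s).choose (r - i - s) = (a - s).choose (a - (r - i)) := by
            rw [← Nat.choose_symm (by omega)]; congr 1; omega
        _ ≤ a.choose (a - (r - i)) := Nat.choose_le_choose _ (by omega)
        _ = a.choose (r - i) := Nat.choose_symm (by omega)
    -- Pascal's rule peels off the sets avoiding one point of the `s`-set; the rest has the same
    -- shape with `a`, `r`, `s` each lowered by one, which is what the recursive form feeds on.
    rw [Nat.add_sub_add_right, Nat.choose_succ_succ', Nat.add_sub_add_right] at hcard
    have key := add_le_card_iterate_shadow (a := a.choose r - (a - s).choose (r - s))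
      (b := a.choose (r - i) - (a - s).choose (r - i - s)) (i := i) h𝒜 (m := a)
      (by omega) (by omega) (by omega) (by omega) (by omega) ?_
    · rw [Nat.add_sub_add_right, e1, Nat.choose_succ_succ', e2]
      rw [e1] at key
      omega
    · intro ℬ hℬ hc
      exact ih ((Set.sized_powersetCard _ _).mono hℬ) (by omega) (by omega) (by omega) hc

/-- The local LYM inequality inside a subset of the ground set. -/
theorem card_mul_le_card_shadow_mul_of_subset {α : Type*} [DecidableEq α] {S : Finset α} {r : ℕ}
    {ℬ : Finset (Finset α)} (hℬ : ℬ ⊆ powersetCard (r + 1) S) :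
    #ℬ * (r + 1) ≤ #(∂ ℬ) * (#S - r) := by
  refine card_mul_le_card_mul' (· ⊆ ·) (fun s hs => ?_) (fun s hs => ?_)
  · have hs' := mem_powersetCard.1 (hℬ hs)
    rw [← hs'.2, ← card_image_of_injOn s.erase_injOn]
    refine card_le_card ?_
    simp_rw [image_subset_iff, mem_bipartiteBelow]
    exact fun a ha => ⟨erase_mem_shadow hs ha, erase_subset _ _⟩
  · obtain ⟨A, hA, a, haA, rfl⟩ := mem_shadow_iff.1 hs
    have hA' := mem_powersetCard.1 (hℬ hA)
    have hc : #(A.erase a) = r := by rw [card_erase_of_mem haA, hA'.2]; rfl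
    have hsubS : A.erase a ⊆ S := (erase_subset _ _).trans hA'.1
    rw [← hc, ← card_sdiff_of_subset hsubS]
    refine le_trans (card_le_card (t := (S \ A.erase a).image fun b => insert b (A.erase a)) ?_)
      card_image_le
    intro B hB
    rw [mem_bipartiteAbove] at hB
    have hB' := mem_powersetCard.1 (hℬ hB.1)
    obtain ⟨b, hb, hbB⟩ := (covBy_iff_card_sdiff_eq_one.2 ⟨hB.2, by
      rw [card_sdiff_of_subset hB.2, hB'.2, hc]; omega⟩).exists_finset_insert
    refine mem_image.2 ⟨b, mem_sdiff.2 ⟨hB'.1 (hbB ▸ mem_insert_self _ _), hb⟩, hbB⟩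

/-- Iterated local LYM: the density of a family within its level of `S` does not decrease on passing
to shadows. -/
theorem card_mul_choose_le_card_iterate_shadow_mul {α : Type*} [DecidableEq α] {S : Finset α}
    {r : ℕ} {ℬ : Finset (Finset α)} (hℬ : ℬ ⊆ powersetCard r S) (hr : r ≤ #S) (i : ℕ)
    (hi : i ≤ r) : #ℬ * (#S).choose (r - i) ≤ #(∂^[i] ℬ) * (#S).choose r := by
  induction i with
  | zero => simp
  | succ i ih =>
    obtain ⟨q, hq⟩ : ∃ q, r - i = q + 1 := ⟨r - i - 1, by omega⟩
    have hq' : r - (i + 1) = q := by omega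
    have ih := ih (by omega)
    have hsub : ∂^[i] ℬ ⊆ powersetCard (q + 1) S := by
      intro B hB
      obtain ⟨A, hA, hBA, hc⟩ := mem_shadow_iterate_iff_exists_mem_card_add.1 hB
      have hA' := mem_powersetCard.1 (hℬ hA)
      exact mem_powersetCard.2 ⟨hBA.trans hA'.1, by omega⟩
    have h1 := card_mul_le_card_shadow_mul_of_subset hsub
    have h2 := Nat.choose_succ_right_eq (#S) q
    rw [hq] at ih
    rw [hq', Function.iterate_succ_apply']
    have hpos : 0 < (#S - q) := by omega
    refine Nat.le_of_mul_le_mul_right (c := #S - q) ?_ hpos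
    calc #ℬ * (#S).choose q * (#S - q) = #ℬ * (#S).choose (q + 1) * (q + 1) := by
          rw [mul_assoc, ← h2, mul_assoc]
      _ ≤ #(∂^[i] ℬ) * (#S).choose r * (q + 1) := Nat.mul_le_mul_right _ ih
      _ = #(∂^[i] ℬ) * (q + 1) * (#S).choose r := by ring
      _ ≤ #(∂ (∂^[i] ℬ)) * (#S - q) * (#S).choose r := Nat.mul_le_mul_right _ h1
      _ = _ := by ring

/-- Kruskal–Katona, interpolated linearly between consecutive binomial coefficients. -/
theorem chord_le_card_iterate_shadow {n m r i : ℕ} {𝒜 : Finset (Finset (Fin n))}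
    (h𝒜 : (𝒜 : Set (Finset (Fin n))).Sized (r + 1)) (hm : m < n) (hrm : r + 1 ≤ m) (hi : i ≤ r)
    (h1 : m.choose (r + 1) ≤ #𝒜) (h2 : #𝒜 ≤ (m + 1).choose (r + 1)) :
    (#𝒜 - m.choose (r + 1)) * m.choose (r - i) + m.choose (r + 1 - i) * m.choose r
      ≤ #(∂^[i] 𝒜) * m.choose r := by
  set a := #𝒜 - m.choose (r + 1) with ha
  set x := m.choose (r - i)
  set y := m.choose r with hy
  have hypos : 0 < y := Nat.choose_pos (by omega)
  rw [Nat.choose_succ_succ'] at h2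
  -- The value of `b` is the ceiling of `a * x / y`, the integer bound that normalized matching
  -- gives for the link.
  have key := add_le_card_iterate_shadow (a := a) (b := (a * x + y - 1) / y) h𝒜 hm hrm hi
    (by omega) (by omega) ?_
  · have h3 : a * x ≤ (a * x + y - 1) / y * y := by
      have := Nat.lt_div_mul_add (a := a * x + y - 1) hypos
      omega
    calc a * x + m.choose (r + 1 - i) * y
        ≤ (a * x + y - 1) / y * y + m.choose (r + 1 - i) * y := by omega
      _ = (m.choose (r + 1 - i) + (a * x + y - 1) / y) * y := by ring
      _ ≤ _ := Nat.mul_le_mul_right _ key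
  · intro ℬ hℬ hc
    have hI : #(initialPart n m) = m := card_initialPart hm.le
    have h4 := card_mul_choose_le_card_iterate_shadow_mul hℬ (by omega) i hi
    rw [hI] at h4
    have h5 : a * x ≤ #(∂^[i] ℬ) * y := (Nat.mul_le_mul_right _ hc).trans h4
    rw [← Nat.lt_succ_iff, Nat.div_lt_iff_lt_mul hypos, Nat.succ_mul]
    omega

/-! ### Kruskal–Katona for up-sets. -/

/-- The `j`-element subsets of `S` that contain a member of `𝒜`. -/
def upAt {α : Type*} [DecidableEq α] (S : Finset α) (j : ℕ) (𝒜 : Finset (Finset α)) :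
    Finset (Finset α) :=
  (powersetCard j S).filter fun B => ∃ A ∈ 𝒜, A ⊆ B

theorem mem_upAt {α : Type*} [DecidableEq α] {S : Finset α} {j : ℕ} {𝒜 : Finset (Finset α)}
    {B : Finset α} : B ∈ upAt S j 𝒜 ↔ (B ⊆ S ∧ #B = j) ∧ ∃ A ∈ 𝒜, A ⊆ B := by
  simp [upAt, mem_powersetCard]

theorem card_image_sdiff {α : Type*} [DecidableEq α] {S : Finset α} {𝒜 : Finset (Finset α)}
    (h : ∀ A ∈ 𝒜, A ⊆ S) : #(𝒜.image (S \ ·)) = #𝒜 := by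
  refine card_image_of_injOn fun A hA B hB hAB => ?_
  have := congrArg (S \ ·) hAB
  simpa only [Finset.sdiff_sdiff_eq_self (h A hA), Finset.sdiff_sdiff_eq_self (h B hB)] using this

theorem sized_image_sdiff {α : Type*} [DecidableEq α] {S : Finset α} {k : ℕ}
    {𝒜 : Finset (Finset α)} (h : 𝒜 ⊆ powersetCard k S) :
    ((𝒜.image (S \ ·) : Finset (Finset α)) : Set (Finset α)).Sized (#S - k) := by
  intro B hB
  obtain ⟨A, hA, rfl⟩ := mem_image.1 (mem_coe.1 hB)
  have := mem_powersetCard.1 (h hA)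
  rw [card_sdiff_of_subset this.1, this.2]

/-- Complementation inside `S` turns supersets into subsets, so every lower bound for iterated
shadows becomes one for upward closures. -/
theorem card_iterate_shadow_le_card_upAt {α : Type*} [DecidableEq α] {S : Finset α} {k j : ℕ}
    {𝒜 : Finset (Finset α)} (h : 𝒜 ⊆ powersetCard k S) (hkj : k ≤ j) (hj : j ≤ #S) :
    #(∂^[j - k] (𝒜.image (S \ ·))) ≤ #(upAt S j 𝒜) := by
  have hmem : ∀ B ∈ ∂^[j - k] (𝒜.image (S \ ·)), B ⊆ S ∧ S \ B ∈ upAt S j 𝒜 := by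
    intro B hB
    obtain ⟨A', hA', hBA, hc⟩ := mem_shadow_iterate_iff_exists_mem_card_add.1 hB
    obtain ⟨A, hA, rfl⟩ := mem_image.1 hA'
    have hAS := mem_powersetCard.1 (h hA)
    have hBS : B ⊆ S := hBA.trans sdiff_subset
    refine ⟨hBS, mem_upAt.2 ⟨⟨sdiff_subset, ?_⟩, A, hA, ?_⟩⟩
    · rw [card_sdiff_of_subset hAS.1, hAS.2] at hc
      rw [card_sdiff_of_subset hBS]
      omega
    · intro a ha
      exact mem_sdiff.2 ⟨hAS.1 ha, fun hb => (mem_sdiff.1 (hBA hb)).2 ha⟩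
  refine card_le_card_of_injOn (S \ ·) (fun B hB => (hmem B hB).2) ?_
  intro B hB C hC hBC
  have := congrArg (S \ ·) hBC
  simpa only [Finset.sdiff_sdiff_eq_self (hmem B hB).1,
    Finset.sdiff_sdiff_eq_self (hmem C hC).1] using this

theorem choose_le_card_upAt {n k j m : ℕ} {S : Finset (Fin n)} {𝒜 : Finset (Finset (Fin n))}
    (h : 𝒜 ⊆ powersetCard k S) (hkj : k ≤ j) (hj : j ≤ #S) (hm : #S - k ≤ m) (hmn : m ≤ n)
    (hc : m.choose (#S - k) ≤ #𝒜) : m.choose (#S - j) ≤ #(upAt S j 𝒜) := by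
  refine le_trans ?_ (card_iterate_shadow_le_card_upAt h hkj hj)
  have := kruskal_katona_lovasz_form (i := j - k) (by omega) hm hmn (sized_image_sdiff h)
    (by rwa [card_image_sdiff fun A hA => (mem_powersetCard.1 (h hA)).1])
  rwa [show #S - k - (j - k) = #S - j by omega] at this

theorem choose_sub_choose_le_card_upAt {n k j s a : ℕ} {S : Finset (Fin n)}
    {𝒜 : Finset (Finset (Fin n))} (h : 𝒜 ⊆ powersetCard k S) (hkj : k ≤ j) (hj : j + s ≤ #S)
    (ha : #S - k + 1 ≤ a) (han : a ≤ n)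
    (hc : a.choose (#S - k) - (a - s).choose (#S - k - s) ≤ #𝒜) :
    a.choose (#S - j) - (a - s).choose (#S - j - s) ≤ #(upAt S j 𝒜) := by
  refine le_trans ?_ (card_iterate_shadow_le_card_upAt h hkj (by omega))
  have := sub_le_card_iterate_shadow (i := j - k) s (sized_image_sdiff h) han ha (by omega)
    (by rwa [card_image_sdiff fun A hA => (mem_powersetCard.1 (h hA)).1])
  rwa [show #S - k - (j - k) = #S - j by omega] at this

/-- Needed where the family size falls between two binomial coefficients and rounding down to the
smaller one would lose too much. -/
theorem chord_le_card_upAt {n k j m : ℕ} {S : Finset (Fin n)} {𝒜 : Finset (Finset (Fin n))}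
    (h : 𝒜 ⊆ powersetCard k S) (hkj : k ≤ j) (hj : j < #S) (hm : #S - k ≤ m) (hmn : m < n)
    (h1 : m.choose (#S - k) ≤ #𝒜) (h2 : #𝒜 ≤ (m + 1).choose (#S - k)) :
    (#𝒜 - m.choose (#S - k)) * m.choose (#S - j - 1) + m.choose (#S - j) * m.choose (#S - k - 1)
      ≤ #(upAt S j 𝒜) * m.choose (#S - k - 1) := by
  refine le_trans ?_ (Nat.mul_le_mul_right _ (card_iterate_shadow_le_card_upAt h hkj hj.le))
  obtain ⟨r, hr⟩ : ∃ r, #S - k = r + 1 := ⟨#S - k - 1, by omega⟩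
  have hs := sized_image_sdiff h
  have hcard := card_image_sdiff fun A hA => (mem_powersetCard.1 (h hA)).1
  rw [hr] at hs hm h1 h2 ⊢
  rw [← hcard] at h1 h2
  have := chord_le_card_iterate_shadow (i := j - k) hs hmn hm (by omega) h1 h2
  rw [hcard] at this
  rwa [show r - (j - k) = #S - j - 1 by omega, show r + 1 - (j - k) = #S - j by omega] at this

/-! ### Spectral analysis on the levels of the Boolean lattice. -/

section Johnson

variable {α : Type*} [Fintype α] [DecidableEq α]

/-- Sum of the values of `g` over the sets obtained from `C` by adding an element. -/
def sumInsert (g : Finset α → ℝ) (C : Finset α) : ℝ := ∑ b ∈ Cᶜ, g (insert b C)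

/-- Sum of the values of `g` over the sets obtained from `A` by deleting an element. -/
def sumErase (g : Finset α → ℝ) (A : Finset α) : ℝ := ∑ a ∈ A, g (A.erase a)

theorem sum_sum_erase_eq (Φ : Finset α → Finset α → ℝ) (j : ℕ) :
    ∑ A ∈ powersetCard (j + 1) (univ : Finset α), ∑ a ∈ A, Φ A (A.erase a)
      = ∑ C ∈ powersetCard j (univ : Finset α), ∑ b ∈ Cᶜ, Φ (insert b C) C := by
  rw [sum_sigma', sum_sigma']
  refine sum_bij' (fun x _ => ⟨x.1.erase x.2, x.2⟩) (fun x _ => ⟨insert x.2 x.1, x.2⟩) ?_ ?_ ?_ ?_ ?_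
  · rintro ⟨A, a⟩ h
    simp only [mem_sigma, mem_powersetCard_univ] at h
    simp [card_erase_of_mem h.2, h.1]
  · rintro ⟨C, b⟩ h
    simp only [mem_sigma, mem_powersetCard_univ, mem_compl] at h
    simp [card_insert_of_notMem h.2, h.1]
  · rintro ⟨A, a⟩ h
    simp only [mem_sigma, mem_powersetCard_univ] at h
    simp [insert_erase h.2]
  · rintro ⟨C, b⟩ h
    simp only [mem_sigma, mem_powersetCard_univ, mem_compl] at h
    simp [erase_insert h.2]
  · rintro ⟨A, a⟩ h
    simp only [mem_sigma, mem_powersetCard_univ] at h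
    simp [insert_erase h.2]

/-- The commutation relation of the raising and lowering operators: exchanging a point for another
is the same in either order, and only the diagonal terms differ, n - |C| against |C|. -/
theorem sumInsert_sumErase (g : Finset α → ℝ) (C : Finset α) :
    sumInsert (sumErase g) C
      = sumErase (sumInsert g) C + ((Fintype.card α : ℝ) - 2 * #C) * g C := by
  have h1 : sumInsert (sumErase g) C
      = ∑ b ∈ Cᶜ, (g C + ∑ a ∈ C, g (insert b (C.erase a))) := by
    refine sum_congr rfl fun b hb => ?_
    rw [mem_compl] at hb
    rw [sumErase, sum_insert hb, erase_insert hb]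
    congr 1
    refine sum_congr rfl fun a ha => ?_
    rw [erase_insert_of_ne]
    rintro rfl
    exact hb ha
  have h2 : sumErase (sumInsert g) C
      = ∑ a ∈ C, (g C + ∑ b ∈ Cᶜ, g (insert b (C.erase a))) := by
    refine sum_congr rfl fun a ha => ?_
    have : (C.erase a)ᶜ = insert a Cᶜ := by
      ext x; by_cases hx : x = a <;> simp [hx]
    rw [sumInsert, this, sum_insert (by simpa using ha), insert_erase ha]
  have h3 : (#Cᶜ : ℝ) = Fintype.card α - #C := by
    rw [card_compl, Nat.cast_sub (card_le_univ C)]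
  rw [h1, h2, sum_add_distrib, sum_add_distrib, sum_const, sum_const, nsmul_eq_mul, nsmul_eq_mul,
    sum_comm, h3]
  ring

/-- The two operators are adjoint to each other. -/
theorem sum_mul_sumErase (g h : Finset α → ℝ) (j : ℕ) :
    ∑ A ∈ powersetCard (j + 1) (univ : Finset α), h A * sumErase g A
      = ∑ C ∈ powersetCard j (univ : Finset α), sumInsert h C * g C := by
  have := sum_sum_erase_eq (fun A C => h A * g C) j
  simpa only [sumErase, sumInsert, mul_sum, sum_mul] using this

theorem sum_sumErase_sq (g : Finset α → ℝ) (r : ℕ) :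
    ∑ A ∈ powersetCard (r + 2) (univ : Finset α), sumErase g A ^ 2
      = ∑ B ∈ powersetCard r (univ : Finset α), sumInsert g B ^ 2
        + ((Fintype.card α : ℝ) - 2 * (r + 1)) *
          ∑ C ∈ powersetCard (r + 1) (univ : Finset α), g C ^ 2 := by
  have h1 : ∑ A ∈ powersetCard (r + 2) (univ : Finset α), sumErase g A ^ 2
      = ∑ C ∈ powersetCard (r + 1) (univ : Finset α), sumInsert (sumErase g) C * g C := by
    rw [← sum_mul_sumErase]
    exact sum_congr rfl fun A _ => sq _
  have h2 : ∑ B ∈ powersetCard r (univ : Finset α), sumInsert g B ^ 2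
      = ∑ C ∈ powersetCard (r + 1) (univ : Finset α), g C * sumErase (sumInsert g) C := by
    rw [sum_mul_sumErase]
    exact sum_congr rfl fun A _ => sq _
  rw [h1, h2, mul_sum, ← sum_add_distrib]
  refine sum_congr rfl fun C hC => ?_
  rw [mem_powersetCard_univ] at hC
  rw [sumInsert_sumErase, hC]
  push_cast
  ring

/-- Sum of `h` over the `j`-element sets that contain `i`. -/
def marginal (j : ℕ) (h : Finset α → ℝ) (i : α) : ℝ :=
  ∑ A ∈ powersetCard j (univ : Finset α) with i ∈ A, h A

theorem marginal_sumInsert (j : ℕ) (h : Finset α → ℝ) (i : α) :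
    marginal j (sumInsert h) i = j * marginal (j + 1) h i := by
  have := sum_sum_erase_eq (fun A C => if i ∈ C then h A else 0) j
  rw [marginal, marginal, sum_filter, sum_filter, mul_sum]
  calc _ = ∑ C ∈ powersetCard j (univ : Finset α), ∑ b ∈ Cᶜ, (if i ∈ C then h (insert b C) else 0) := by
        refine sum_congr rfl fun C _ => ?_
        split_ifs <;> simp [sumInsert]
    _ = _ := by
        rw [← this]
        refine sum_congr rfl fun A hA => ?_
        rw [mem_powersetCard_univ] at hA
        rw [← sum_filter, sum_const, nsmul_eq_mul]
        by_cases hi : i ∈ A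
        · have : A.filter (fun a => i ∈ A.erase a) = A.erase i := by
            ext a
            simp only [mem_filter, mem_erase]
            constructor
            · rintro ⟨h1, h2, -⟩; exact ⟨fun h => h2 h.symm, h1⟩
            · rintro ⟨h1, h2⟩; exact ⟨h2, fun h => h1 h.symm, hi⟩
          rw [this, card_erase_of_mem hi, hA, if_pos hi]
          simp
        · have : A.filter (fun a => i ∈ A.erase a) = ∅ := by
            ext a
            simp [hi]
          rw [this, if_neg hi]
          simp

theorem sum_marginal_mul (j : ℕ) (h : Finset α → ℝ) (c : α → ℝ) :
    ∑ A ∈ powersetCard j (univ : Finset α), h A * ∑ i ∈ A, c i = ∑ i, c i * marginal j h i := by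
  simp only [marginal, sum_filter, mul_sum]
  rw [sum_comm]
  refine sum_congr rfl fun A _ => ?_
  rw [← sum_filter_add_sum_filter_not univ (fun i => i ∈ A) (fun i => c i * if i ∈ A then h A else 0),
    sum_eq_zero (s := univ.filter fun i => i ∉ A), add_zero, filter_mem_eq_inter, univ_inter]
  · refine sum_congr rfl fun i hi => ?_
    rw [if_pos hi, mul_comm]
  · intro i hi
    rw [if_neg (mem_filter.1 hi).2, mul_zero]

theorem sum_marginal (j : ℕ) (h : Finset α → ℝ) :
    ∑ i, marginal j h i = j * ∑ A ∈ powersetCard j (univ : Finset α), h A := by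
  have := sum_marginal_mul j h (fun _ => 1)
  simp only [one_mul] at this
  rw [← this, mul_sum]
  refine sum_congr rfl fun A hA => ?_
  rw [mem_powersetCard_univ] at hA
  simp [hA, mul_comm]

/-- A function all of whose marginals vanish contracts under `sumInsert`. -/
theorem sum_sumInsert_sq_le (r : ℕ) (hn : (r : ℝ) + 3 ≤ Fintype.card α) : ∀ h : Finset α → ℝ, (∀ i, marginal (r + 2) h i = 0) →
    ∑ B ∈ powersetCard (r + 1) (univ : Finset α), sumInsert h B ^ 2
      ≤ r * ((Fintype.card α : ℝ) - r - 3) *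
        ∑ A ∈ powersetCard (r + 2) (univ : Finset α), h A ^ 2 := by
  induction r with
  | zero =>
    intro h hh
    -- On singletons `sumInsert h` is itself a vertex marginal, up to a nonzero factor a marginal of
    -- `h`, so it vanishes.
    have : ∀ B ∈ powersetCard (0 + 1) (univ : Finset α), sumInsert h B ^ 2 = 0 := by
      intro B hB
      rw [mem_powersetCard_univ, zero_add, card_eq_one] at hB
      obtain ⟨x, rfl⟩ := hB
      have h1 := marginal_sumInsert 1 h x
      rw [show marginal (1 + 1) h x = 0 from hh x, mul_zero, marginal] at h1
      have h2 : (powersetCard 1 (univ : Finset α)).filter (fun A => x ∈ A) = {{x}} := by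
        ext A
        simp only [mem_filter, mem_powersetCard_univ, mem_singleton]
        constructor
        · rintro ⟨hA, hx⟩
          obtain ⟨y, rfl⟩ := card_eq_one.1 hA
          rw [mem_singleton.1 hx]
        · rintro rfl; simp
      rw [h2, sum_singleton] at h1
      rw [h1]; norm_num
    rw [sum_eq_zero this]
    simp
  | succ r ih =>
    intro h hh
    have hg : ∀ i, marginal (r + 2) (sumInsert h) i = 0 := fun i => by
      rw [marginal_sumInsert, show r + 2 + 1 = r + 1 + 2 from rfl, hh i, mul_zero]
    have h1 := ih (by push_cast at hn; linarith) _ hg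
    have h2 := sum_sumErase_sq (sumInsert h) (r + 1)
    have h3 := sum_mul_sumErase (sumInsert h) h (r + 2)
    set G := ∑ C ∈ powersetCard (r + 2) (univ : Finset α), sumInsert h C ^ 2 with hG
    set H := ∑ A ∈ powersetCard (r + 3) (univ : Finset α), h A ^ 2 with hH
    set c : ℝ := (r + 1) * ((Fintype.card α : ℝ) - r - 4) with hc
    have h4 : ∑ A ∈ powersetCard (r + 3) (univ : Finset α), sumErase (sumInsert h) A ^ 2 ≤ c * G := by
      have e : r + 1 + 2 = r + 3 := rfl
      rw [e] at h2
      rw [h2, hc]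
      push_cast
      change _ + _ * G ≤ _
      linarith
    -- Cauchy–Schwarz after moving one operator across by adjointness. The constant closes up
    -- because r(n-r-3) + (n-2r-4) = (r+1)(n-r-4).
    have h5 : G ^ 2 ≤ H * (c * G) := by
      have h6 := sum_mul_sq_le_sq_mul_sq (powersetCard (r + 3) (univ : Finset α)) h
        (sumErase (sumInsert h))
      have h7 : G = ∑ A ∈ powersetCard (r + 2 + 1) (univ : Finset α),
          h A * sumErase (sumInsert h) A := by
        rw [h3, hG]
        exact sum_congr rfl fun C _ => sq _
      rw [h7]
      refine h6.trans ?_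
      rw [← h7]
      exact mul_le_mul_of_nonneg_left h4 (sum_nonneg fun _ _ => sq_nonneg _)
    have hG0 : 0 ≤ G := sum_nonneg fun _ _ => sq_nonneg _
    have hc0 : 0 ≤ c := by
      rw [hc]
      push_cast at hn
      exact mul_nonneg (by positivity) (by linarith)
    have hgoal : G ≤ c * H := by
      rcases hG0.eq_or_lt with h0 | h0
      · rw [← h0]
        exact mul_nonneg hc0 (sum_nonneg fun _ _ => sq_nonneg _)
      · nlinarith
    have e : ((r + 1 : ℕ) : ℝ) * ((Fintype.card α : ℝ) - (r + 1 : ℕ) - 3) = c := by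
      rw [hc]; push_cast; ring
    rw [e]
    exact hgoal

theorem card_filter_subset_powersetCard {β : Type*} [DecidableEq β] {S T : Finset β} (hT : T ⊆ S) {k : ℕ} (hk : #T ≤ k) :
    #((powersetCard k S).filter fun A => T ⊆ A) = (#S - #T).choose (k - #T) := by
  rw [← card_sdiff_of_subset hT, ← card_powersetCard]
  refine card_nbij' (· \ T) (T ∪ ·) ?_ ?_ ?_ ?_
  · intro A hA
    rw [mem_coe, mem_filter, mem_powersetCard] at hA
    exact mem_coe.2 (mem_powersetCard.2 ⟨sdiff_subset_sdiff hA.1.1 subset_rfl,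
      by rw [card_sdiff_of_subset hA.2, hA.1.2]⟩)
  · intro B hB
    have hB := mem_powersetCard.1 (mem_coe.1 hB)
    have hd : Disjoint T B := disjoint_of_subset_right hB.1 disjoint_sdiff
    exact mem_coe.2 (mem_filter.2 ⟨mem_powersetCard.2 ⟨union_subset hT (hB.1.trans sdiff_subset),
      by rw [card_union_of_disjoint hd, hB.2]; omega⟩, subset_union_left⟩)
  · intro A hA
    exact union_sdiff_of_subset (mem_filter.1 (mem_coe.1 hA)).2
  · intro B hB
    have hB := mem_powersetCard.1 (mem_coe.1 hB)
    have hd : Disjoint T B := disjoint_of_subset_right hB.1 disjoint_sdiff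
    exact union_sdiff_cancel_left hd

theorem card_filter_mem_powersetCard (i : α) (j : ℕ) :
    #((powersetCard (j + 1) (univ : Finset α)).filter fun A => i ∈ A)
      = (Fintype.card α - 1).choose j := by
  have := card_filter_subset_powersetCard (subset_univ {i}) (k := j + 1) (by simp)
  simpa using this

theorem marginal_const (j : ℕ) (x : ℝ) (i : α) :
    marginal (j + 1) (fun _ => x) i = (Fintype.card α - 1).choose j * x := by
  rw [marginal, sum_const, card_filter_mem_powersetCard, nsmul_eq_mul]

/-- The diagonal pair contributes C(n-1,j+1) and each other point C(n-2,j); as `c` sums to zero the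
others contribute -C(n-2,j) `c i` in total, and Pascal's rule leaves an eigenvalue. -/
theorem marginal_linear (j : ℕ) (hn : 2 ≤ Fintype.card α) (c : α → ℝ) (hc : ∑ i, c i = 0) (i : α) :
    marginal (j + 2) (fun A => ∑ m ∈ A, c m) i = (Fintype.card α - 2).choose (j + 1) * c i := by
  obtain ⟨N, hN⟩ : ∃ N, Fintype.card α = N + 2 := ⟨_, (Nat.sub_add_cancel hn).symm⟩
  have h1 : marginal (j + 2) (fun A => ∑ m ∈ A, c m) i
      = ∑ m, c m * #((powersetCard (j + 2) (univ : Finset α)).filter fun A => i ∈ A ∧ m ∈ A) := by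
    have := sum_marginal_mul (j + 2) (fun A => if i ∈ A then (1 : ℝ) else 0) c
    rw [marginal, sum_filter]
    calc _ = ∑ A ∈ powersetCard (j + 2) (univ : Finset α),
          (if i ∈ A then (1 : ℝ) else 0) * ∑ m ∈ A, c m := by
          refine sum_congr rfl fun A _ => ?_
          split_ifs <;> simp
      _ = _ := by
          rw [this]
          refine sum_congr rfl fun m _ => ?_
          rw [marginal, ← sum_filter, filter_filter, sum_const, nsmul_eq_mul, mul_one]
          congr 3
          ext A
          simp [and_comm]
  have h2 : ∀ m ∈ univ.erase i,
      (#((powersetCard (j + 2) (univ : Finset α)).filter fun A => i ∈ A ∧ m ∈ A) : ℝ)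
        = N.choose j := by
    intro m hm
    have hmi := ne_of_mem_erase hm
    have hp : #({i, m} : Finset α) = 2 := card_pair hmi.symm
    have := card_filter_subset_powersetCard (subset_univ {i, m}) (k := j + 2) (by omega)
    rw [hp, card_univ, hN] at this
    rw [show N + 2 - 2 = N by omega, show j + 2 - 2 = j by omega] at this
    rw [← this]
    congr 3
    ext A
    simp [insert_subset_iff]
  rw [h1, ← add_sum_erase _ _ (mem_univ i), sum_congr rfl fun m hm => by rw [h2 m hm], ← sum_mul]
  have h3 : ∑ m ∈ univ.erase i, c m = - c i := by
    have := add_sum_erase univ c (mem_univ i)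
    linarith
  have h4 : #((powersetCard (j + 2) (univ : Finset α)).filter fun A => i ∈ A ∧ i ∈ A)
      = (N + 1).choose (j + 1) := by
    have := card_filter_mem_powersetCard i (j + 1)
    rw [hN] at this
    simpa using this
  rw [h3, h4, hN, Nat.choose_succ_succ', Nat.add_sub_cancel]
  push_cast
  ring

/-- The spectral inequality: the sum of squared degrees on the level below is controlled by the
total weight, the weight on linear functions, and the remaining weight. -/
theorem sum_sumInsert_sq_le_of_degrees (r : ℕ) (hn : r + 5 ≤ Fintype.card α) (f : Finset α → ℝ)
    {a s W : ℝ} (ha : a = ∑ A ∈ powersetCard (r + 3) (univ : Finset α), f A)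
    (hs : s = ∑ A ∈ powersetCard (r + 3) (univ : Finset α), f A ^ 2)
    (hW : W = (∑ i, (marginal (r + 3) f i - (r + 3) * a / Fintype.card α) ^ 2) /
      (Fintype.card α - 2).choose (r + 2)) :
    ∑ B ∈ powersetCard (r + 2) (univ : Finset α), sumInsert f B ^ 2
      ≤ (r + 3) * ((Fintype.card α : ℝ) - r - 2) * (a ^ 2 / (Fintype.card α).choose (r + 3))
        + (Fintype.card α - r - 3) * (r + 2) * W
        + (r + 1) * (Fintype.card α - r - 4) *
          (s - a ^ 2 / (Fintype.card α).choose (r + 3) - W) := by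
  obtain ⟨N, hN⟩ : ∃ N, Fintype.card α = N + r + 5 := ⟨Fintype.card α - (r + 5), by omega⟩
  set D : ℝ := (((Fintype.card α - 2).choose (r + 2) : ℕ) : ℝ) with hD
  set K : ℝ := (((Fintype.card α).choose (r + 3) : ℕ) : ℝ) with hK
  set n : ℝ := (Fintype.card α : ℝ) with hn'
  have hnN : n = N + r + 5 := by rw [hn', hN]; push_cast; ring
  have hDpos : 0 < D := by rw [hD]; exact_mod_cast Nat.choose_pos (by omega)
  have hKpos : 0 < K := by rw [hK]; exact_mod_cast Nat.choose_pos (by omega)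
  have hnpos : 0 < n := by rw [hnN]; positivity
  -- Dividing by the eigenvalue of `marginal_linear` makes the affine function `l` have the same
  -- marginals as `f`, so that `h = f - l` has none and the contraction applies to it.
  set c : α → ℝ := fun i => (marginal (r + 3) f i - (r + 3) * a / n) / D with hc
  have hcard : (∑ _i : α, (1 : ℝ)) = n := by simp [hn']
  have hc0 : ∑ i, c i = 0 := by
    rw [hc, ← sum_div, sum_sub_distrib, sum_marginal, ← ha]
    simp only [sum_const, card_univ, nsmul_eq_mul]
    rw [← hn']
    push_cast
    field_simp
    ring
  set l : Finset α → ℝ := fun A => a / K + ∑ i ∈ A, c i with hl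
  set h : Finset α → ℝ := fun A => f A - l A with hh
  have hfl : ∀ A, f A = l A + h A := fun A => by rw [hh]; ring
  have hmadd : ∀ (j : ℕ) (u v : Finset α → ℝ) (i : α),
      marginal j (fun A => u A + v A) i = marginal j u i + marginal j v i := fun j u v i => by
    simp only [marginal, sum_add_distrib]
  have hml : ∀ i, marginal (r + 3) l i = marginal (r + 3) f i := by
    intro i
    rw [hl, hmadd, marginal_const, marginal_linear (r + 1) (by omega) c hc0]
    change _ + D * c i = _
    rw [hc]
    have h1 : (((Fintype.card α - 1).choose (r + 2) : ℕ) : ℝ) * n = K * (r + 3) := by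
      have := Nat.add_one_mul_choose_eq (Fintype.card α - 1) (r + 2)
      rw [Nat.sub_add_cancel (by omega)] at this
      rw [hK, hn', mul_comm]
      exact_mod_cast this
    have h2 : (((Fintype.card α - 1).choose (r + 2) : ℕ) : ℝ) = K * (r + 3) / n := by
      field_simp; exact h1
    rw [h2]
    field_simp
    ring
  have hmh : ∀ i, marginal (r + 3) h i = 0 := by
    intro i
    have := hmadd (r + 3) l h i
    rw [← funext hfl, hml] at this
    linarith
  have htot : ∑ A ∈ powersetCard (r + 3) (univ : Finset α), h A = 0 := by
    have := sum_marginal (r + 3) h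
    rw [sum_congr rfl fun i _ => hmh i, sum_const_zero] at this
    have h3 : ((r + 3 : ℕ) : ℝ) ≠ 0 := by positivity
    exact (mul_eq_zero.1 this.symm).resolve_left h3
  -- orthogonality of linear functions to functions with vanishing marginals
  have horth : ∀ (j : ℕ) (u : Finset α → ℝ) (x : ℝ) (e : α → ℝ), (∀ i, marginal (j + 1) u i = 0) →
      ∑ A ∈ powersetCard (j + 1) (univ : Finset α), u A * (x + ∑ i ∈ A, e i) = 0 := by
    intro j u x e hu
    have h1 : ∑ A ∈ powersetCard (j + 1) (univ : Finset α), u A = 0 := by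
      have := sum_marginal (j + 1) u
      rw [sum_congr rfl fun i _ => hu i, sum_const_zero] at this
      have h3 : ((j + 1 : ℕ) : ℝ) ≠ 0 := by positivity
      exact (mul_eq_zero.1 this.symm).resolve_left h3
    simp only [mul_add, sum_add_distrib]
    rw [← sum_mul, h1, sum_marginal_mul, sum_congr rfl fun i _ => by rw [hu i, mul_zero]]
    simp
  -- second moment of a linear function
  have hmom : ∀ (j : ℕ) (x : ℝ),
      ∑ A ∈ powersetCard (j + 2) (univ : Finset α), (x + ∑ i ∈ A, c i) ^ 2
        = (Fintype.card α).choose (j + 2) * x ^ 2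
          + (Fintype.card α - 2).choose (j + 1) * ∑ i, c i ^ 2 := by
    intro j x
    have h1 : ∑ A ∈ powersetCard (j + 2) (univ : Finset α), ∑ i ∈ A, c i = 0 := by
      have := sum_marginal_mul (j + 2) (fun _ => (1 : ℝ)) c
      simp only [one_mul] at this
      rw [this, sum_congr rfl fun i _ => by rw [marginal_const], ← sum_mul, hc0, zero_mul]
    have h2 := sum_marginal_mul (j + 2) (fun A => ∑ i ∈ A, c i) c
    simp only [marginal_linear j (show 2 ≤ Fintype.card α by omega) c hc0] at h2
    have h3 : ∀ A : Finset α, (x + ∑ i ∈ A, c i) ^ 2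
        = x ^ 2 + 2 * x * ∑ i ∈ A, c i + (∑ i ∈ A, c i) * ∑ i ∈ A, c i := fun A => by ring
    rw [sum_congr rfl fun A _ => h3 A, sum_add_distrib, sum_add_distrib, ← mul_sum, h1, h2,
      sum_const, card_powersetCard, card_univ, nsmul_eq_mul, mul_zero, add_zero, mul_sum]
    congr 1
    exact sum_congr rfl fun i _ => by ring
  have hWc : D * ∑ i, c i ^ 2 = W := by
    have h1 : ∑ i, c i ^ 2
        = (∑ i, (marginal (r + 3) f i - (r + 3) * a / n) ^ 2) / D ^ 2 := by
      rw [sum_div]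
      exact sum_congr rfl fun i _ => div_pow _ _ _
    rw [h1, hW]
    generalize ∑ i, (marginal (r + 3) f i - (r + 3) * a / n) ^ 2 = X
    field_simp
  have hsq : ∑ A ∈ powersetCard (r + 3) (univ : Finset α), h A ^ 2 = s - a ^ 2 / K - W := by
    have h1 := horth (r + 2) h (a / K) c hmh
    have h2 := hmom (r + 1) (a / K)
    have h3 : s = ∑ A ∈ powersetCard (r + 3) (univ : Finset α),
        (l A ^ 2 + 2 * (h A * l A) + h A ^ 2) := by
      rw [hs]
      exact sum_congr rfl fun A _ => by rw [hfl A]; ring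
    rw [sum_add_distrib, sum_add_distrib, ← mul_sum] at h3
    have h4 : K * (a / K) ^ 2 = a ^ 2 / K := by field_simp
    change ∑ A ∈ powersetCard (r + 3) (univ : Finset α), l A ^ 2 = K * _ + D * _ at h2
    change ∑ A ∈ powersetCard (r + 3) (univ : Finset α), h A * l A = 0 at h1
    rw [h1, h2, h4, hWc] at h3
    linarith
  have hdl : ∀ B ∈ powersetCard (r + 2) (univ : Finset α), sumInsert l B
      = (n - r - 3) * ((n - r - 2) / (n - r - 3) * (a / K) + ∑ i ∈ B, c i) := by
    intro B hB
    rw [mem_powersetCard_univ] at hB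
    have h1 : sumInsert l B = ∑ b ∈ Bᶜ, (a / K + (c b + ∑ i ∈ B, c i)) :=
      sum_congr rfl fun b hb => by
        rw [mem_compl] at hb
        rw [hl]
        simp only
        rw [sum_insert hb]
    have h2 : ∑ b ∈ Bᶜ, c b = - ∑ b ∈ B, c b := by
      have := sum_add_sum_compl B c
      linarith
    have h3 : (#Bᶜ : ℝ) = n - (r + 2) := by
      rw [card_compl, hB, Nat.cast_sub (by omega)]; push_cast; rw [hn']
    have h4 : n - r - 3 ≠ 0 := by rw [hnN]; ring_nf; positivity
    rw [h1, sum_add_distrib, sum_add_distrib, sum_const, sum_const, h2, nsmul_eq_mul, nsmul_eq_mul,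
      h3]
    field_simp
    ring
  have hmdh : ∀ i, marginal (r + 2) (sumInsert h) i = 0 := fun i => by
    rw [marginal_sumInsert, show r + 2 + 1 = r + 3 from rfl, hmh i, mul_zero]
  have hdf : ∀ B, sumInsert f B = sumInsert l B + sumInsert h B := fun B => by
    simp only [sumInsert, ← sum_add_distrib]
    exact sum_congr rfl fun b _ => hfl _
  -- The constant, linear and remaining parts of `f` now contribute their eigenvalues
  -- (k'-e)(n-k'-e+1) with k' = r + 3 and e = 0, 1, 2; the last is only an upper bound.
  have hgap := sum_sumInsert_sq_le (r + 1) (by rw [← hn', hnN]; push_cast; linarith [N.cast_nonneg (α := ℝ)]) h hmh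
  have hcross : ∑ B ∈ powersetCard (r + 2) (univ : Finset α), sumInsert h B * sumInsert l B = 0 := by
    have h1 := horth (r + 1) (sumInsert h) ((n - r - 2) / (n - r - 3) * (a / K)) c hmdh
    rw [sum_congr rfl fun B hB => by rw [hdl B hB, mul_left_comm], ← mul_sum]
    change _ * ∑ A ∈ powersetCard (r + 2) (univ : Finset α), _ = 0
    rw [h1, mul_zero]
  have hlin : ∑ B ∈ powersetCard (r + 2) (univ : Finset α), sumInsert l B ^ 2
      = (r + 3) * (n - r - 2) * (a ^ 2 / K) + (n - r - 3) * (r + 2) * W := by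
    have h1 := hmom r ((n - r - 2) / (n - r - 3) * (a / K))
    have h4 : n - r - 3 ≠ 0 := by rw [hnN]; ring_nf; positivity
    rw [sum_congr rfl fun B hB => by rw [hdl B hB, mul_pow], ← mul_sum, h1]
    have h5 : (((Fintype.card α).choose (r + 2) : ℕ) : ℝ) * (n - r - 2) = K * (r + 3) := by
      have := Nat.choose_succ_right_eq (Fintype.card α) (r + 2)
      rw [hK, hn']
      have h6 : ((Fintype.card α - (r + 2) : ℕ) : ℝ) = (Fintype.card α : ℝ) - r - 2 := by
        rw [Nat.cast_sub (by omega)]; push_cast; ring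
      rw [← h6]
      exact_mod_cast this.symm
    have h6 : (((Fintype.card α - 2).choose (r + 1) : ℕ) : ℝ) * (n - r - 3) = D * (r + 2) := by
      have := Nat.choose_succ_right_eq (Fintype.card α - 2) (r + 1)
      rw [hD, hn']
      have h6 : ((Fintype.card α - 2 - (r + 1) : ℕ) : ℝ) = (Fintype.card α : ℝ) - r - 3 := by
        rw [Nat.cast_sub (by omega), Nat.cast_sub (by omega)]; push_cast; ring
      rw [← h6]
      exact_mod_cast this.symm
    rw [← hWc]
    have h7 : (n - r - 3) ^ 2 * (((Fintype.card α).choose (r + 2) : ℕ) *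
        ((n - r - 2) / (n - r - 3) * (a / K)) ^ 2)
        = ((((Fintype.card α).choose (r + 2) : ℕ) : ℝ) * (n - r - 2)) * (n - r - 2) * (a / K) ^ 2 := by
      field_simp
    have h8 : (n - r - 3) ^ 2 * ((((Fintype.card α - 2).choose (r + 1) : ℕ) : ℝ) * ∑ i, c i ^ 2)
        = ((((Fintype.card α - 2).choose (r + 1) : ℕ) : ℝ) * (n - r - 3)) * (n - r - 3) *
          ∑ i, c i ^ 2 := by ring
    rw [mul_add, h7, h8, h5, h6]
    field_simp
  have hexp : ∑ B ∈ powersetCard (r + 2) (univ : Finset α), sumInsert f B ^ 2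
      = ∑ B ∈ powersetCard (r + 2) (univ : Finset α), sumInsert l B ^ 2
        + ∑ B ∈ powersetCard (r + 2) (univ : Finset α), sumInsert h B ^ 2 := by
    have : ∀ B, sumInsert f B ^ 2 = sumInsert l B ^ 2 + 2 * (sumInsert h B * sumInsert l B)
        + sumInsert h B ^ 2 := fun B => by rw [hdf]; ring
    rw [sum_congr rfl fun B _ => this B, sum_add_distrib, sum_add_distrib, ← mul_sum, hcross]
    ring
  rw [hexp, hlin, ← hsq]
  have e : ((r + 1 : ℕ) : ℝ) * (n - (r + 1 : ℕ) - 3) = (r + 1) * (n - r - 4) := by push_cast; ring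
  change _ ≤ ((r + 1 : ℕ) : ℝ) * (n - (r + 1 : ℕ) - 3) * _ at hgap
  rw [e] at hgap
  exact (add_le_add_iff_left _).2 hgap

end Johnson

/-! ### Isoperimetry for two consecutive levels. -/

section Influence

variable {α : Type*} [DecidableEq α]

/-- The number of members of `𝓕` containing `i`. -/
def vertexDegree (𝓕 : Finset (Finset α)) (i : α) : ℕ := #(𝓕.filter fun A => i ∈ A)

/-- The indicator function of a family. -/
def famIndicator (𝓕 : Finset (Finset α)) (A : Finset α) : ℝ := if A ∈ 𝓕 then 1 else 0

theorem famIndicator_sq (𝓕 : Finset (Finset α)) (A : Finset α) :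
    famIndicator 𝓕 A ^ 2 = famIndicator 𝓕 A := by
  rw [famIndicator]; split_ifs <;> norm_num

theorem sumErase_famIndicator (𝓕 : Finset (Finset α)) (B : Finset α) :
    sumErase (famIndicator 𝓕) B = #(B.filter fun a => B.erase a ∈ 𝓕) := by
  simp only [sumErase, famIndicator]
  rw [← sum_filter, sum_const, nsmul_eq_mul, mul_one]

/-- Inserting `i` maps the members of `𝓕` that avoid `i` injectively into the members of `𝓖` through
`i`. -/
theorem card_le_vertexDegree_add {𝓕 𝓖 : Finset (Finset α)}
    (hup : ∀ A ∈ 𝓕, ∀ b ∉ A, insert b A ∈ 𝓖) (i : α) :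
    #𝓕 ≤ vertexDegree 𝓕 i + vertexDegree 𝓖 i := by
  have h1 := card_filter_add_card_filter_not (s := 𝓕) (fun A => i ∈ A)
  have h2 : #(𝓕.filter fun A => i ∉ A) ≤ vertexDegree 𝓖 i := by
    refine card_le_card_of_injOn (insert i) ?_ ?_
    · intro A hA
      have := mem_filter.1 (mem_coe.1 hA)
      exact mem_coe.2 (mem_filter.2 ⟨hup A this.1 i this.2, mem_insert_self _ _⟩)
    · intro A hA B hB hAB
      have hA := (mem_filter.1 (mem_coe.1 hA)).2
      have hB := (mem_filter.1 (mem_coe.1 hB)).2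
      have := congrArg (fun s => s.erase i) hAB
      simpa [erase_insert hA, erase_insert hB] using this
  rw [vertexDegree]
  omega

variable [Fintype α]

theorem sum_famIndicator {𝓕 : Finset (Finset α)} {j : ℕ} (h : 𝓕 ⊆ powersetCard j univ) :
    ∑ A ∈ powersetCard j (univ : Finset α), famIndicator 𝓕 A = #𝓕 := by
  simp only [famIndicator]
  rw [← sum_filter, filter_mem_eq_inter, inter_eq_right.2 h]
  simp

theorem marginal_famIndicator {𝓕 : Finset (Finset α)} {j : ℕ} (h : 𝓕 ⊆ powersetCard j univ)
    (i : α) : marginal j (famIndicator 𝓕) i = vertexDegree 𝓕 i := by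
  simp only [marginal, famIndicator, vertexDegree]
  rw [← sum_filter, filter_filter, sum_const, nsmul_eq_mul, mul_one]
  congr 2
  ext A
  simp only [mem_filter]
  exact ⟨fun ⟨_, h2, h3⟩ => ⟨h3, h2⟩, fun ⟨h1, h2⟩ => ⟨h h1, h2, h1⟩⟩

theorem sum_vertexDegree {𝓕 : Finset (Finset α)} {j : ℕ} (h : 𝓕 ⊆ powersetCard j univ) :
    ∑ i, (vertexDegree 𝓕 i : ℝ) = j * #𝓕 := by
  rw [← sum_famIndicator h, ← sum_marginal]
  exact sum_congr rfl fun i _ => (marginal_famIndicator h i).symm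

theorem sum_sumErase_famIndicator {𝓕 : Finset (Finset α)} {j : ℕ} (h : 𝓕 ⊆ powersetCard j univ)
    : ∑ B ∈ powersetCard (j + 1) (univ : Finset α), sumErase (famIndicator 𝓕) B
      = ((Fintype.card α : ℝ) - j) * #𝓕 := by
  have := sum_mul_sumErase (famIndicator 𝓕) (fun _ => 1) j
  simp only [one_mul] at this
  rw [this, ← sum_famIndicator h, mul_sum]
  refine sum_congr rfl fun C hC => ?_
  rw [mem_powersetCard_univ] at hC
  rw [sumInsert, sum_const, nsmul_eq_mul, mul_one, card_compl, Nat.cast_sub (card_le_univ C), hC]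

variable {𝓕 𝓖 : Finset (Finset α)} {j : ℕ}

/-- Local LYM among the sets through `i`: such a set has n - j extensions, and a set of size j + 1
has only j subsets of size j that keep `i`. -/
theorem vertexDegree_mul_le (h𝓕 : 𝓕 ⊆ powersetCard j univ) (h𝓖 : 𝓖 ⊆ powersetCard (j + 1) univ)
    (hup : ∀ A ∈ 𝓕, ∀ b ∉ A, insert b A ∈ 𝓖) (i : α) :
    ((Fintype.card α : ℝ) - j) * vertexDegree 𝓕 i ≤ j * vertexDegree 𝓖 i := by
  have key := sum_sum_erase_eq (fun _ A => if i ∈ A ∧ A ∈ 𝓕 then (1 : ℝ) else 0) j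
  have hR : ∑ C ∈ powersetCard j (univ : Finset α), ∑ b ∈ Cᶜ, (if i ∈ C ∧ C ∈ 𝓕 then (1 : ℝ) else 0)
      = ((Fintype.card α : ℝ) - j) * vertexDegree 𝓕 i := by
    rw [← marginal_famIndicator h𝓕, marginal, sum_filter, mul_sum]
    refine sum_congr rfl fun C hC => ?_
    rw [mem_powersetCard_univ] at hC
    rw [sum_const, nsmul_eq_mul, card_compl, Nat.cast_sub (card_le_univ C), hC, famIndicator]
    by_cases h1 : i ∈ C <;> by_cases h2 : C ∈ 𝓕 <;> simp [h1, h2]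
  rw [← hR, ← key, ← marginal_famIndicator h𝓖, marginal, sum_filter, mul_sum]
  refine sum_le_sum fun B hB => ?_
  rw [mem_powersetCard_univ] at hB
  by_cases hi : i ∈ B
  · rw [if_pos hi, ← sum_filter, sum_const, nsmul_eq_mul, mul_one, famIndicator]
    by_cases hBG : B ∈ 𝓖
    · rw [if_pos hBG, mul_one]
      have : B.filter (fun a => i ∈ B.erase a ∧ B.erase a ∈ 𝓕) ⊆ B.erase i := by
        intro a ha
        simp only [mem_filter, mem_erase] at ha ⊢
        exact ⟨fun h => ha.2.1.1 h.symm, ha.1⟩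
      have := card_le_card this
      rw [card_erase_of_mem hi, hB] at this
      exact_mod_cast this
    · rw [if_neg hBG, mul_zero, filter_false_of_mem]
      · simp
      · rintro a ha ⟨-, h2⟩
        apply hBG
        have := hup _ h2 a (notMem_erase a B)
        rwa [insert_erase ha] at this
  · rw [if_neg hi, mul_zero]
    refine (sum_eq_zero fun a _ => ?_).le
    rw [if_neg]
    rintro ⟨h1, -⟩
    exact hi (mem_of_mem_erase h1)

theorem le_sum_sumErase_sq (h𝓕 : 𝓕 ⊆ powersetCard j univ) (h𝓖 : 𝓖 ⊆ powersetCard (j + 1) univ)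
    (hup : ∀ A ∈ 𝓕, ∀ b ∉ A, insert b A ∈ 𝓖) :
    (2 * j + 1) * (((Fintype.card α : ℝ) - j) * #𝓕) - j * (j + 1) * #𝓖
      ≤ ∑ B ∈ powersetCard (j + 1) (univ : Finset α), sumErase (famIndicator 𝓕) B ^ 2 := by
  rw [← sum_sumErase_famIndicator h𝓕, ← sum_famIndicator h𝓖, mul_sum, mul_sum, ← sum_sub_distrib]
  refine sum_le_sum fun B _ => ?_
  rw [sumErase_famIndicator]
  set s := #(B.filter fun a => B.erase a ∈ 𝓕) with hs
  by_cases hB : B ∈ 𝓖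
  · rw [famIndicator, if_pos hB, mul_one]
    -- No integer lies strictly between `j` and `j + 1`; this gives a linear lower bound for s² that
    -- is tight at the full value `s = j + 1`.
    have h1 : (0 : ℤ) ≤ ((s : ℤ) - j) * ((s : ℤ) - j - 1) := by
      rcases le_or_gt (s : ℤ) j with h | h
      · exact mul_nonneg_of_nonpos_of_nonpos (by omega) (by omega)
      · exact mul_nonneg (by omega) (by omega)
    have h2 : (0 : ℝ) ≤ ((s : ℝ) - j) * ((s : ℝ) - j - 1) := by exact_mod_cast h1
    nlinarith
  · have : s = 0 := by
      rw [hs, card_eq_zero, filter_eq_empty_iff]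
      intro a ha h
      apply hB
      have := hup _ h a (notMem_erase a B)
      rwa [insert_erase ha] at this
    rw [famIndicator, if_neg hB, this]
    simp

/-- An isoperimetric inequality for two consecutive levels, in terms of the deviations of the
vertex degrees from their average. -/
theorem card_mul_le_of_degree_deviation {r : ℕ} (hn : r + 5 ≤ Fintype.card α)
    (h𝓕 : 𝓕 ⊆ powersetCard (r + 3) univ) (h𝓖 : 𝓖 ⊆ powersetCard (r + 4) univ)
    (hup : ∀ A ∈ 𝓕, ∀ b ∉ A, insert b A ∈ 𝓖) {n a Z X Y : ℝ} (hn' : n = Fintype.card α)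
    (ha : a = #𝓕) (hZ : Z = (r + 4) * #𝓖 - (n - r - 3) * a)
    (hX : ∀ i, vertexDegree 𝓕 i - (r + 3) * a / n ≤ X)
    (hY : ∀ i, -Y ≤ vertexDegree 𝓕 i - (r + 3) * a / n) :
    2 * (n - 1) * (a - a ^ 2 / (Fintype.card α).choose (r + 3))
      ≤ (r + 3) * Z + (n - 2) * ((X + Y) * ((r + 3) / n * Z) / (Fintype.card α - 2).choose (r + 2)) := by
  have hn5 : (r : ℝ) + 5 ≤ n := by rw [hn']; exact_mod_cast hn
  have hnpos : 0 < n := by linarith [r.cast_nonneg (α := ℝ)]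
  set dev : α → ℝ := fun i => vertexDegree 𝓕 i - (r + 3) * a / n with hdev
  -- `m i` counts the sets of `𝓖` through `i` whose deletion of `i` leaves `𝓕`. So `m` is the
  -- boundary in direction `i`, and it dominates the positive part of the deviation.
  set m : α → ℝ := fun i => vertexDegree 𝓖 i + vertexDegree 𝓕 i - a with hm
  have hdev0 : ∑ i, dev i = 0 := by
    rw [hdev, sum_sub_distrib, sum_vertexDegree h𝓕, sum_const, card_univ, nsmul_eq_mul, ← hn', ← ha]
    push_cast
    field_simp
    ring
  have hmZ : ∑ i, m i = Z := by
    rw [hm, sum_sub_distrib, sum_add_distrib, sum_vertexDegree h𝓕, sum_vertexDegree h𝓖, sum_const,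
      card_univ, nsmul_eq_mul, ← hn', ← ha, hZ]
    push_cast
    ring
  have hm0 : ∀ i, 0 ≤ m i := fun i => by
    have := card_le_vertexDegree_add hup i
    have h2 : (#𝓕 : ℝ) ≤ vertexDegree 𝓕 i + vertexDegree 𝓖 i := by exact_mod_cast this
    simp only [hm]
    linarith
  have hdm : ∀ i, dev i ≤ (r + 3) / n * m i := fun i => by
    have := vertexDegree_mul_le h𝓕 h𝓖 hup i
    rw [← hn'] at this
    push_cast at this
    rw [div_mul_eq_mul_div, le_div_iff₀ hnpos]
    simp only [hdev, hm]
    have h2 : (vertexDegree 𝓕 i - (r + 3) * a / n) * n = vertexDegree 𝓕 i * n - (r + 3) * a := by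
      field_simp
    rw [h2]
    linarith
  have hsq : ∑ i, dev i ^ 2 ≤ (X + Y) * ((r + 3) / n * Z) := by
    -- Deviations sum to zero, so `Y` can be added for free. The second factor is then nonnegative,
    -- and only points with positive deviation, where the boundary controls `dev i`, need an
    -- estimate.
    have h1 : ∑ i, dev i ^ 2 = ∑ i, dev i * (dev i + Y) := by
      have : ∀ i, dev i * (dev i + Y) = dev i ^ 2 + dev i * Y := fun i => by ring
      rw [sum_congr rfl fun i _ => this i, sum_add_distrib, ← sum_mul, hdev0, zero_mul, add_zero]
    rw [h1, ← hmZ, mul_sum, mul_sum]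
    refine sum_le_sum fun i _ => ?_
    have hXi : dev i ≤ X := hX i
    have hYi : -Y ≤ dev i := hY i
    have hq : 0 ≤ (r + 3) / n * m i := mul_nonneg (by positivity) (hm0 i)
    rcases le_total 0 (dev i) with h0 | h0
    · calc dev i * (dev i + Y) = (dev i + Y) * dev i := mul_comm _ _
        _ ≤ (X + Y) * ((r + 3) / n * m i) :=
          mul_le_mul (by linarith) (hdm i) h0 (by linarith)
    · exact le_trans (mul_nonpos_of_nonpos_of_nonneg h0 (by linarith)) (mul_nonneg (by linarith) hq)
  have hs : a = ∑ A ∈ powersetCard (r + 3) (univ : Finset α), famIndicator 𝓕 A ^ 2 := by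
    rw [sum_congr rfl fun A _ => famIndicator_sq 𝓕 A, sum_famIndicator h𝓕, ha]
  have hspec := sum_sumInsert_sq_le_of_degrees r hn (famIndicator 𝓕) (a := a) (s := a)
    (by rw [sum_famIndicator h𝓕, ha]) hs rfl
  have hWdev : ∑ i, (marginal (r + 3) (famIndicator 𝓕) i - (r + 3) * a / Fintype.card α) ^ 2
      = ∑ i, dev i ^ 2 :=
    sum_congr rfl fun i _ => by rw [marginal_famIndicator h𝓕, hdev, hn']
  have hnorm := sum_sumErase_sq (famIndicator 𝓕) (r + 2)
  have hlow := le_sum_sumErase_sq h𝓕 h𝓖 hup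
  rw [hWdev, ← hn'] at hspec
  have hs' : ∑ C ∈ powersetCard (r + 2 + 1) (univ : Finset α), famIndicator 𝓕 C ^ 2 = a := hs.symm
  rw [hs', ← hn'] at hnorm
  have e1 : r + 2 + 2 = r + 3 + 1 := rfl
  rw [e1] at hnorm
  rw [hnorm, ← hn', ← ha] at hlow
  set K : ℝ := ((Fintype.card α).choose (r + 3) : ℝ) with hK
  set D : ℝ := ((Fintype.card α - 2).choose (r + 2) : ℝ) with hD
  have hDpos : 0 < D := by rw [hD]; exact_mod_cast Nat.choose_pos (by omega)
  have hdiv : (∑ i, dev i ^ 2) / D ≤ (X + Y) * ((r + 3) / n * Z) / D := by gcongr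
  have hKpos : 0 < K := by rw [hK]; exact_mod_cast Nat.choose_pos (by omega)
  have hmul := mul_le_mul_of_nonneg_left hdiv (show 0 ≤ n - 2 by linarith [r.cast_nonneg (α := ℝ)])
  set V := (∑ i, dev i ^ 2) / D with hV
  set Q := a ^ 2 / K with hQ
  push_cast at hlow
  have h4 : ((r : ℝ) + 4) * #𝓖 = Z + (n - r - 3) * a := by rw [hZ]; ring
  have h5 : ((r : ℝ) + 3) * (r + 3 + 1) * #𝓖 = (r + 3) * (Z + (n - r - 3) * a) := by rw [← h4]; ring
  rw [h5] at hlow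
  -- With `𝓖` eliminated through `Z`, the coefficients of a - a²/K and of the linear weight collapse
  -- to 2(n-1) and n-2.
  have h6 := hlow.trans (add_le_add_left hspec _)
  nlinarith
end Influence

/-- Lowering the top entry from c + 1 to c multiplies the binomial by 1 - b/(c+1), which is at most
1 - b/a. -/
theorem choose_sub_le_choose_mul_pow (a b s : ℕ) (hs : s ≤ a) (hb : b ≤ a) :
    (((a - s).choose b : ℕ) : ℝ) ≤ a.choose b * (((a : ℝ) - b) / a) ^ s := by
  induction s with
  | zero => simp
  | succ s ih =>
    have ih := ih (by omega)
    obtain ⟨c, hc⟩ : ∃ c, a - s = c + 1 := ⟨a - s - 1, by omega⟩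
    have hc' : a - (s + 1) = c := by omega
    have hapos : (0 : ℝ) < a := by exact_mod_cast (by omega : 0 < a)
    have hq : 0 ≤ ((a : ℝ) - b) / a := div_nonneg (sub_nonneg.2 (by exact_mod_cast hb)) hapos.le
    rw [hc] at ih
    rw [hc', pow_succ, ← mul_assoc]
    refine le_trans ?_ (mul_le_mul_of_nonneg_right ih hq)
    rcases Nat.lt_or_ge c b with h | h
    · rw [Nat.choose_eq_zero_of_lt h]
      push_cast
      positivity
    · have h1 : ((c : ℝ) + 1) * c.choose b = (c + 1).choose b * (c + 1 - b) := by
        have := Nat.add_one_mul_choose_eq c b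
        have h2 := Nat.choose_succ_right_eq (c + 1) b
        rw [h2] at this
        have h3 : ((c + 1 - b : ℕ) : ℝ) = (c : ℝ) + 1 - b := by
          rw [Nat.cast_sub (by omega)]; push_cast; ring
        rw [← h3]
        exact_mod_cast this
      have h4 : ((c : ℝ) + 1) ≤ a := by exact_mod_cast (by omega : c + 1 ≤ a)
      have hcpos : (0 : ℝ) < c + 1 := by positivity
      have h5 : (c.choose b : ℝ) = (c + 1).choose b * ((c + 1 - b) / (c + 1)) := by
        field_simp
        linarith
      rw [h5]
      gcongr ?_ * ?_
      rw [div_le_div_iff₀ hcpos hapos]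
      have : (b : ℝ) * (c + 1) ≤ b * a := by gcongr
      nlinarith

/-! ### Degrees in the levels of the generated up-set. -/

section Degrees

variable {n k t : ℕ} {F : Finset (Finset (Fin n))}

theorem upAt_subset (S : Finset (Fin n)) (j : ℕ) : upAt S j F ⊆ powersetCard j univ := by
  intro A hA
  exact mem_powersetCard_univ.2 (mem_upAt.1 hA).1.2

theorem sized_upAt (S : Finset (Fin n)) (j : ℕ) :
    (upAt S j F : Set (Finset (Fin n))).Sized j := fun _ hA => (mem_upAt.1 hA).1.2

theorem intersecting_upAt (hF : (F : Set (Finset (Fin n))).Intersecting) (S : Finset (Fin n))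
    (j : ℕ) : (upAt S j F : Set (Finset (Fin n))).Intersecting := by
  intro A hA B hB hAB
  obtain ⟨-, A', hA', hAA⟩ := mem_upAt.1 hA
  obtain ⟨-, B', hB', hBB⟩ := mem_upAt.1 hB
  exact hF hA' hB' (disjoint_of_subset_left hAA (disjoint_of_subset_right hBB hAB))

theorem insert_mem_upAt {S : Finset (Fin n)} {j : ℕ} {A : Finset (Fin n)} (hA : A ∈ upAt S j F)
    {b : Fin n} (hb : b ∉ A) (hbS : b ∈ S) : insert b A ∈ upAt S (j + 1) F := by
  obtain ⟨⟨h1, h2⟩, A', hA', hAA⟩ := mem_upAt.1 hA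
  exact mem_upAt.2 ⟨⟨insert_subset hbS h1, by rw [card_insert_of_notMem hb, h2]⟩, A', hA',
    hAA.trans (subset_insert _ _)⟩

/-- Lower bounds of Hilton–Milner shape on the degrees are inherited by the higher levels. -/
theorem le_subsetDegree_upAt (hF : (F : Set (Finset (Fin n))).Sized k) {T : Finset (Fin n)}
    (hT : #T = t) (htk : t + 2 ≤ k) {j : ℕ} (hkj : k ≤ j) (hj : j + k ≤ n)
    (hd : (n - t - 1).choose (k - t - 1) - (n - t - k - 1).choose (k - t - 1) ≤ subsetDegree F T) :
    (n - t - 1).choose (j - t - 1) - (n - t - k - 1).choose (j - t - 1)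
      ≤ subsetDegree (upAt univ j F) T := by
  set S : Finset (Fin n) := Tᶜ with hS
  have hSc : #S = n - t := by rw [hS, card_compl, Fintype.card_fin, hT]
  set 𝒜 := (F.filter fun A => T ⊆ A).image (· \ T) with h𝒜
  have h𝒜s : 𝒜 ⊆ powersetCard (k - t) S := by
    intro B hB
    obtain ⟨A, hA, rfl⟩ := mem_image.1 hB
    obtain ⟨hA1, hA2⟩ := mem_filter.1 hA
    refine mem_powersetCard.2 ⟨?_, ?_⟩
    · intro x hx
      exact mem_compl.2 (mem_sdiff.1 hx).2
    · rw [card_sdiff_of_subset hA2, hF hA1, hT]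
  have h𝒜c : #𝒜 = subsetDegree F T := by
    rw [subsetDegree, h𝒜]
    refine card_image_of_injOn fun A hA B hB hAB => ?_
    have hA := (mem_filter.1 (mem_coe.1 hA)).2
    have hB := (mem_filter.1 (mem_coe.1 hB)).2
    rw [← union_sdiff_of_subset hA, ← union_sdiff_of_subset hB]
    exact congrArg (T ∪ ·) hAB
  -- Read through complements, the Hilton–Milner degree is exactly the threshold of
  -- `choose_sub_choose_le_card_upAt` for the link of `T`, with `s = k` and `a = n - t - 1`; hence
  -- it reproduces itself at level `j`.
  have key := choose_sub_choose_le_card_upAt (j := j - t) (s := k) (a := n - t - 1) h𝒜s (by omega)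
    (by omega) (by omega) (by omega) ?_
  · rw [hSc, show n - t - (j - t) = n - j by omega, show n - t - 1 - k = n - t - k - 1 by omega,
      ← Nat.choose_symm (show n - j ≤ n - t - 1 by omega),
      ← Nat.choose_symm (show n - j - k ≤ n - t - k - 1 by omega),
      show n - t - 1 - (n - j) = j - t - 1 by omega,
      show n - t - k - 1 - (n - j - k) = j - t - 1 by omega] at key
    refine key.trans ?_
    rw [subsetDegree]
    refine card_le_card_of_injOn (T ∪ ·) ?_ ?_
    · intro C hC
      obtain ⟨⟨h1, h2⟩, B, hB, hBC⟩ := mem_upAt.1 (mem_coe.1 hC)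
      obtain ⟨A, hA, rfl⟩ := mem_image.1 hB
      have hd : Disjoint T C := disjoint_of_subset_right h1 disjoint_compl_right
      refine mem_coe.2 (mem_filter.2 ⟨mem_upAt.2 ⟨⟨subset_univ _, ?_⟩, A, (mem_filter.1 hA).1, ?_⟩,
        subset_union_left⟩)
      · rw [card_union_of_disjoint hd, h2, hT]; omega
      · intro x hx
        by_cases hxT : x ∈ T
        · exact mem_union_left _ hxT
        · exact mem_union_right _ (hBC (mem_sdiff.2 ⟨hx, hxT⟩))
    · intro C hC C' hC' hCC
      have h1 := (mem_upAt.1 (mem_coe.1 hC)).1.1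
      have h1' := (mem_upAt.1 (mem_coe.1 hC')).1.1
      have hd : Disjoint T C := disjoint_of_subset_right h1 disjoint_compl_right
      have hd' : Disjoint T C' := disjoint_of_subset_right h1' disjoint_compl_right
      have := congrArg (· \ T) hCC
      simpa only [union_sdiff_cancel_left hd, union_sdiff_cancel_left hd'] using this
  · rw [h𝒜c, hSc, show n - t - (k - t) = n - k by omega, show n - t - 1 - k = n - t - k - 1 by omega,
      ← Nat.choose_symm (show n - k ≤ n - t - 1 by omega),
      ← Nat.choose_symm (show n - k - k ≤ n - t - k - 1 by omega),
      show n - t - 1 - (n - k) = k - t - 1 by omega,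
      show n - t - k - 1 - (n - k - k) = k - t - 1 by omega]
    exact hd

/-- Double counting of the members containing `t`-sets through a given element. -/
theorem sum_subsetDegree_of_mem {j : ℕ} (hF : F ⊆ powersetCard j univ) (i : Fin n) (ht : 1 ≤ t) :
    ∑ T ∈ powersetCard t univ with i ∈ T, subsetDegree F T
      = vertexDegree F i * (j - 1).choose (t - 1) := by
  have h1 := sum_card_bipartiteAbove_eq_sum_card_bipartiteBelow (fun T A : Finset (Fin n) => T ⊆ A)
    (s := (powersetCard t univ).filter fun T => i ∈ T) (t := F)
  have h2 : ∀ T ∈ (powersetCard t univ).filter (fun T : Finset (Fin n) => i ∈ T),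
      #(bipartiteAbove (fun T A : Finset (Fin n) => T ⊆ A) F T) = subsetDegree F T := fun T _ => rfl
  rw [sum_congr rfl h2] at h1
  rw [h1, vertexDegree, card_filter, sum_mul]
  refine sum_congr rfl fun A hA => ?_
  have hAj := mem_powersetCard_univ.1 (hF hA)
  rw [bipartiteBelow, filter_filter]
  split_ifs with hi
  · rw [one_mul]
    have := card_filter_subset_powersetCard (singleton_subset_iff.2 hi) (k := t) (by simpa using ht)
    rw [card_singleton, hAj] at this
    rw [← this]
    congr 1
    ext T
    simp only [mem_filter, mem_powersetCard, subset_univ, true_and, singleton_subset_iff]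
    tauto
  · rw [zero_mul, card_eq_zero, filter_eq_empty_iff]
    rintro T - ⟨h3, h4⟩
    exact hi (h4 h3)

/-- A lower bound for the vertex degrees, from a Hilton–Milner type lower bound for all degrees of
`t`-sets. -/
theorem le_vertexDegree_of_le_subsetDegree {j s : ℕ} (hF : F ⊆ powersetCard j univ) (ht : 1 ≤ t)
    (htj : t + 1 ≤ j) (hjn : j ≤ n) (hs : s + t + 1 ≤ n)
    (hd : ∀ T : Finset (Fin n), #T = t →
      (n - t - 1).choose (j - t - 1) - (n - t - s - 1).choose (j - t - 1) ≤ subsetDegree F T)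
    (i : Fin n) :
    ((n - 1).choose (j - 1) : ℝ) * (((j : ℝ) - t) / (n - t) * (1 - (((n : ℝ) - j) / (n - t - 1)) ^ s))
      ≤ vertexDegree F i := by
  set B := (n - t - 1).choose (j - t - 1) - (n - t - s - 1).choose (j - t - 1) with hB
  have h1 : (n - 1).choose (t - 1) * B ≤ vertexDegree F i * (j - 1).choose (t - 1) := by
    rw [← sum_subsetDegree_of_mem hF i ht]
    have h2 := card_filter_mem_powersetCard i (t - 1)
    rw [Fintype.card_fin, Nat.sub_add_cancel ht] at h2
    rw [← h2, ← smul_eq_mul]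
    refine card_nsmul_le_sum _ _ _ fun T hT => hd T ?_
    exact mem_powersetCard_univ.1 (mem_filter.1 hT).1
  have hpow := choose_sub_le_choose_mul_pow (n - t - 1) (j - t - 1) s (by omega) (by omega)
  have c1 : ((n - t - 1 : ℕ) : ℝ) = (n : ℝ) - t - 1 := by
    rw [Nat.sub_sub, Nat.cast_sub (by omega)]; push_cast; ring
  have c2 : ((j - t - 1 : ℕ) : ℝ) = (j : ℝ) - t - 1 := by
    rw [Nat.sub_sub, Nat.cast_sub (by omega)]; push_cast; ring
  rw [c1, c2, show n - t - 1 - s = n - t - s - 1 by omega,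
    show (n : ℝ) - t - 1 - (j - t - 1) = n - j by ring] at hpow
  set e := (((n : ℝ) - j) / (n - t - 1)) ^ s with he
  have hB' : ((n - t - 1).choose (j - t - 1) : ℝ) * (1 - e) ≤ B := by
    have h3 : ((n - t - 1).choose (j - t - 1) : ℝ) - (n - t - s - 1).choose (j - t - 1) ≤ B := by
      rw [hB]
      have h4 : (n - t - 1).choose (j - t - 1) ≤
        ((n - t - 1).choose (j - t - 1) - (n - t - s - 1).choose (j - t - 1))
          + (n - t - s - 1).choose (j - t - 1) := by omega
      have h5 : ((n - t - 1).choose (j - t - 1) : ℝ) ≤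
        (((n - t - 1).choose (j - t - 1) - (n - t - s - 1).choose (j - t - 1) : ℕ) : ℝ)
          + (n - t - s - 1).choose (j - t - 1) := by exact_mod_cast h4
      linarith
    linarith
  have hid : (n - 1).choose (j - 1) * (j - 1).choose (t - 1) * (j - t)
      = (n - 1).choose (t - 1) * (n - t - 1).choose (j - t - 1) * (n - t) := by
    rw [Nat.choose_mul (by omega), show n - 1 - (t - 1) = n - t by omega,
      show j - 1 - (t - 1) = j - t by omega]
    have h3 := Nat.add_one_mul_choose_eq (n - t - 1) (j - t - 1)
    rw [show n - t - 1 + 1 = n - t by omega, show j - t - 1 + 1 = j - t by omega] at h3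
    rw [mul_assoc, ← h3]
    ring
  have hidR : ((n - 1).choose (j - 1) : ℝ) * (j - 1).choose (t - 1) * (j - t)
      = (n - 1).choose (t - 1) * (n - t - 1).choose (j - t - 1) * (n - t) := by
    have c3 : ((j - t : ℕ) : ℝ) = (j : ℝ) - t := Nat.cast_sub (by omega)
    have c4 : ((n - t : ℕ) : ℝ) = (n : ℝ) - t := Nat.cast_sub (by omega)
    rw [← c3, ← c4]
    exact_mod_cast hid
  have h1R : ((n - 1).choose (t - 1) : ℝ) * B ≤ vertexDegree F i * (j - 1).choose (t - 1) := by
    exact_mod_cast h1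
  have hpos : (0 : ℝ) < (j - 1).choose (t - 1) := by exact_mod_cast Nat.choose_pos (by omega)
  have hnt : (0 : ℝ) < (n : ℝ) - t := by
    rw [← Nat.cast_sub (by omega)]; exact_mod_cast (by omega : 0 < n - t)
  refine le_of_mul_le_mul_right ?_ hpos
  refine le_trans ?_ h1R
  calc _ = ((n - 1).choose (j - 1) : ℝ) * (j - 1).choose (t - 1) * (j - t) * (1 - e) / (n - t) := by
        field_simp
    _ = (n - 1).choose (t - 1) * ((n - t - 1).choose (j - t - 1) * (1 - e)) := by
        rw [hidR]; field_simp
    _ ≤ _ := by gcongr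

/-- Lovász's form of Kruskal–Katona on the complement of `i`, where the threshold equals C(n-3,
n-1-k) and so corresponds to the parameter n - 3. -/
theorem choose_le_card_sub_vertexDegree_upAt (hF : (F : Set (Finset (Fin n))).Sized k) (hk : 2 ≤ k)
    {j : ℕ} (hkj : k ≤ j) (hj : j + 1 ≤ n) (hkn : k + 1 ≤ n) {i : Fin n}
    (hi : (n - 3).choose (k - 2) ≤ #(F.filter fun A => i ∉ A)) :
    vertexDegree (upAt univ j F) i + (n - 3).choose (j - 2) ≤ #(upAt univ j F) := by
  have hS : #({i}ᶜ : Finset (Fin n)) = n - 1 := by simp [card_compl]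
  have hsub : (F.filter fun A => i ∉ A) ⊆ powersetCard k {i}ᶜ := by
    intro A hA
    obtain ⟨h1, h2⟩ := mem_filter.1 hA
    exact mem_powersetCard.2 ⟨subset_compl_singleton.2 h2, hF h1⟩
  have key := choose_le_card_upAt (j := j) (m := n - 3) hsub hkj (by omega) (by omega) (by omega) (by
    rw [hS, ← Nat.choose_symm (by omega), show n - 3 - (n - 1 - k) = k - 2 by omega]; exact hi)
  rw [hS, ← Nat.choose_symm (by omega), show n - 3 - (n - 1 - j) = j - 2 by omega] at key
  have h1 := card_filter_add_card_filter_not (s := upAt univ j F) (fun A => i ∈ A)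
  have h2 : #(upAt {i}ᶜ j (F.filter fun A => i ∉ A)) ≤ #((upAt univ j F).filter fun A => i ∉ A) := by
    refine card_le_card fun B hB => ?_
    obtain ⟨⟨h3, h4⟩, A, hA, hAB⟩ := mem_upAt.1 hB
    exact mem_filter.2 ⟨mem_upAt.2 ⟨⟨subset_univ _, h4⟩, A, (mem_filter.1 hA).1, hAB⟩,
      subset_compl_singleton.1 h3⟩
  rw [vertexDegree]
  omega

/-- The members of a higher level containing `i` miss all complements of sets that contain a member
of `F` avoiding `i`. -/
theorem vertexDegree_upAt_add_le (hint : (F : Set (Finset (Fin n))).Intersecting)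
    {j : ℕ} (hj1 : 1 ≤ j) (i : Fin n) (hjn : j ≤ n) :
    vertexDegree (upAt univ j F) i + #(upAt {i}ᶜ (n - j) (F.filter fun A => i ∉ A))
      ≤ (n - 1).choose (j - 1) := by
  have hcount := card_filter_mem_powersetCard i (j - 1)
  rw [Fintype.card_fin, Nat.sub_add_cancel hj1] at hcount
  set U := upAt {i}ᶜ (n - j) (F.filter fun A => i ∉ A) with hU
  have hUc : #(U.image compl) = #U := card_image_of_injective _ compl_injective
  rw [← hcount, ← hUc, vertexDegree, ← card_union_of_disjoint]
  · refine card_le_card (union_subset ?_ ?_)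
    · intro A hA
      obtain ⟨h1, h2⟩ := mem_filter.1 hA
      exact mem_filter.2 ⟨upAt_subset _ _ h1, h2⟩
    · intro A hA
      obtain ⟨C, hC, rfl⟩ := mem_image.1 hA
      obtain ⟨⟨h1, h2⟩, -⟩ := mem_upAt.1 hC
      refine mem_filter.2 ⟨mem_powersetCard_univ.2 ?_, ?_⟩
      · rw [card_compl, Fintype.card_fin, h2]; omega
      · rw [mem_compl]; exact subset_compl_singleton.1 h1
  · rw [disjoint_left]
    intro A hA hA'
    obtain ⟨C, hC, rfl⟩ := mem_image.1 hA'
    obtain ⟨-, B, hB, hBC⟩ := mem_upAt.1 hC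
    obtain ⟨-, B', hB', hBC'⟩ := mem_upAt.1 (mem_filter.1 hA).1
    exact hint hB' (mem_filter.1 hB).1
      (disjoint_of_subset_left hBC' (disjoint_of_subset_right hBC disjoint_compl_left))

/-- The same growth estimate taken up to level n - j: the complements of the sets found there
contain `i` and are excluded by intersection. -/
theorem vertexDegree_upAt_add_choose_le (hF : (F : Set (Finset (Fin n))).Sized k)
    (hint : (F : Set (Finset (Fin n))).Intersecting) (hk : 2 ≤ k) {j : ℕ} (hj1 : 1 ≤ j)
    (hj : k + j ≤ n) {i : Fin n}
    (hi : (n - 3).choose (k - 2) ≤ #(F.filter fun A => i ∉ A)) :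
    vertexDegree (upAt univ j F) i + (n - 3).choose (j - 1) ≤ (n - 1).choose (j - 1) := by
  refine le_trans (Nat.add_le_add_left ?_ _) (vertexDegree_upAt_add_le hint hj1 i (by omega))
  have hS : #({i}ᶜ : Finset (Fin n)) = n - 1 := by simp [card_compl]
  have hsub : (F.filter fun A => i ∉ A) ⊆ powersetCard k {i}ᶜ := by
    intro A hA
    obtain ⟨h1, h2⟩ := mem_filter.1 hA
    exact mem_powersetCard.2 ⟨subset_compl_singleton.2 h2, hF h1⟩
  have key := choose_le_card_upAt (j := n - j) (m := n - 3) hsub (by omega) (by omega) (by omega)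
    (by omega) (by
    rw [hS, ← Nat.choose_symm (by omega), show n - 3 - (n - 1 - k) = k - 2 by omega]; exact hi)
  rwa [hS, show n - 1 - (n - j) = j - 1 by omega] at key

end Degrees

/-! ### The inequality forced by two levels of nearly equal density. -/

section Level

variable {n k : ℕ} {F : Finset (Finset (Fin n))}

set_option maxHeartbeats 1000000 in
/-- If no element lies in almost all members of `F`, then two consecutive levels of the up-set
generated by `F` of nearly maximal size satisfy a numerical inequality. -/
theorem level_inequality (hF : (F : Set (Finset (Fin n))).Sized k)
    (hint : (F : Set (Finset (Fin n))).Intersecting) (hk : 2 ≤ k) {r : ℕ} (hkr : k ≤ r + 3)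
    (hn : 2 * (r + 4) ≤ n)
    (hγ : ∀ i, (n - 3).choose (k - 2) ≤ #(F.filter fun A => i ∉ A))
    {q θ κ : ℝ} (hq : q = (r + 3) / n) (hθ : 0 ≤ θ) (hθq : θ ≤ q)
    (hd : ∀ i, ((n - 1).choose (r + 2) : ℝ) * (q - θ) ≤ vertexDegree (upAt univ (r + 3) F) i)
    (hΔ : (#(upAt univ (r + 4) F) : ℝ) / n.choose (r + 4)
      - #(upAt univ (r + 3) F) / n.choose (r + 3) ≤ (1 + κ) / n) :
    2 * ((n : ℝ) - 1) * ((q - θ) * (1 - q + θ))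
      ≤ n * (q * (1 - q)) * ((1 + κ) * (1 + 2 * (q * (1 - q)) + θ / (1 - q))) := by
  set a : ℝ := (#(upAt univ (r + 3) F) : ℝ) with ha
  set b : ℝ := (#(upAt univ (r + 4) F) : ℝ) with hb
  set N : ℝ := (n.choose (r + 3) : ℝ) with hN
  have hnr : 2 * ((r : ℝ) + 4) ≤ n := by exact_mod_cast hn
  have hr0 : (0 : ℝ) ≤ r := r.cast_nonneg
  have hnpos : (0 : ℝ) < n := by linarith
  have hNpos : 0 < N := by rw [hN]; exact_mod_cast Nat.choose_pos (by omega)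
  have hqn : q * n = r + 3 := by rw [hq]; field_simp
  have hq0 : 0 < q := by rw [hq]; positivity
  have hq2 : q ≤ 1 / 2 := by rw [hq, div_le_div_iff₀ hnpos two_pos]; linarith
  -- binomial identities
  have b1 : ((n - 1).choose (r + 2) : ℝ) = q * N := by
    have := Nat.add_one_mul_choose_eq (n - 1) (r + 2)
    rw [Nat.sub_add_cancel (by omega)] at this
    have h2 : (n : ℝ) * (n - 1).choose (r + 2) = N * (r + 3) := by rw [hN]; exact_mod_cast this
    rw [hq]
    field_simp
    linarith
  have b2 : ((n - 2).choose (r + 2) : ℝ) * (n - 1) = (1 - q) * n * (q * N) := by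
    have := Nat.choose_mul_succ_eq (n - 2) (r + 2)
    rw [show n - 2 + 1 = n - 1 by omega] at this
    have h2 : ((n - 2).choose (r + 2) : ℝ) * ((n - 1 : ℕ) : ℝ)
        = (n - 1).choose (r + 2) * ((n - 1 - (r + 2) : ℕ) : ℝ) := by exact_mod_cast this
    rw [Nat.cast_sub (by omega), Nat.cast_sub (by omega), Nat.cast_sub (by omega), b1] at h2
    push_cast at h2
    rw [h2, show (1 - q) * n = n - q * n by ring, hqn]
    ring
  have b3 : ((n - 3).choose (r + 2) : ℝ) * (n - 2) = (n - 2).choose (r + 2) * (n - r - 4) := by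
    have := Nat.choose_mul_succ_eq (n - 3) (r + 2)
    rw [show n - 3 + 1 = n - 2 by omega] at this
    have h2 : ((n - 3).choose (r + 2) : ℝ) * ((n - 2 : ℕ) : ℝ)
        = (n - 2).choose (r + 2) * ((n - 2 - (r + 2) : ℕ) : ℝ) := by exact_mod_cast this
    rw [Nat.cast_sub (by omega), Nat.cast_sub (by omega), Nat.cast_sub (by omega)] at h2
    push_cast at h2
    rw [h2]; ring
  have b4 : ((n - 3).choose (r + 1) : ℝ) * (n - 2) = (n - 2).choose (r + 2) * (r + 2) := by
    have := Nat.add_one_mul_choose_eq (n - 3) (r + 1)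
    rw [show n - 3 + 1 = n - 2 by omega] at this
    have h2 : ((n - 2 : ℕ) : ℝ) * (n - 3).choose (r + 1)
        = (n - 2).choose (r + 2) * (r + 2) := by exact_mod_cast this
    rw [Nat.cast_sub (by omega)] at h2
    push_cast at h2
    linarith
  have b5 : (n.choose (r + 4) : ℝ) * (r + 4) = N * (n - r - 3) := by
    have := Nat.choose_succ_right_eq n (r + 3)
    have h2 : (n.choose (r + 4) : ℝ) * (r + 4) = N * ((n - (r + 3) : ℕ) : ℝ) := by
      rw [hN]; exact_mod_cast this
    rw [Nat.cast_sub (by omega)] at h2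
    push_cast at h2
    rw [h2]; ring
  set D : ℝ := ((n - 2).choose (r + 2) : ℝ) with hD
  have hDpos : 0 < D := by rw [hD]; exact_mod_cast Nat.choose_pos (by omega)
  -- bounds on the size
  have haq : a ≤ q * N := by
    rw [← b1]
    have := erdos_ko_rado (intersecting_upAt hint univ (r + 3)) (sized_upAt univ (r + 3)) (by omega)
    rw [ha]
    exact_mod_cast this
  have haθ : (q - θ) * N ≤ a := by
    have h1 := sum_vertexDegree (upAt_subset (F := F) univ (r + 3))
    have h2 : ∑ _i : Fin n, ((n - 1).choose (r + 2) : ℝ) * (q - θ) ≤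
      ∑ i, (vertexDegree (upAt univ (r + 3) F) i : ℝ) := sum_le_sum fun i _ => hd i
    rw [h1, sum_const, card_univ, Fintype.card_fin, nsmul_eq_mul, b1] at h2
    push_cast at h2
    have h3 : (r + 3 : ℝ) * ((q - θ) * N) ≤ (r + 3) * a := by
      calc (r + 3 : ℝ) * ((q - θ) * N) = n * (q * N * (q - θ)) := by rw [← hqn]; ring
        _ ≤ _ := h2
    exact le_of_mul_le_mul_left h3 (by positivity)
  -- deviations
  set X : ℝ := (1 - q) * (q * N - (n - 3).choose (r + 2)) - q * (n - 3).choose (r + 1) with hX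
  have hdevX : ∀ i, (vertexDegree (upAt univ (r + 3) F) i : ℝ) - (r + 3) * a / n ≤ X := by
    intro i
    have h1 := choose_le_card_sub_vertexDegree_upAt hF hk hkr (by omega) (by omega) (hγ i)
    have h2 := vertexDegree_upAt_add_choose_le (j := r + 3) hF hint hk (by omega) (by omega) (hγ i)
    rw [show r + 3 - 2 = r + 1 by omega] at h1
    rw [show r + 3 - 1 = r + 2 by omega] at h2
    have h1R : (vertexDegree (upAt univ (r + 3) F) i : ℝ) + (n - 3).choose (r + 1) ≤ a := by
      rw [ha]; exact_mod_cast h1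
    have h2R : (vertexDegree (upAt univ (r + 3) F) i : ℝ) + (n - 3).choose (r + 2) ≤ q * N := by
      rw [← b1]; exact_mod_cast h2
    have h3 : (r + 3) * a / n = q * a := by rw [hq]; ring
    rw [h3, hX]
    nlinarith
  have hdevY : ∀ i, -(q * N * θ) ≤ (vertexDegree (upAt univ (r + 3) F) i : ℝ) - (r + 3) * a / n := by
    intro i
    have h1 := hd i
    rw [b1] at h1
    have h3 : (r + 3) * a / n = q * a := by rw [hq]; ring
    rw [h3]
    nlinarith
  set Z : ℝ := (r + 4) * b - (n - r - 3) * a with hZ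
  have hup : ∀ A ∈ upAt univ (r + 3) F, ∀ c ∉ A, insert c A ∈ upAt univ (r + 4) F :=
    fun A hA c hc => insert_mem_upAt hA hc (mem_univ _)
  have key := card_mul_le_of_degree_deviation (n := n) (a := a) (Z := Z) (X := X) (Y := q * N * θ)
    (by rw [Fintype.card_fin]; omega) (upAt_subset univ (r + 3)) (upAt_subset univ (r + 4)) hup
    (by rw [Fintype.card_fin]) rfl rfl hdevX hdevY
  rw [Fintype.card_fin] at key
  have hZle : Z ≤ (1 - q) * N * (1 + κ) := by
    have h1 : Z = (n - r - 3) * N * (b / n.choose (r + 4) - a / N) := by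
      have hc : (0 : ℝ) < n.choose (r + 4) := by exact_mod_cast Nat.choose_pos (by omega)
      have h2 : (n - r - 3) * N * (b / n.choose (r + 4)) = (r + 4) * b := by
        rw [mul_comm (n - r - 3 : ℝ) N, ← b5]; field_simp
      rw [mul_sub, h2, hZ]; field_simp
    have h3 : (0 : ℝ) ≤ (n - r - 3) * N := mul_nonneg (by linarith) hNpos.le
    rw [h1]
    refine (mul_le_mul_of_nonneg_left hΔ h3).trans (le_of_eq ?_)
    have : (n : ℝ) - r - 3 = (1 - q) * n := by rw [sub_mul, hqn]; ring
    rw [this]; field_simp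
  have hXD : ((n : ℝ) - 2) * X = D * (2 * (r + 2) * (n - r - 4)) / n := by
    have h1 : D * (n - 1) = (1 - q) * n * (q * N) := b2
    have h2 : ((n : ℝ) - 2) * X = (1 - q) * (q * N) * (n - 2)
        - (1 - q) * (D * (n - r - 4)) - q * (D * (r + 2)) := by
      rw [hX, ← b3, ← b4]; ring
    have h3 : (1 - q) * (q * N) = D * (n - 1) / n := by rw [h1]; field_simp
    rw [h2, h3, hq]
    field_simp
    ring
  have hYD : ((n : ℝ) - 2) * (q * N * θ) ≤ D * (n * (θ / (1 - q))) := by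
    have h1 : q * N = D * (n - 1) / ((1 - q) * n) := by
      rw [b2]
      have : 1 - q ≠ 0 := by linarith
      field_simp
    have h4 : 0 < 1 - q := by linarith
    rw [h1]
    have h5 : ((n : ℝ) - 2) * (D * (n - 1) / ((1 - q) * n) * θ)
        = D * ((n - 2) * (n - 1) / n * (θ / (1 - q))) := by field_simp
    rw [h5]
    have h6 : ((n : ℝ) - 2) * (n - 1) / n ≤ n := by
      rw [div_le_iff₀ hnpos]; nlinarith
    gcongr
  have hE : (n - 2) * ((X + q * N * θ) * ((r + 3) / n * Z) / D)
      ≤ (n * (2 * (q * (1 - q))) + n * (θ / (1 - q))) * (q * Z) := by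
    have hZ0 : 0 ≤ Z := by
      have h1 := fun i => card_le_vertexDegree_add hup i
      have h2 : ∑ _i : Fin n, (#(upAt univ (r + 3) F) : ℝ) ≤
          ∑ i, ((vertexDegree (upAt univ (r + 3) F) i : ℝ) + vertexDegree (upAt univ (r + 4) F) i) :=
        sum_le_sum fun i _ => by exact_mod_cast h1 i
      rw [sum_add_distrib, sum_vertexDegree (upAt_subset univ _),
        sum_vertexDegree (upAt_subset univ _), sum_const, card_univ, Fintype.card_fin,
        nsmul_eq_mul] at h2
      push_cast at h2
      rw [hZ]
      linarith
    have h1 : (n - 2) * ((X + q * N * θ) * ((r + 3) / n * Z) / D)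
        = (((n : ℝ) - 2) * X + (n - 2) * (q * N * θ)) / D * (q * Z) := by
      rw [hq]; field_simp
    rw [h1]
    refine mul_le_mul_of_nonneg_right ?_ (mul_nonneg hq0.le hZ0)
    rw [div_le_iff₀ hDpos, hXD]
    have h2 : D * (2 * (r + 2) * (n - r - 4)) / n ≤ D * (n * (2 * (q * (1 - q)))) := by
      have h3 : (2 * ((r : ℝ) + 2) * (n - r - 4)) / n ≤ n * (2 * (q * (1 - q))) := by
        have h4 : (n : ℝ) * (2 * (q * (1 - q))) = 2 * (r + 3) * (n - r - 3) / n := by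
          rw [hq]; field_simp; ring
        rw [h4]
        gcongr <;> linarith
      rw [mul_div_assoc]
      gcongr
    linarith
  have hfin : 2 * ((n : ℝ) - 1) * (a - a ^ 2 / N)
      ≤ N * (n * (q * (1 - q)) * ((1 + κ) * (1 + 2 * (q * (1 - q)) + θ / (1 - q)))) := by
    refine key.trans ?_
    have h0 : 0 ≤ θ / (1 - q) := div_nonneg hθ (by linarith)
    have h00 : 0 ≤ q * (1 - q) := mul_nonneg hq0.le (by linarith)
    calc _ ≤ (q * n) * Z + (n * (2 * (q * (1 - q))) + n * (θ / (1 - q))) * (q * Z) := by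
          rw [hqn]; linarith
      _ = n * q * (1 + 2 * (q * (1 - q)) + θ / (1 - q)) * Z := by ring
      _ ≤ n * q * (1 + 2 * (q * (1 - q)) + θ / (1 - q)) * ((1 - q) * N * (1 + κ)) := by
          refine mul_le_mul_of_nonneg_left hZle ?_
          refine mul_nonneg (mul_nonneg hnpos.le hq0.le) (by linarith)
      _ = _ := by ring
  -- The density lies in [q - θ, q] with q ≤ 1/2, where x(1-x) is increasing.
  have hlow : N * ((q - θ) * (1 - q + θ)) ≤ a - a ^ 2 / N := by
    set x := a / N with hx
    have e1 : a = N * x := by rw [hx]; field_simp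
    have h1 : q - θ ≤ x := by rw [hx, le_div_iff₀ hNpos]; exact haθ
    have h2 : x ≤ q := by rw [hx, div_le_iff₀ hNpos]; exact haq
    have h3 : a - a ^ 2 / N = N * (x * (1 - x)) := by rw [e1]; field_simp
    rw [h3]
    refine mul_le_mul_of_nonneg_left ?_ hNpos.le
    nlinarith
  have h1 : N * (2 * ((n : ℝ) - 1) * ((q - θ) * (1 - q + θ))) ≤
      N * (n * (q * (1 - q)) * ((1 + κ) * (1 + 2 * (q * (1 - q)) + θ / (1 - q)))) := by
    refine le_trans ?_ hfin
    have : N * (2 * ((n : ℝ) - 1) * ((q - θ) * (1 - q + θ)))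
      = 2 * ((n : ℝ) - 1) * (N * ((q - θ) * (1 - q + θ))) := by ring
    rw [this]
    exact mul_le_mul_of_nonneg_left hlow (by linarith)
  exact le_of_mul_le_mul_left h1 hNpos

end Level

/-! ### Choice of constants and existence of a nearly universal element. -/

theorem mul_pow_le_of_le {x c : ℝ} {k₀ : ℕ} (hx0 : 0 ≤ x) (hx : x * (k₀ + 1) ≤ k₀)
    (hk₀ : 0 < k₀) (h0 : k₀ * x ^ k₀ ≤ c) {k : ℕ} (hk : k₀ ≤ k) : k * x ^ k ≤ c := by
  induction k, hk using Nat.le_induction with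
  | base => exact h0
  | succ k hk ih =>
    refine le_trans ?_ ih
    have h1 : (k₀ : ℝ) ≤ k := by exact_mod_cast hk
    have h2 : (0 : ℝ) < k₀ := by exact_mod_cast hk₀
    have h3 : x * (k + 1) ≤ k := by
      have : x ≤ k₀ / (k₀ + 1) := by rw [le_div_iff₀ (by linarith)]; exact hx
      have h4 : (k₀ : ℝ) / (k₀ + 1) ≤ k / (k + 1) := by
        rw [div_le_div_iff₀ (by linarith) (by linarith)]; nlinarith
      have h5 := this.trans h4
      rwa [le_div_iff₀ (by linarith)] at h5
    calc ((k + 1 : ℕ) : ℝ) * x ^ (k + 1) = (x * (k + 1)) * x ^ k := by push_cast; ring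
      _ ≤ k * x ^ k := mul_le_mul_of_nonneg_right h3 (pow_nonneg hx0 _)

/-- After division by n both sides depend on n only through 2(n-1)/n, at least 59/30 for n ≥ 60 and
148/75 for n ≥ 75; what remains is a polynomial inequality in q on [1/4, 1/2). -/
theorem numeric_contradiction {n q θ θ₀ κ₀ : ℝ} (hn : 0 < n) (hq : 1 / 4 ≤ q) (hq2 : q < 1 / 2)
    (hθ : 0 ≤ θ)
    (h : (θ₀ = 0.042 ∧ κ₀ = 0.185 ∧ 60 ≤ n) ∨ (θ₀ = 0.0103 ∧ κ₀ = 0.2745 ∧ 75 ≤ n))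
    (hθ₀ : θ ≤ θ₀) :
    n * (q * (1 - q)) * ((1 + κ₀) * (1 + 2 * (q * (1 - q)) + θ / (1 - q)))
      < 2 * (n - 1) * ((q - θ) * (1 - q + θ)) := by
  have e1 : n * (q * (1 - q)) * ((1 + κ₀) * (1 + 2 * (q * (1 - q)) + θ / (1 - q)))
      = n * ((1 + κ₀) * (q * (1 - q) + 2 * (q * (1 - q)) ^ 2 + q * θ)) := by
    have : 1 - q ≠ 0 := by linarith
    field_simp
  rw [e1]
  have h1 : (q - θ₀) * (1 - q + θ₀) ≤ (q - θ) * (1 - q + θ) := by nlinarith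
  have hκ : 0 ≤ 1 + κ₀ := by rcases h with h | h <;> rw [h.2.1] <;> norm_num
  have h2 : (1 + κ₀) * (q * (1 - q) + 2 * (q * (1 - q)) ^ 2 + q * θ)
      ≤ (1 + κ₀) * (q * (1 - q) + 2 * (q * (1 - q)) ^ 2 + q * θ₀) := by
    have : q * θ ≤ q * θ₀ := mul_le_mul_of_nonneg_left hθ₀ (by linarith)
    exact mul_le_mul_of_nonneg_left (by linarith) hκ
  have hmain : ∀ c : ℝ, (θ₀ = 0.042 ∧ κ₀ = 0.185 ∧ 59 / 30 ≤ c) ∨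
      (θ₀ = 0.0103 ∧ κ₀ = 0.2745 ∧ 148 / 75 ≤ c) →
      (1 + κ₀) * (q * (1 - q) + 2 * (q * (1 - q)) ^ 2 + q * θ₀)
        < c * ((q - θ₀) * (1 - q + θ₀)) := by
    intro c hc
    have hu : 3 / 16 ≤ q * (1 - q) := by nlinarith
    have hu2 : q * (1 - q) ≤ 1 / 4 := by nlinarith [sq_nonneg (1 - 2 * q)]
    -- Centring at 1/4 makes p and 1/4 - p nonnegative; their products certify positivity of the
    -- quartic.
    obtain ⟨p, rfl⟩ : ∃ p, q = p + 1 / 4 := ⟨q - 1 / 4, by ring⟩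
    have hp0 : 0 ≤ p := by linarith
    have hp1 : 0 ≤ 1 / 4 - p := by linarith
    have m1 := mul_nonneg hp0 hp1
    have m2 := mul_nonneg m1 hp0
    have m3 := mul_nonneg m1 hp1
    have m4 := mul_nonneg m1 m1
    have m5 := mul_nonneg m2 hp0
    have m6 := mul_nonneg m3 hp1
    rcases hc with ⟨rfl, rfl, hc⟩ | ⟨rfl, rfl, hc⟩
    · have : 59 / 30 * ((p + 1 / 4 - 0.042) * (1 - (p + 1 / 4) + 0.042))
        ≤ c * ((p + 1 / 4 - 0.042) * (1 - (p + 1 / 4) + 0.042)) :=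
        mul_le_mul_of_nonneg_right hc (mul_nonneg (by norm_num; linarith) (by norm_num; linarith))
      refine lt_of_lt_of_le ?_ this
      nlinarith
    · have : 148 / 75 * ((p + 1 / 4 - 0.0103) * (1 - (p + 1 / 4) + 0.0103))
        ≤ c * ((p + 1 / 4 - 0.0103) * (1 - (p + 1 / 4) + 0.0103)) :=
        mul_le_mul_of_nonneg_right hc (mul_nonneg (by norm_num; linarith) (by norm_num; linarith))
      refine lt_of_lt_of_le ?_ this
      nlinarith
  have h3 := hmain (2 * (n - 1) / n) (by
    rcases h with ⟨a1, a2, a3⟩ | ⟨a1, a2, a3⟩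
    · exact Or.inl ⟨a1, a2, by rw [div_le_div_iff₀ (by norm_num) hn]; linarith⟩
    · exact Or.inr ⟨a1, a2, by rw [div_le_div_iff₀ (by norm_num) hn]; linarith⟩)
  calc _ ≤ n * ((1 + κ₀) * (q * (1 - q) + 2 * (q * (1 - q)) ^ 2 + q * θ₀)) :=
        mul_le_mul_of_nonneg_left h2 hn.le
    _ < n * (2 * (n - 1) / n * ((q - θ₀) * (1 - q + θ₀))) := mul_lt_mul_of_pos_left h3 hn
    _ = 2 * (n - 1) * ((q - θ₀) * (1 - q + θ₀)) := by field_simp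
    _ ≤ _ := by
        refine mul_le_mul_of_nonneg_left h1 ?_
        rcases h with h | h <;> linarith [h.2.2]

/-- The admissible ranges of the parameters. -/
def AdmissibleParams (n k t : ℕ) : Prop :=
  (t = 1 ∧ 2 * k + 5 ≤ n ∧ 35 ≤ k) ∨ (2 ≤ t ∧ 4 * t + 8 ≤ k ∧ 2 * k + 14 * t ≤ n)

/-- Starting at level max(k, ⌈n/4⌉) keeps q ≥ 1/4 and the base of the power well below 1, while the
gap up to ⌊n/2⌋ stays large enough to absorb the initial error. If n ≤ 4k then l = k and the gap
comes from the excess of n over 2k; otherwise it is about n/4. -/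
theorem parameter_bounds {n k t l : ℕ} (h : AdmissibleParams n k t) (hl : l = max k ((n + 3) / 4)) :
    ∃ θ₀ κ₀ : ℝ, ((θ₀ = 0.042 ∧ κ₀ = 0.185 ∧ (60 : ℝ) ≤ n) ∨
        (θ₀ = 0.0103 ∧ κ₀ = 0.2745 ∧ (75 : ℝ) ≤ n)) ∧
      (1 - (l : ℝ) / n) * (t / (n - t)) + (((n : ℝ) - l) / (n - t - 1)) ^ k / 2 ≤ θ₀ ∧
      n * ((1 - (l : ℝ) / n) * (t / (n - t)) + (((n : ℝ) - l) / (n - t - 1)) ^ k / 2)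
        ≤ κ₀ * ((n / 2 - l : ℕ) : ℝ) := by
  set e : ℝ := (((n : ℝ) - l) / (n - t - 1)) ^ k with he
  have hln : 4 * (n - l) ≤ 3 * n := by omega
  have hl' : l ≤ n := by rcases h with h | h <;> omega
  have hlR : 4 * ((n : ℝ) - l) ≤ 3 * n := by
    have : ((4 * (n - l) : ℕ) : ℝ) ≤ ((3 * n : ℕ) : ℝ) := by exact_mod_cast hln
    rw [Nat.cast_mul, Nat.cast_sub hl'] at this
    push_cast at this
    exact this
  have hl0 : (0 : ℝ) ≤ (n : ℝ) - l := sub_nonneg.2 (by exact_mod_cast hl')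
  rcases h with ⟨rfl, h1, h2⟩ | ⟨h1, h2, h3⟩
  · have hn75 : (75 : ℝ) ≤ n := by exact_mod_cast (by omega : 75 ≤ n)
    refine ⟨0.0103, 0.2745, Or.inr ⟨rfl, rfl, hn75⟩, ?_⟩
    have hx : ((n : ℝ) - l) / (n - (1 : ℕ) - 1) ≤ 0.771 := by
      push_cast
      rw [div_le_iff₀ (by linarith)]
      norm_num
      linarith
    have hx0 : 0 ≤ ((n : ℝ) - l) / (n - (1 : ℕ) - 1) := div_nonneg hl0 (by push_cast; linarith)
    have hek : e ≤ 0.771 ^ k := pow_le_pow_left₀ hx0 hx k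
    have hke : (k : ℝ) * 0.771 ^ k ≤ 0.00391 :=
      mul_pow_le_of_le (k₀ := 35) (by norm_num) (by norm_num) (by norm_num) (by norm_num) h2
    have hk35 : (35 : ℝ) ≤ k := by exact_mod_cast h2
    have he0 : 0 ≤ e := pow_nonneg hx0 _
    have hke' : (k : ℝ) * e ≤ 0.00391 := le_trans (by gcongr) hke
    have he1 : e ≤ 0.000112 := by nlinarith
    push_cast
    have hnl : 1 - (l : ℝ) / n = (n - l) / n := by field_simp
    have hθ : (1 - (l : ℝ) / n) * (1 / (n - 1)) + e / 2 ≤ 0.0103 := by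
      have a1 : 1 - (l : ℝ) / n ≤ 3 / 4 := by rw [hnl, div_le_div_iff₀ (by linarith) (by norm_num)]; linarith
      have a2 : 1 / ((n : ℝ) - 1) ≤ 1 / 74 := one_div_le_one_div_of_le (by norm_num) (by linarith)
      have a3 : (1 - (l : ℝ) / n) * (1 / (n - 1)) ≤ 3 / 4 * (1 / 74) :=
        mul_le_mul a1 a2 (by rw [one_div]; exact inv_nonneg.2 (by linarith)) (by norm_num)
      norm_num at a3 he1 ⊢
      linarith
    refine ⟨hθ, ?_⟩
    have hnθ : n * ((1 - (l : ℝ) / n) * (1 / (n - 1)) + e / 2) = (n - l) / (n - 1) + n * e / 2 := by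
      field_simp
    rcases le_or_gt n (4 * k) with hc | hc
    · have hlk : l = k := by omega
      subst hlk
      have hcR : (n : ℝ) ≤ 4 * l := by exact_mod_cast hc
      have hne : n * e / 2 ≤ 0.00782 := by
        have : n * e ≤ 4 * (l * e) := by nlinarith
        linarith
      rw [hnθ]
      -- The tight case: the gap is only 2, and k ≥ 35 gives (n-l)/(n-1) ≤ 40/74, just under
      -- 2·0.2745 with room for the exponential term.
      rcases eq_or_ne n (2 * l + 5) with hn5 | hn5
      · have hw : n / 2 - l = 2 := by omega
        rw [hw]
        have hnR : (n : ℝ) = 2 * l + 5 := by exact_mod_cast hn5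
        have : ((n : ℝ) - l) / (n - 1) ≤ 40 / 74 := by
          rw [div_le_div_iff₀ (by linarith) (by norm_num)]; linarith
        norm_num at this hne ⊢
        linarith
      · have hw : 3 ≤ n / 2 - l := by omega
        have hwR : (3 : ℝ) ≤ ((n / 2 - l : ℕ) : ℝ) := by exact_mod_cast hw
        have : ((n : ℝ) - l) / (n - 1) ≤ 0.77 := by
          rw [div_le_iff₀ (by linarith)]; linarith
        norm_num at this hne ⊢
        linarith
    · have hn140 : (140 : ℝ) ≤ n := by exact_mod_cast (by omega : 140 ≤ n)
      have hw : n ≤ 4 * (n / 2 - l) + 5 := by omega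
      have hwR : (n : ℝ) ≤ 4 * ((n / 2 - l : ℕ) : ℝ) + 5 := by exact_mod_cast hw
      have : (n : ℝ) * ((1 - (l : ℝ) / n) * (1 / (n - 1)) + e / 2) ≤ n * 0.0103 :=
        mul_le_mul_of_nonneg_left hθ (by linarith)
      norm_num at this ⊢
      linarith
  · have hkt : (4 : ℝ) * t + 8 ≤ k := by exact_mod_cast h2
    have hnk : (2 : ℝ) * k + 14 * t ≤ n := by exact_mod_cast h3
    have ht2 : (2 : ℝ) ≤ t := by exact_mod_cast h1
    have hn60 : (60 : ℝ) ≤ n := by linarith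
    refine ⟨0.042, 0.185, Or.inl ⟨rfl, rfl, hn60⟩, ?_⟩
    have hx : ((n : ℝ) - l) / (n - t - 1) ≤ 0.79 := by
      rw [div_le_iff₀ (by linarith)]
      norm_num
      linarith
    have hx0 : 0 ≤ ((n : ℝ) - l) / (n - t - 1) := div_nonneg hl0 (by linarith)
    have hek : e ≤ 0.79 ^ k := pow_le_pow_left₀ hx0 hx k
    have hke : (k : ℝ) * 0.79 ^ k ≤ 0.37 :=
      mul_pow_le_of_le (k₀ := 16) (by norm_num) (by norm_num) (by norm_num) (by norm_num) (by omega)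
    have he0 : 0 ≤ e := pow_nonneg hx0 _
    have hke' : (k : ℝ) * e ≤ 0.37 := le_trans (by gcongr) hke
    have hnl : 1 - (l : ℝ) / n = (n - l) / n := by field_simp
    have hnt : (0 : ℝ) < n - t := by linarith
    have a1 : 1 - (l : ℝ) / n ≤ 3 / 4 := by
      rw [hnl, div_le_div_iff₀ (by linarith) (by norm_num)]; linarith
    have hθ : (1 - (l : ℝ) / n) * (t / (n - t)) + e / 2 ≤ 0.042 := by
      have hs0 : 0 ≤ (t : ℝ) / (n - t) := by positivity
      have a3 : (1 - (l : ℝ) / n) * (t / (n - t)) ≤ 3 / 4 * (t / (n - t)) :=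
        mul_le_mul_of_nonneg_right a1 hs0
      rcases eq_or_ne t 2 with rfl | ht
      · have h16 : e ≤ 0.79 ^ 16 := hek.trans (pow_le_pow_of_le_one (by norm_num) (by norm_num) (by omega))
        have a2 : ((2 : ℕ) : ℝ) / (n - (2 : ℕ)) ≤ 1 / 29 := by
          push_cast
          rw [div_le_div_iff₀ (by linarith) (by norm_num)]; linarith
        norm_num at a2 a3 h16 ⊢
        linarith
      · have h20 : e ≤ 0.79 ^ 20 := hek.trans (pow_le_pow_of_le_one (by norm_num) (by norm_num) (by omega))
        have a2 : (t : ℝ) / (n - t) ≤ 1 / 21 := by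
          rw [div_le_div_iff₀ hnt (by norm_num)]; linarith
        norm_num at a2 a3 h20 ⊢
        linarith
    refine ⟨hθ, ?_⟩
    rcases le_or_gt n (4 * k) with hc | hc
    · have hlk : l = k := by omega
      subst hlk
      have hcR : (n : ℝ) ≤ 4 * l := by exact_mod_cast hc
      have hne : n * e ≤ 1.48 := by
        have : n * e ≤ 4 * (l * e) := by nlinarith
        norm_num at hke' ⊢
        linarith
      have hw : n ≤ 2 * (n / 2 - l) + 2 * l + 1 := by omega
      have hwR : (n : ℝ) ≤ 2 * ((n / 2 - l : ℕ) : ℝ) + 2 * l + 1 := by exact_mod_cast hw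
      set w : ℝ := ((n / 2 - l : ℕ) : ℝ) with hwdef
      have hw2 : (14 * (t : ℝ) - 1) ≤ 2 * w := by linarith
      have hnθ : n * ((1 - (l : ℝ) / n) * (t / (n - t)) + e / 2)
          = ((n - l) / (n - t)) * t + n * e / 2 := by
        field_simp
      have a4 : ((n : ℝ) - l) / (n - t) ≤ 0.786 := by
        rw [div_le_iff₀ hnt]
        norm_num
        linarith
      rw [hnθ]
      have a5 : ((n : ℝ) - l) / (n - t) * t ≤ 0.786 * t :=
        mul_le_mul_of_nonneg_right a4 (by linarith)
      norm_num at a5 hne ⊢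
      linarith
    · have hn65 : (65 : ℝ) ≤ n := by exact_mod_cast (by omega : 65 ≤ n)
      have hw : n ≤ 4 * (n / 2 - l) + 5 := by omega
      have hwR : (n : ℝ) ≤ 4 * ((n / 2 - l : ℕ) : ℝ) + 5 := by exact_mod_cast hw
      have : (n : ℝ) * ((1 - (l : ℝ) / n) * (t / (n - t)) + e / 2) ≤ n * 0.042 :=
        mul_le_mul_of_nonneg_left hθ (by linarith)
      norm_num at this ⊢
      linarith

theorem exists_step_le {f : ℕ → ℝ} {l m : ℕ} (hlm : l < m) {c : ℝ}
    (h : f m - f l ≤ c * ((m - l : ℕ) : ℝ)) : ∃ j, l ≤ j ∧ j < m ∧ f (j + 1) - f j ≤ c := by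
  by_contra hcon
  push Not at hcon
  have h1 : ∑ j ∈ Ico l m, (f (j + 1) - f j) = f m - f l := sum_Ico_sub f hlm.le
  have h2 : ∑ _j ∈ Ico l m, c < ∑ j ∈ Ico l m, (f (j + 1) - f j) := by
    refine sum_lt_sum_of_nonempty (nonempty_Ico.2 hlm) fun j hj => ?_
    rw [mem_Ico] at hj
    exact hcon j hj.1 hj.2
  rw [h1, sum_const, Nat.card_Ico, nsmul_eq_mul] at h2
  linarith

/-- If all `t`-degrees are large, then some element lies in almost all members. -/
theorem exists_card_filter_notMem_lt {n k t : ℕ} (h : AdmissibleParams n k t)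
    {F : Finset (Finset (Fin n))} (hF : (F : Set (Finset (Fin n))).Sized k)
    (hint : (F : Set (Finset (Fin n))).Intersecting)
    (hd : ∀ T : Finset (Fin n), #T = t →
      (n - t - 1).choose (k - t - 1) - (n - t - k - 1).choose (k - t - 1) ≤ subsetDegree F T) :
    ∃ i, #(F.filter fun A => i ∉ A) < (n - 3).choose (k - 2) := by
  by_contra hcon
  push Not at hcon
  obtain ⟨l, hl⟩ : ∃ l, l = max k ((n + 3) / 4) := ⟨_, rfl⟩
  obtain ⟨θ₀, κ₀, hcase, hθ₀, hκ₀⟩ := parameter_bounds h hl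
  set θ := (1 - (l : ℝ) / n) * (t / (n - t)) + (((n : ℝ) - l) / (n - t - 1)) ^ k / 2 with hθ
  have hlm : l < n / 2 := by rcases h with h | h <;> omega
  have ht1 : 1 ≤ t := by rcases h with h | h <;> omega
  have htk : t + 2 ≤ k := by rcases h with h | h <;> omega
  have hkl : k ≤ l := by omega
  have hnl : n ≤ 4 * l := by omega
  have hln : (l : ℝ) ≤ n := by exact_mod_cast (by omega : l ≤ n)
  have hn0 : (0 : ℝ) < n := by exact_mod_cast (by omega : 0 < n)
  have hnt : (0 : ℝ) < (n : ℝ) - t - 1 := by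
    have : ((t + 1 : ℕ) : ℝ) < n := by exact_mod_cast (by omega : t + 1 < n)
    push_cast at this
    linarith
  have hx0 : 0 ≤ ((n : ℝ) - l) / (n - t - 1) := div_nonneg (by linarith) hnt.le
  have hl1 : 0 ≤ 1 - (l : ℝ) / n := by rw [sub_nonneg, div_le_one hn0]; exact hln
  have hs0 : (0 : ℝ) ≤ t / (n - t) := div_nonneg t.cast_nonneg (by linarith)
  have hθ0 : 0 ≤ θ := by rw [hθ]; positivity
  -- vertex degrees in the higher levels
  have hdeg : ∀ j, l ≤ j → j ≤ n / 2 → ∀ i, ((n - 1).choose (j - 1) : ℝ) * ((j : ℝ) / n - θ)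
      ≤ vertexDegree (upAt univ j F) i := by
    intro j hj1 hj2 i
    have h1 := le_vertexDegree_of_le_subsetDegree (F := upAt univ j F) (s := k) (t := t)
      (upAt_subset univ j) ht1 (by omega) (by omega) (by omega) (fun T hT =>
        le_subsetDegree_upAt hF hT htk (by omega) (by omega) (hd T hT)) i
    refine le_trans (mul_le_mul_of_nonneg_left ?_ (Nat.cast_nonneg _)) h1
    have hjl : (l : ℝ) ≤ j := by exact_mod_cast hj1
    have hjn : 2 * (j : ℝ) ≤ n := by exact_mod_cast (by omega : 2 * j ≤ n)
    have htj : (t : ℝ) ≤ j := by exact_mod_cast (by omega : t ≤ j)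
    have he : (((n : ℝ) - j) / (n - t - 1)) ^ k ≤ (((n : ℝ) - l) / (n - t - 1)) ^ k := by
      refine pow_le_pow_left₀ (div_nonneg (by linarith) hnt.le) ?_ k
      gcongr
    have he0 : 0 ≤ (((n : ℝ) - j) / (n - t - 1)) ^ k :=
      pow_nonneg (div_nonneg (by linarith) hnt.le) _
    have h2 : ((j : ℝ) - t) / (n - t) ≤ 1 / 2 := by
      rw [div_le_div_iff₀ (by linarith) two_pos]; linarith
    -- This identity is the source of the first term of `θ`; the second comes from the power, using
    -- that its coefficient is at most 1/2.
    have h3 : (j : ℝ) / n - (1 - (j : ℝ) / n) * (t / (n - t)) = ((j : ℝ) - t) / (n - t) := by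
      have : (n : ℝ) - t ≠ 0 := by linarith
      field_simp
      ring
    have h4 : (1 - (j : ℝ) / n) * (t / (n - t)) ≤ (1 - (l : ℝ) / n) * (t / (n - t)) := by
      refine mul_le_mul_of_nonneg_right ?_ hs0
      gcongr
    have h5 : ((j : ℝ) - t) / (n - t) * (((n : ℝ) - j) / (n - t - 1)) ^ k
        ≤ 1 / 2 * (((n : ℝ) - l) / (n - t - 1)) ^ k := mul_le_mul h2 he he0 (by norm_num)
    rw [hθ]
    linarith
  set α : ℕ → ℝ := fun j => #(upAt univ j F) / n.choose j with hα
  have hαl : (l : ℝ) / n - θ ≤ α l := by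
    have h1 := sum_vertexDegree (upAt_subset (F := F) univ l)
    have h2 : ∑ _i : Fin n, ((n - 1).choose (l - 1) : ℝ) * ((l : ℝ) / n - θ) ≤
      ∑ i, (vertexDegree (upAt univ l F) i : ℝ) :=
      sum_le_sum fun i _ => hdeg l le_rfl hlm.le i
    rw [h1, sum_const, card_univ, Fintype.card_fin, nsmul_eq_mul, ← mul_assoc] at h2
    have h3 := Nat.add_one_mul_choose_eq (n - 1) (l - 1)
    rw [Nat.sub_add_cancel (by omega), Nat.sub_add_cancel (by omega)] at h3
    have h4 : (n : ℝ) * (n - 1).choose (l - 1) = l * n.choose l := by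
      rw [mul_comm (l : ℝ)]; exact_mod_cast h3
    rw [h4, mul_assoc] at h2
    have hl0 : (0 : ℝ) < l := by exact_mod_cast (by omega : 0 < l)
    have hc : (0 : ℝ) < n.choose l := by exact_mod_cast Nat.choose_pos (by omega)
    rw [hα, le_div_iff₀ hc, mul_comm]
    exact le_of_mul_le_mul_left h2 hl0
  have hαm : α (n / 2) ≤ ((n / 2 : ℕ) : ℝ) / n := by
    have h1 := erdos_ko_rado (intersecting_upAt hint univ (n / 2)) (sized_upAt univ (n / 2)) le_rfl
    have h3 := Nat.add_one_mul_choose_eq (n - 1) (n / 2 - 1)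
    rw [Nat.sub_add_cancel (by omega), Nat.sub_add_cancel (by omega)] at h3
    have h4 : (n : ℝ) * (n - 1).choose (n / 2 - 1) = n.choose (n / 2) * ((n / 2 : ℕ) : ℝ) := by
      exact_mod_cast h3
    have hc : (0 : ℝ) < n.choose (n / 2) := by exact_mod_cast Nat.choose_pos (by omega)
    rw [hα]
    change _ / _ ≤ _
    rw [div_le_div_iff₀ hc hn0, mul_comm _ ((n.choose (n / 2) : ℕ) : ℝ), ← h4, mul_comm]
    have : (#(upAt univ (n / 2) F) : ℝ) ≤ (n - 1).choose (n / 2 - 1) := by exact_mod_cast h1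
    exact mul_le_mul_of_nonneg_left this hn0.le
  -- The density rises by at most ⌊n/2⌋/n - l/n + θ over ⌊n/2⌋ - l steps, and θ is at most κ₀(⌊n/2⌋
  -- - l)/n, so some step is at most (1+κ₀)/n.
  obtain ⟨j, hlj, hjm, hstep⟩ := exists_step_le (f := α) hlm (c := (1 + κ₀) / n) (by
    have h1 : ((n / 2 - l : ℕ) : ℝ) = ((n / 2 : ℕ) : ℝ) - l := Nat.cast_sub hlm.le
    have h2 : θ ≤ κ₀ * ((n / 2 - l : ℕ) : ℝ) / n := by rw [le_div_iff₀ hn0, mul_comm]; exact hκ₀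
    have h3 : (1 + κ₀) / n * ((n / 2 - l : ℕ) : ℝ)
        = (((n / 2 : ℕ) : ℝ) / n - l / n) + κ₀ * ((n / 2 - l : ℕ) : ℝ) / n := by
      rw [h1]; ring
    rw [h3]
    linarith)
  obtain ⟨r, rfl⟩ : ∃ r, j = r + 3 := ⟨j - 3, by omega⟩
  have hq1 : (1 : ℝ) / 4 ≤ ((r + 3 : ℕ) : ℝ) / n := by
    rw [div_le_div_iff₀ (by norm_num) hn0]
    have : (n : ℝ) ≤ 4 * ((r + 3 : ℕ) : ℝ) := by exact_mod_cast (by omega : n ≤ 4 * (r + 3))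
    linarith
  have hq2 : ((r + 3 : ℕ) : ℝ) / n < 1 / 2 := by
    rw [div_lt_div_iff₀ hn0 (by norm_num)]
    have : 2 * ((r + 3 : ℕ) : ℝ) < n := by exact_mod_cast (by omega : 2 * (r + 3) < n)
    linarith
  have key := level_inequality hF hint (by omega) (r := r) (by omega) (by omega) hcon
    (q := ((r + 3 : ℕ) : ℝ) / n) (θ := θ) (κ := κ₀) (by push_cast; ring) hθ0
    (by rcases hcase with h | h <;> rw [h.1] at hθ₀ <;> norm_num at hθ₀ <;> linarith)
    (fun i => hdeg (r + 3) hlj hjm.le i) hstep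
  exact absurd key (not_le.2 (numeric_contradiction hn0 hq1 hq2 hθ0 hcase hθ₀))

/-! ### The minimum degree of the Hilton–Milner family. -/

section HiltonMilner

variable {n k t : ℕ}

theorem card_filter_subset_inter_nonempty_add {T H : Finset (Fin n)} (hTk : #T ≤ k)
    (hTH : Disjoint T H) :
    #((powersetCard k univ).filter fun A => T ⊆ A ∧ (A ∩ H).Nonempty)
      + (n - #T - #H).choose (k - #T) = (n - #T).choose (k - #T) := by
  have h1 := card_filter_subset_powersetCard (subset_univ T) hTk
  have h2 := card_filter_subset_powersetCard (S := Hᶜ) (T := T)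
    (subset_compl_iff_disjoint_right.2 hTH) hTk
  rw [card_univ, Fintype.card_fin] at h1
  rw [card_compl, Fintype.card_fin, Nat.sub_right_comm] at h2
  rw [← h1, ← h2, ← card_filter_add_card_filter_not (s := (powersetCard k univ).filter fun A => T ⊆ A)
    (fun A => (A ∩ H).Nonempty), filter_filter, filter_filter]
  congr 2
  ext A
  simp only [mem_filter, mem_powersetCard, subset_univ, true_and, not_nonempty_iff_eq_empty,
    ← disjoint_iff_inter_eq_empty, subset_compl_iff_disjoint_right]
  tauto

theorem choose_le_card_filter_subset_inter_nonempty_add {T H : Finset (Fin n)} (hTk : #T ≤ k) :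
    (n - #T).choose (k - #T) ≤
      #((powersetCard k univ).filter fun A => T ⊆ A ∧ (A ∩ H).Nonempty)
        + (n - #T - #H).choose (k - #T) := by
  by_cases hTH : Disjoint T H
  · exact (card_filter_subset_inter_nonempty_add hTk hTH).ge
  · have h1 := card_filter_subset_powersetCard (subset_univ T) hTk
    rw [card_univ, Fintype.card_fin] at h1
    rw [← h1]
    refine le_add_right (card_le_card fun A hA => ?_)
    obtain ⟨h2, h3⟩ := mem_filter.1 hA
    refine mem_filter.2 ⟨h2, h3, ?_⟩
    obtain ⟨x, hx, hx'⟩ := not_disjoint_iff.1 hTH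
    exact ⟨x, mem_inter.2 ⟨h3 hx, hx'⟩⟩

theorem card_hmSet (h : k + 1 ≤ n) : #(hmSet n k) = k := by
  have : (hmSet n k).map Fin.valEmbedding = Icc 1 k := by
    ext a
    simp only [hmSet, mem_map, mem_filter, mem_univ, true_and, Fin.valEmbedding_apply, mem_Icc]
    constructor
    · rintro ⟨i, hi, rfl⟩
      exact hi
    · intro ha
      exact ⟨⟨a, by omega⟩, ha, rfl⟩
  rw [← card_map Fin.valEmbedding, this, Nat.card_Icc]
  omega

theorem le_subsetDegree_hiltonMilner (htk : t + 1 ≤ k) (hkn : 2 * k + 1 ≤ n)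
    {T : Finset (Fin n)} (hT : #T = t) :
    (n - t - 1).choose (k - t - 1)
      ≤ subsetDegree (hiltonMilner n k) T + (n - t - k - 1).choose (k - t - 1) := by
  obtain ⟨z, hz⟩ : ∃ z : Fin n, (z : ℕ) = 0 := ⟨⟨0, by omega⟩, rfl⟩
  have hsub : #((powersetCard k univ).filter fun A => insert z T ⊆ A ∧ (A ∩ hmSet n k).Nonempty)
      ≤ subsetDegree (hiltonMilner n k) T := by
    refine card_le_card fun A hA => ?_
    obtain ⟨h1, h2, h3⟩ := mem_filter.1 hA
    obtain ⟨h4, h5⟩ := insert_subset_iff.1 h2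
    exact mem_filter.2 ⟨mem_insert_of_mem (mem_filter.2 ⟨h1, ⟨z, h4, hz⟩, h3⟩), h5⟩
  by_cases hzT : z ∈ T
  · rw [insert_eq_of_mem hzT] at hsub
    have h1 := choose_le_card_filter_subset_inter_nonempty_add (T := T) (H := hmSet n k) (k := k)
      (by omega)
    rw [card_hmSet (by omega), hT] at h1
    obtain ⟨a, ha⟩ : ∃ a, k - t = a + 1 := ⟨k - t - 1, by omega⟩
    -- A set `T` through the centre has a larger degree; Pascal's rule exhibits the surplus over the
    -- claimed value.
    have p1 := Nat.choose_succ_succ' (n - t - 1) a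
    have p2 := Nat.choose_succ_succ' (n - t - k - 1) a
    rw [show n - t - 1 + 1 = n - t by omega] at p1
    rw [show n - t - k - 1 + 1 = n - t - k by omega] at p2
    rw [ha] at h1 ⊢
    have p3 : (n - t - k - 1).choose (a + 1) ≤ (n - t - 1).choose (a + 1) :=
      Nat.choose_le_choose _ (by omega)
    simp only [Nat.add_sub_cancel]
    omega
  · have h1 := choose_le_card_filter_subset_inter_nonempty_add (T := insert z T) (H := hmSet n k)
      (k := k) (by rw [card_insert_of_notMem hzT]; omega)
    rw [card_hmSet (by omega), card_insert_of_notMem hzT, hT] at h1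
    rw [show n - t - k - 1 = n - (t + 1) - k by omega, Nat.sub_sub, Nat.sub_sub]
    omega

/-- Any `T` disjoint from the centre and from `hmSet n k` works: being non-empty it is not inside
`hmSet n k`, so only sets through the centre count. -/
theorem exists_subsetDegree_hiltonMilner_eq (ht : 1 ≤ t) (htk : t + 1 ≤ k)
    (hkn : k + t + 1 ≤ n) :
    ∃ T : Finset (Fin n), #T = t ∧ subsetDegree (hiltonMilner n k) T
      + (n - t - k - 1).choose (k - t - 1) = (n - t - 1).choose (k - t - 1) := by
  obtain ⟨z, hz⟩ : ∃ z : Fin n, (z : ℕ) = 0 := ⟨⟨0, by omega⟩, rfl⟩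
  have hzH : z ∉ hmSet n k := by simp [hmSet, hz]
  obtain ⟨T, hT, hTc⟩ := exists_subset_card_eq (s := (insert z (hmSet n k))ᶜ) (n := t) (by
    rw [card_compl, Fintype.card_fin, card_insert_of_notMem hzH, card_hmSet (by omega)]; omega)
  rw [subset_compl_iff_disjoint_right, disjoint_insert_right] at hT
  obtain ⟨hzT, hTH⟩ := hT
  refine ⟨T, hTc, ?_⟩
  have h1 := card_filter_subset_inter_nonempty_add (T := insert z T) (H := hmSet n k)
    (k := k) (by rw [card_insert_of_notMem hzT]; omega) (disjoint_insert_left.2 ⟨hzH, hTH⟩)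
  rw [card_hmSet (by omega), card_insert_of_notMem hzT, hTc] at h1
  rw [show n - t - k - 1 = n - (t + 1) - k by omega, Nat.sub_sub n t 1, Nat.sub_sub k t 1, ← h1]
  congr 1
  rw [subsetDegree]
  congr 1
  ext A
  simp only [hiltonMilner, mem_filter, mem_insert, insert_subset_iff]
  constructor
  · rintro ⟨rfl | ⟨h2, ⟨i, hi, hi0⟩, h3⟩, h4⟩
    · obtain ⟨x, hx⟩ := card_pos.1 (by omega : 0 < #T)
      exact absurd (h4 hx) (disjoint_left.1 hTH hx)
    · obtain rfl : i = z := Fin.ext (hi0.trans hz.symm)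
      exact ⟨h2, ⟨hi, h4⟩, h3⟩
  · rintro ⟨h2, ⟨h3, h4⟩, h5⟩
    exact ⟨Or.inr ⟨h2, ⟨z, h3, hz⟩, h5⟩, h4⟩

theorem minDegree_hiltonMilner (ht : 1 ≤ t) (htk : t + 1 ≤ k) (hkn : 2 * k + 1 ≤ n) :
    minDegree t (hiltonMilner n k) + (n - t - k - 1).choose (k - t - 1)
      = (n - t - 1).choose (k - t - 1) := by
  obtain ⟨T, hT, hd⟩ := exists_subsetDegree_hiltonMilner_eq ht htk (by omega : k + t + 1 ≤ n)
  have h1 : minDegree t (hiltonMilner n k) ≤ subsetDegree (hiltonMilner n k) T :=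
    Nat.sInf_le ⟨T, hT, rfl⟩
  obtain ⟨T', hT', h2⟩ := Nat.sInf_mem
    (s := {d | ∃ S : Finset (Fin n), #S = t ∧ subsetDegree (hiltonMilner n k) S = d})
    ⟨_, T, hT, rfl⟩
  have h3 := le_subsetDegree_hiltonMilner htk hkn hT'
  rw [h2] at h3
  rw [← minDegree] at h3
  omega

end HiltonMilner

/-! ### Few members avoid `i`. -/

section SmallDiversity

variable {n k t : ℕ} {F : Finset (Finset (Fin n))}

theorem sum_card_filter_subset (𝒢 : Finset (Finset (Fin n))) (S : Finset (Fin n)) (t : ℕ) :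
    ∑ T ∈ powersetCard t S, #(𝒢.filter fun G => T ⊆ G) = ∑ G ∈ 𝒢, (#(G ∩ S)).choose t := by
  have h1 := sum_card_bipartiteAbove_eq_sum_card_bipartiteBelow (fun T A : Finset (Fin n) => T ⊆ A)
    (s := powersetCard t S) (t := 𝒢)
  simp only [bipartiteAbove, bipartiteBelow] at h1
  rw [h1]
  refine sum_congr rfl fun G _ => ?_
  rw [← card_powersetCard]
  congr 1
  ext T
  simp only [mem_filter, mem_powersetCard, subset_inter_iff]
  tauto

/-- If some but few members avoid `i`, then some `t`-set has at most the Hilton–Milner degree. -/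
theorem exists_subsetDegree_add_le (hF : (F : Set (Finset (Fin n))).Sized k)
    (hint : (F : Set (Finset (Fin n))).Intersecting) (ht : 1 ≤ t) (htk : t + 2 ≤ k)
    (hkn : k + 1 + t ≤ n) {i : Fin n}
    (hpos : (F.filter fun A => i ∉ A).Nonempty)
    (hlt : (#(F.filter fun A => i ∉ A) - 1) * (k - 1).choose t
      ≤ (n - 2 * k).choose t * (n - k - t - 2).choose (k - t - 2)) :
    ∃ T : Finset (Fin n), #T = t ∧ subsetDegree F T
      + (n - t - k - 1).choose (k - t - 1) ≤ (n - t - 1).choose (k - t - 1) := by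
  by_contra! hcon
  obtain ⟨A, hA⟩ := hpos
  obtain ⟨hAF, hiA⟩ := mem_filter.1 hA
  have hAk := hF hAF
  set S : Finset (Fin n) := (insert i A)ᶜ with hS
  have hSc : #S = n - k - 1 := by
    rw [hS, card_compl, Fintype.card_fin, card_insert_of_notMem hiA, hAk]; omega
  set 𝒟 := F.filter fun A => i ∉ A with h𝒟
  -- Sets through `i` and `T` that the Hilton–Milner family built on `i` and `A` would contain but
  -- `F` lacks. A degree above the bound forces members avoiding `i` to outnumber them.
  set miss : Finset (Fin n) → Finset (Finset (Fin n)) := fun T =>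
    (powersetCard k univ).filter fun G => (insert i T ⊆ G ∧ (G ∩ A).Nonempty) ∧ G ∉ F with hmiss
  -- the degree of a set disjoint from `A` and `i`
  have hT : ∀ T ∈ powersetCard t S, #(miss T) + 1 ≤ #(𝒟.filter fun G => T ⊆ G) := by
    intro T hT
    obtain ⟨hTS, hTc⟩ := mem_powersetCard.1 hT
    rw [hS, subset_compl_iff_disjoint_right, disjoint_insert_right] at hTS
    have h1 := card_filter_subset_inter_nonempty_add (T := insert i T) (H := A)
      (k := k) (by rw [card_insert_of_notMem hTS.1]; omega) (disjoint_insert_left.2 ⟨hiA, hTS.2⟩)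
    rw [hAk, card_insert_of_notMem hTS.1, hTc] at h1
    have h2 := hcon T hTc
    rw [show n - t - k - 1 = n - (t + 1) - k by omega, Nat.sub_sub n t 1, Nat.sub_sub k t 1, ← h1] at h2
    have h3 : subsetDegree F T + #(miss T) ≤ #((powersetCard k univ).filter fun G =>
        insert i T ⊆ G ∧ (G ∩ A).Nonempty) + #(𝒟.filter fun G => T ⊆ G) := by
      rw [subsetDegree, ← card_filter_add_card_filter_not (s := F.filter fun G => T ⊆ G)
        (fun G => i ∈ G), h𝒟, filter_filter, filter_filter, filter_filter,
        ← card_filter_add_card_filter_not (s := (powersetCard k univ).filter fun G =>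
        insert i T ⊆ G ∧ (G ∩ A).Nonempty) (fun G => G ∈ F), filter_filter, filter_filter]
      have h4 : #(F.filter fun G => T ⊆ G ∧ i ∈ G) ≤ #((powersetCard k univ).filter fun G =>
          (insert i T ⊆ G ∧ (G ∩ A).Nonempty) ∧ G ∈ F) := by
        refine card_le_card fun G hG => ?_
        obtain ⟨h5, h6, h7⟩ := mem_filter.1 hG
        exact mem_filter.2 ⟨mem_powersetCard_univ.2 (hF h5), ⟨insert_subset h7 h6,
          not_disjoint_iff_nonempty_inter.1 (hint h5 hAF)⟩, h5⟩
      have h5 : #(F.filter fun G => T ⊆ G ∧ i ∉ G) = #(F.filter fun G => i ∉ G ∧ T ⊆ G) := by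
        simp only [and_comm]
      rw [hmiss]
      simp only
      omega
    omega
  have hsum : ∑ T ∈ powersetCard t S, #(miss T) + (n - k - 1).choose t ≤ (#𝒟 - 1) * (k - 1).choose t := by
    calc _ = ∑ T ∈ powersetCard t S, (#(miss T) + 1) := by
          rw [sum_add_distrib, sum_const, card_powersetCard, hSc, smul_eq_mul, mul_one]
      _ ≤ ∑ T ∈ powersetCard t S, #(𝒟.filter fun G => T ⊆ G) := sum_le_sum hT
      _ = ∑ G ∈ 𝒟, (#(G ∩ S)).choose t := sum_card_filter_subset _ _ _
      _ = ∑ G ∈ 𝒟.erase A, (#(G ∩ S)).choose t := by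
          rw [← add_sum_erase 𝒟 _ hA]
          have : A ∩ S = ∅ := by
            rw [← disjoint_iff_inter_eq_empty]
            exact disjoint_of_subset_left (subset_insert i A) disjoint_compl_right
          rw [this, card_empty, Nat.choose_eq_zero_of_lt ht, zero_add]
      -- A itself contributes nothing, and every other member spends at least one element on `A`,
      -- leaving at most k - 1 in `S`.
      _ ≤ #(𝒟.erase A) • (k - 1).choose t := by
          refine sum_le_card_nsmul _ _ _ fun G hG => Nat.choose_le_choose _ ?_
          have hGF := (mem_filter.1 (mem_of_mem_erase hG)).1
          obtain ⟨x, hx⟩ := not_disjoint_iff_nonempty_inter.1 (hint hGF hAF)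
          obtain ⟨hx1, hx2⟩ := mem_inter.1 hx
          have : G ∩ S ⊆ G.erase x := by
            intro y hy
            obtain ⟨hy1, hy2⟩ := mem_inter.1 hy
            refine mem_erase.2 ⟨?_, hy1⟩
            rintro rfl
            exact mem_compl.1 hy2 (mem_insert_of_mem hx2)
          refine (card_le_card this).trans ?_
          rw [card_erase_of_mem hx1, hF hGF]
      _ = _ := by rw [card_erase_of_mem hA, smul_eq_mul]
  have hp : 0 < (n - k - 1).choose t := Nat.choose_pos (by omega)
  rcases Nat.eq_zero_or_pos (#𝒟 - 1) with h0 | h0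
  · rw [h0, zero_mul] at hsum
    omega
  obtain ⟨B, hB, hBA⟩ := exists_mem_ne (by omega : 1 < #𝒟) A
  obtain ⟨hBF, hiB⟩ := mem_filter.1 hB
  have hBk := hF hBF
  obtain ⟨x, hxA, hxB⟩ : ∃ x ∈ A, x ∉ B := by
    by_contra! hsub
    exact hBA (eq_of_subset_of_card_le hsub (by rw [hAk, hBk])).symm
  -- Since `A` and `B` meet, their union has at most 2k - 1 elements, which leaves room for `i`.
  have hAB : #(insert i (A ∪ B)) ≤ 2 * k := by
    have h1 := card_union_add_card_inter A B
    have h2 : 0 < #(A ∩ B) := card_pos.2 (not_disjoint_iff_nonempty_inter.1 (hint hAF hBF))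
    have h3 := card_insert_le i (A ∪ B)
    omega
  have hlow : (n - 2 * k).choose t * (n - k - t - 2).choose (k - t - 2)
      ≤ ∑ T ∈ powersetCard t S, #(miss T) := by
    have hsubS : (insert i (A ∪ B))ᶜ ⊆ S :=
      compl_subset_compl.2 (insert_subset_insert _ subset_union_left)
    calc _ ≤ #(powersetCard t (insert i (A ∪ B))ᶜ) • (n - k - t - 2).choose (k - t - 2) := by
          rw [smul_eq_mul, card_powersetCard, card_compl, Fintype.card_fin]
          gcongr
      _ ≤ ∑ T ∈ powersetCard t (insert i (A ∪ B))ᶜ, #(miss T) := by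
          refine card_nsmul_le_sum _ _ _ fun T hT => ?_
          obtain ⟨hTS, hTc⟩ := mem_powersetCard.1 hT
          rw [subset_compl_iff_disjoint_right, disjoint_insert_right, disjoint_union_right] at hTS
          obtain ⟨hiT, hTA, hTB⟩ := hTS
          have hxT : x ∉ T := fun hx => disjoint_left.1 hTA hx hxA
          have hxi : x ∉ insert i T := by
            rw [mem_insert, not_or]
            exact ⟨fun h => hiA (h ▸ hxA), hxT⟩
          have hc : #(insert x (insert i T)) = t + 2 := by
            rw [card_insert_of_notMem hxi, card_insert_of_notMem hiT, hTc]
          -- Sets through `i`, `T` and `x` that avoid `B` meet `A` at `x` but cannot lie in `F`.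
          have h1 := card_filter_subset_powersetCard (S := Bᶜ) (T := insert x (insert i T)) (k := k)
            (by
              rw [subset_compl_iff_disjoint_right, disjoint_insert_left, disjoint_insert_left]
              exact ⟨hxB, hiB, hTB⟩) (by omega)
          rw [card_compl, Fintype.card_fin, hBk, hc, show n - k - (t + 2) = n - k - t - 2 by omega,
            show k - (t + 2) = k - t - 2 by omega] at h1
          rw [← h1]
          refine card_le_card fun G hG => ?_
          obtain ⟨h2, h3⟩ := mem_filter.1 hG
          obtain ⟨h4, h5⟩ := mem_powersetCard.1 h2
          obtain ⟨h6, h7⟩ := insert_subset_iff.1 h3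
          refine mem_filter.2 ⟨mem_powersetCard_univ.2 h5, ⟨h7, x, mem_inter.2 ⟨h6, hxA⟩⟩,
            fun hGF => ?_⟩
          exact hint hGF hBF (subset_compl_iff_disjoint_right.1 h4)
      _ ≤ _ := sum_le_sum_of_subset (powersetCard_mono hsubS)
  omega

end SmallDiversity

/-! ### Binomial estimates for the small range. -/

section Numerics

theorem choose_mul_pow_le_choose_mul_pow {a a' : ℕ} (h : a ≤ a') (b : ℕ) :
    a.choose b * a' ^ b ≤ a'.choose b * a ^ b := by
  induction b with
  | zero => simp
  | succ b ih =>
    have h1 := Nat.choose_succ_right_eq a b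
    have h2 := Nat.choose_succ_right_eq a' b
    have h3 : (a - b) * a' ≤ (a' - b) * a := by
      rw [Nat.sub_mul, Nat.sub_mul, mul_comm a a']
      exact Nat.sub_le_sub_left (Nat.mul_le_mul_left b h) _
    refine Nat.le_of_mul_le_mul_right ?_ (Nat.add_one_pos b)
    calc a.choose (b + 1) * a' ^ (b + 1) * (b + 1) = (a.choose b * a' ^ b) * ((a - b) * a') := by
          rw [pow_succ]; linear_combination a' ^ b * a' * h1
      _ ≤ (a'.choose b * a ^ b) * ((a' - b) * a) := Nat.mul_le_mul ih h3
      _ = _ := by rw [pow_succ]; linear_combination -(a ^ b * a * h2)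

theorem choose_mul_pow_le_choose_mul_pow_sub (a a' b c c' : ℕ) (h : c ≤ c')
    (ha : a = c + b) (ha' : a' = c' + b) :
    a'.choose b * (c + 1) ^ b ≤ a.choose b * (c' + 1) ^ b := by
  subst ha ha'
  induction b with
  | zero => simp
  | succ b ih =>
    have h1 := Nat.add_one_mul_choose_eq (c + b) b
    have h2 := Nat.add_one_mul_choose_eq (c' + b) b
    have h3 : (c' + b + 1) * (c + 1) ≤ (c + b + 1) * (c' + 1) := by nlinarith
    refine Nat.le_of_mul_le_mul_right ?_ (Nat.add_one_pos b)
    calc _ = ((c' + b).choose b * (c + 1) ^ b) * ((c' + b + 1) * (c + 1)) := by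
          rw [pow_succ, ← add_assoc]; linear_combination -((c + 1) ^ b * (c + 1) * h2)
      _ ≤ ((c + b).choose b * (c' + 1) ^ b) * ((c + b + 1) * (c' + 1)) := Nat.mul_le_mul ih h3
      _ = _ := by
          rw [pow_succ, ← add_assoc c]; linear_combination (c' + 1) ^ b * (c' + 1) * h1

/-- The smallest parameters k = 4t + 8, n = 2k + 14t. After comparing the factors with lower index
`t`, split C(17t+6, 3t+6) through its `2t`-subsets; passing from 17t+6 to 20t+7 costs at most 2^t,
and the complementary factor supplies 2^t. -/
theorem diversity_numeric_base {t : ℕ} (ht : 2 ≤ t) :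
    (20 * t + 7).choose (2 * t) * (4 * t + 7).choose t
      ≤ (14 * t).choose t * (17 * t + 6).choose (3 * t + 6) := by
  rw [mul_comm]
  refine Nat.mul_le_mul (Nat.choose_le_choose _ (by omega)) ?_
  have h1 := choose_mul_pow_le_choose_mul_pow (show 3 * t + 6 ≤ 15 * t + 6 by omega) (t + 6)
  have h2 := choose_mul_pow_le_choose_mul_pow_sub (17 * t + 6) (20 * t + 7) (2 * t) (15 * t + 6)
    (18 * t + 7) (by omega) (by omega) (by omega)
  have h3 := Nat.choose_mul (n := 17 * t + 6) (k := 3 * t + 6) (s := 2 * t) (by omega)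
  rw [show 17 * t + 6 - 2 * t = 15 * t + 6 by omega, show 3 * t + 6 - 2 * t = t + 6 by omega,
    ← Nat.choose_symm (show 2 * t ≤ 3 * t + 6 by omega),
    show 3 * t + 6 - 2 * t = t + 6 by omega] at h3
  have h4 : (3 * t + 6).choose (t + 6) * 2 ^ t ≤ (15 * t + 6).choose (t + 6) := by
    refine Nat.le_of_mul_le_mul_right (c := (3 * t + 6) ^ (t + 6)) ?_ (by positivity)
    refine le_trans ?_ h1
    rw [mul_assoc]
    refine Nat.mul_le_mul_left _ ?_
    calc 2 ^ t * (3 * t + 6) ^ (t + 6) ≤ 2 ^ (t + 6) * (3 * t + 6) ^ (t + 6) := by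
          gcongr <;> omega
      _ = (2 * (3 * t + 6)) ^ (t + 6) := (mul_pow _ _ _).symm
      _ ≤ _ := Nat.pow_le_pow_left (by omega) _
  have h5 : (20 * t + 7).choose (2 * t) ≤ (17 * t + 6).choose (2 * t) * 2 ^ t := by
    refine Nat.le_of_mul_le_mul_right (c := (15 * t + 6 + 1) ^ (2 * t)) ?_ (by positivity)
    refine h2.trans ?_
    rw [mul_assoc]
    refine Nat.mul_le_mul_left _ ?_
    rw [pow_mul, pow_mul, ← mul_pow]
    exact Nat.pow_le_pow_left (by nlinarith) _
  have hp : 0 < (3 * t + 6).choose (t + 6) := Nat.choose_pos (by omega)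
  refine Nat.le_of_mul_le_mul_right ?_ hp
  calc _ ≤ (17 * t + 6).choose (2 * t) * 2 ^ t * (3 * t + 6).choose (t + 6) :=
        Nat.mul_le_mul_right _ h5
    _ = (17 * t + 6).choose (2 * t) * ((3 * t + 6).choose (t + 6) * 2 ^ t) := by ring
    _ ≤ (17 * t + 6).choose (2 * t) * (15 * t + 6).choose (t + 6) := Nat.mul_le_mul_left _ h4
    _ = _ := h3.symm

theorem diversity_numeric_step_left {N s t : ℕ} (hN : t ≤ N) (hs : 2 * t ≤ s + t + 1)
    (h : (s + t + 3 + N - 1 + 2 * t).choose (2 * t) * (s + t + 2).choose t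
      ≤ N.choose t * (s + 1 + N).choose N) :
    (s + t + 3 + (N + 1) - 1 + 2 * t).choose (2 * t) * (s + t + 2).choose t
      ≤ (N + 1).choose t * (s + 1 + (N + 1)).choose (N + 1) := by
  have e1 := Nat.choose_mul_succ_eq N t
  have e2 := Nat.add_one_mul_choose_eq (s + 1 + N) N
  have e3 := Nat.choose_mul_succ_eq (s + t + 3 + N - 1 + 2 * t) (2 * t)
  rw [show s + t + 3 + N - 1 + 2 * t = s + t + N + 2 + 2 * t by omega] at *
  rw [show s + t + N + 2 + 2 * t + 1 - 2 * t = s + t + N + 3 by omega] at e3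
  rw [show s + t + 3 + (N + 1) - 1 + 2 * t = s + t + N + 2 + 2 * t + 1 by omega,
    show s + 1 + (N + 1) = s + 1 + N + 1 by omega]
  obtain ⟨u, rfl⟩ := Nat.exists_eq_add_of_le' hN
  rw [show u + t + 1 - t = u + 1 by omega] at e1
  have hpos : 0 < (s + t + (u + t) + 3) * (u + 1) := by positivity
  refine Nat.le_of_mul_le_mul_right ?_ hpos
  have h5 : (s + t + (u + t) + 2 + 2 * t + 1) * (u + 1) ≤
      (s + 1 + (u + t) + 1) * (s + t + (u + t) + 3) := by nlinarith
  have e12 : (u + t + 1).choose t * (s + 1 + (u + t) + 1).choose (u + t + 1) * (u + 1)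
      = (u + t).choose t * (s + 1 + (u + t)).choose (u + t) * (s + 1 + (u + t) + 1) := by
    refine Nat.eq_of_mul_eq_mul_right (Nat.add_one_pos (u + t)) ?_
    linear_combination -((s + 1 + (u + t) + 1).choose (u + t + 1) * (u + t + 1) * e1)
      - (u + t).choose t * (u + t + 1) * e2
  calc _ = (s + t + (u + t) + 2 + 2 * t).choose (2 * t) * (s + t + 2).choose t
        * ((s + t + (u + t) + 2 + 2 * t + 1) * (u + 1)) := by
        linear_combination -((s + t + 2).choose t * (u + 1) * e3)
    _ ≤ ((u + t).choose t * (s + 1 + (u + t)).choose (u + t))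
        * ((s + 1 + (u + t) + 1) * (s + t + (u + t) + 3)) := Nat.mul_le_mul h h5
    _ = _ := by linear_combination -((s + t + (u + t) + 3) * e12)

theorem diversity_numeric_step_right {N s t : ℕ} (hN : 3 * t + 2 ≤ N)
    (h : (s + t + 3 + N - 1 + 2 * t).choose (2 * t) * (s + t + 2).choose t
      ≤ N.choose t * (s + 1 + N).choose N) :
    (s + 1 + t + 3 + N - 1 + 2 * t).choose (2 * t) * (s + 1 + t + 2).choose t
      ≤ N.choose t * (s + 1 + 1 + N).choose N := by
  have e1 := Nat.choose_mul_succ_eq (s + t + 2) t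
  have e2 := Nat.choose_mul_succ_eq (s + 1 + N) N
  have e3 := Nat.choose_mul_succ_eq (s + t + 3 + N - 1 + 2 * t) (2 * t)
  rw [show s + t + 3 + N - 1 + 2 * t = s + t + N + 2 + 2 * t by omega] at *
  rw [show s + t + N + 2 + 2 * t + 1 - 2 * t = s + t + N + 3 by omega] at e3
  rw [show s + t + 2 + 1 - t = s + 3 by omega] at e1
  rw [show s + 1 + N + 1 - N = s + 2 by omega] at e2
  rw [show s + 1 + t + 3 + N - 1 + 2 * t = s + t + N + 2 + 2 * t + 1 by omega,
    show s + 1 + 1 + N = s + 1 + N + 1 by omega, show s + 1 + t + 2 = s + t + 2 + 1 by omega]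
  obtain ⟨u, rfl⟩ := Nat.exists_eq_add_of_le hN
  have hpos : 0 < (s + t + (3 * t + 2 + u) + 3) * (s + 3) * (s + 2) := by positivity
  refine Nat.le_of_mul_le_mul_right ?_ hpos
  have h5 : (s + t + (3 * t + 2 + u) + 2 + 2 * t + 1) * (s + t + 2 + 1) * (s + 2) ≤
      (s + 1 + (3 * t + 2 + u) + 1) * (s + t + (3 * t + 2 + u) + 3) * (s + 3) := by
    ring_nf
    nlinarith [Nat.zero_le (s * t * u), Nat.zero_le (s * t), Nat.zero_le (t * u), Nat.zero_le (s * u),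
      Nat.zero_le (s * s * u), Nat.zero_le (s * s * t), Nat.zero_le (s * t * t),
      Nat.zero_le (t * t), Nat.zero_le (u * u), Nat.zero_le (s * u * u), Nat.zero_le (s * s)]
  generalize 3 * t + 2 + u = N at *
  calc _ = (s + t + N + 2 + 2 * t).choose (2 * t) * (s + t + 2).choose t
        * ((s + t + N + 2 + 2 * t + 1) * (s + t + 2 + 1) * (s + 2)) := by
        linear_combination -((s + t + 2 + 1).choose t * (s + 3) * (s + 2) * e3)
          - (s + t + N + 2 + 2 * t).choose (2 * t) * (s + t + N + 2 + 2 * t + 1) * (s + 2) * e1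
    _ ≤ (N.choose t * (s + 1 + N).choose N)
        * ((s + 1 + N + 1) * (s + t + N + 3) * (s + 3)) := Nat.mul_le_mul h h5
    _ = _ := by linear_combination N.choose t * (s + t + N + 3) * (s + 3) * e2

theorem diversity_numeric_of_le {N₀ s₀ N s t : ℕ} (hN₀ : 3 * t + 2 ≤ N₀) (hs₀ : t ≤ s₀ + 1)
    (hN : N₀ ≤ N) (hs : s₀ ≤ s)
    (h : (s₀ + t + 3 + N₀ - 1 + 2 * t).choose (2 * t) * (s₀ + t + 2).choose t
      ≤ N₀.choose t * (s₀ + 1 + N₀).choose N₀) :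
    (s + t + 3 + N - 1 + 2 * t).choose (2 * t) * (s + t + 2).choose t
      ≤ N.choose t * (s + 1 + N).choose N := by
  induction N, hN using Nat.le_induction with
  | base =>
    induction s, hs using Nat.le_induction with
    | base => exact h
    | succ s hs ih => exact diversity_numeric_step_right hN₀ ih
  | succ N hN ih => exact diversity_numeric_step_left (by omega) (by omega) ih

/-- In the variables N = n - 2k and s = k - t - 3 the inequality is preserved when either grows, so
only the smallest admissible pair needs checking. -/
theorem choose_mul_choose_le_of_admissibleParams {n k t : ℕ} (h : AdmissibleParams n k t) :
    (n - k - 1 + 2 * t).choose (2 * t) * (k - 1).choose t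
      ≤ (n - 2 * k).choose t * (n - k - t - 2).choose (k - t - 2) := by
  obtain ⟨s, hs⟩ : ∃ s, k = s + t + 3 := ⟨k - t - 3, by rcases h with h | h <;> omega⟩
  obtain ⟨N, hN⟩ : ∃ N, n = 2 * k + N := ⟨n - 2 * k, by rcases h with h | h <;> omega⟩
  rw [← Nat.choose_symm (show k - t - 2 ≤ n - k - t - 2 by omega), hN, hs,
    show 2 * (s + t + 3) + N - (s + t + 3) - t - 2 - (s + t + 3 - t - 2) = N by omega,
    show 2 * (s + t + 3) + N - (s + t + 3) - t - 2 = s + 1 + N by omega,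
    show 2 * (s + t + 3) + N - (s + t + 3) - 1 = s + t + 3 + N - 1 by omega,
    show 2 * (s + t + 3) + N - 2 * (s + t + 3) = N by omega,
    show s + t + 3 - 1 = s + t + 2 by omega]
  rcases h with ⟨rfl, h1, h2⟩ | ⟨h1, h2, h3⟩
  · refine diversity_numeric_of_le (N₀ := 5) (s₀ := 31) (by omega) (by omega) (by omega) (by omega) ?_
    norm_num [Nat.choose]
  · refine diversity_numeric_of_le (N₀ := 14 * t) (s₀ := 3 * t + 5) (by omega) (by omega) (by omega)
      (by omega) ?_
    have := diversity_numeric_base h1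
    rw [show 3 * t + 5 + t + 3 + 14 * t - 1 + 2 * t = 20 * t + 7 by omega,
      show 3 * t + 5 + t + 2 = 4 * t + 7 by omega, show 3 * t + 5 + 1 + 14 * t = 17 * t + 6 by omega,
      ← Nat.choose_symm (show 14 * t ≤ 17 * t + 6 by omega),
      show 17 * t + 6 - 14 * t = 3 * t + 6 by omega]
    exact this

end Numerics

/-! ### Binomial estimates for the large range. -/

section LargeDiversityNumerics

theorem choose_mul_le_choose_mul_of_lt {m a b : ℕ} (ha : 1 ≤ a) (hab : a ≤ b) (hm : m + 1 ≤ a + b) :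
    m.choose b * b ≤ m.choose a * a := by
  have h1 := Nat.choose_mul (n := m) hab
  have h2 : (m - a).choose (b - a) ≤ (b - 1).choose (a - 1) := by
    rw [← Nat.choose_symm (show a - 1 ≤ b - 1 by omega), show b - 1 - (a - 1) = b - a by omega]
    exact Nat.choose_le_choose _ (by omega)
  have h3 := Nat.add_one_mul_choose_eq (b - 1) (a - 1)
  rw [Nat.sub_add_cancel ha, Nat.sub_add_cancel (by omega)] at h3
  refine Nat.le_of_mul_le_mul_right ?_ (Nat.choose_pos hab)
  calc m.choose b * b * b.choose a = m.choose a * (m - a).choose (b - a) * b := by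
        rw [← h1]; ring
    _ ≤ m.choose a * (b - 1).choose (a - 1) * b := by gcongr
    _ = m.choose a * (b * (b - 1).choose (a - 1)) := by ring
    _ = _ := by rw [h3]; ring

/-- The guaranteed excess of the loss through `i` over the gain outside `i`. -/
noncomputable def diversityGain (n k t m : ℕ) : ℝ :=
  m.choose (k - 1) - (k : ℝ) / (k - t) * m.choose (n - k - 1)

/-- By Pascal's rule the increment is C(m,k-2) - k/(k-t)·C(m,n-k-2). The comparison of these
binomials needs m + 1 ≤ n - 4, so the final step to n - 3 is not covered. -/
theorem diversityGain_le_succ {n k t m : ℕ} (h : AdmissibleParams n k t) (hm : m + 5 ≤ n) :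
    diversityGain n k t m ≤ diversityGain n k t (m + 1) := by
  have ht1 : 1 ≤ t := by rcases h with h | h <;> omega
  have htk : 3 * t ≤ k := by rcases h with h | h <;> omega
  have hn : 2 * k + 5 ≤ n := by rcases h with h | h <;> omega
  have hk : 3 ≤ k := by omega
  have h1 := choose_mul_le_choose_mul_of_lt (m := m) (a := k - 2) (b := n - k - 2) (by omega)
    (by omega) (by omega)
  have h2 : k * (k - 2) ≤ (k - t) * (n - k - 2) := by
    rcases h with ⟨rfl, h4, h5⟩ | ⟨h3, h4, h5⟩
    · calc k * (k - 2) ≤ (k - 1) * (k + 3) := by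
            obtain ⟨v, rfl⟩ : ∃ v, k = v + 2 := ⟨k - 2, by omega⟩
            simp only [Nat.add_sub_cancel, show v + 2 - 1 = v + 1 by omega]
            nlinarith
        _ ≤ _ := Nat.mul_le_mul_left _ (by omega)
    · calc k * (k - 2) ≤ (k - t) * (k + 14 * t - 2) := by
            obtain ⟨v, rfl⟩ : ∃ v, k = v + t := ⟨k - t, by omega⟩
            obtain ⟨s, rfl⟩ : ∃ s, t = s + 2 := ⟨t - 2, by omega⟩
            simp only [Nat.add_sub_cancel, show v + (s + 2) - 2 = v + s by omega,
              show v + (s + 2) + 14 * (s + 2) - 2 = v + 15 * s + 28 by omega]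
            nlinarith
        _ ≤ _ := Nat.mul_le_mul_left _ (by omega)
  have h3 : k * m.choose (n - k - 2) ≤ (k - t) * m.choose (k - 2) := by
    refine Nat.le_of_mul_le_mul_right (c := n - k - 2) ?_ (by omega)
    calc _ = k * (m.choose (n - k - 2) * (n - k - 2)) := by ring
      _ ≤ k * (m.choose (k - 2) * (k - 2)) := Nat.mul_le_mul_left _ h1
      _ = m.choose (k - 2) * (k * (k - 2)) := by ring
      _ ≤ m.choose (k - 2) * ((k - t) * (n - k - 2)) := Nat.mul_le_mul_left _ h2
      _ = _ := by ring
  have e1 := Nat.choose_succ_succ' m (k - 2)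
  have e2 := Nat.choose_succ_succ' m (n - k - 2)
  rw [show k - 2 + 1 = k - 1 by omega] at e1
  rw [show n - k - 2 + 1 = n - k - 1 by omega] at e2
  have hkt : (0 : ℝ) < (k : ℝ) - t := by
    rw [← Nat.cast_sub (by omega)]; exact_mod_cast (by omega : 0 < k - t)
  have h3R : (k : ℝ) / (k - t) * m.choose (n - k - 2) ≤ m.choose (k - 2) := by
    rw [div_mul_eq_mul_div, div_le_iff₀ hkt, ← Nat.cast_sub (by omega), mul_comm _ ((k - t : ℕ) : ℝ)]
    exact_mod_cast h3
  rw [diversityGain, diversityGain, e1, e2]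
  push_cast
  linarith

theorem one_add_le_sq_mul {x e : ℝ} (hx : 0 ≤ x) (h1 : e ≤ 0.12 * x) (h2 : e ≤ 0.23) :
    1 + 1.07 * x ≤ (1 + x) ^ 2 * (1 - e) := by
  nlinarith [mul_nonneg hx (sub_nonneg.2 h2), mul_nonneg (sq_nonneg x) (sub_nonneg.2 h2)]

theorem choose_le_choose_mul_pow_ratio {n k t : ℕ} (h : k + 1 + t ≤ n) :
    ((n - 1).choose t : ℝ) ≤ (n - k - 1).choose t * (((n : ℝ) - t) / (n - k - t)) ^ t := by
  have h1 := choose_mul_pow_le_choose_mul_pow_sub (n - k - 1) (n - 1) t (n - k - 1 - t) (n - 1 - t)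
    (by omega) (by omega) (by omega)
  rw [show n - k - 1 - t + 1 = n - k - t by omega, show n - 1 - t + 1 = n - t by omega] at h1
  have hc : ((n - k - t : ℕ) : ℝ) = (n : ℝ) - k - t := by
    rw [Nat.cast_sub (by omega), Nat.cast_sub (by omega)]
  have hc' : ((n - t : ℕ) : ℝ) = (n : ℝ) - t := Nat.cast_sub (by omega)
  have hpos : (0 : ℝ) < (n : ℝ) - k - t := by
    rw [← hc]; exact_mod_cast (by omega : 0 < n - k - t)
  rw [div_pow, ← mul_div_assoc, le_div_iff₀ (by positivity), ← hc, ← hc']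
  exact_mod_cast h1

/-- The 2t extra points shrink the ratio of binomials by (1+x)^(2t), while the left-hand base is at
most 1 + 1.07x. The spare factor, used for a single power, pays for the relative size ε of the
subtracted term. -/
theorem choose_mul_le_diversityGain_base {n k t : ℕ} (h : AdmissibleParams n k t) :
    (((n : ℝ) - t) / (n - k - t)) ^ t * (n - k - 1).choose (k - 1)
      ≤ diversityGain n k t (n - k - 1 + 2 * t) := by
  have ht1 : 1 ≤ t := by rcases h with h | h <;> omega
  have htk : 4 * t + 8 ≤ k := by rcases h with h | h <;> omega
  obtain ⟨N, hN⟩ : ∃ N, n = 2 * k + N := ⟨n - 2 * k, by rcases h with h | h <;> omega⟩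
  have hNt : (t = 1 ∧ 5 ≤ N ∧ 35 ≤ k) ∨ (2 ≤ t ∧ 14 * t ≤ N) := by rcases h with h | h <;> omega
  have h1 := choose_sub_le_choose_mul_pow (n - k - 1 + 2 * t) (k - 1) (2 * t) (by omega) (by omega)
  rw [Nat.add_sub_cancel] at h1
  -- the ratio of the two binomials
  have hrat : (n - k - 1 + 2 * t).choose (n - k - 1) * ((N + 2 * t + 1) * (N + 2 * t + 2))
      ≤ (n - k - 1 + 2 * t).choose (k - 1) * ((2 * t + 1) * (2 * t + 2)) := by
    have e1 := Nat.choose_mul (n := n - k - 1 + 2 * t) (k := n - k - 1) (s := k - 1) (by omega)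
    rw [show n - k - 1 + 2 * t - (k - 1) = N + 2 * t by omega,
      show n - k - 1 - (k - 1) = N by omega] at e1
    have e2 := Nat.choose_mul_succ_eq (N + 2 * t) N
    have e3 := Nat.choose_mul_succ_eq (N + 2 * t + 1) N
    rw [show N + 2 * t + 1 - N = 2 * t + 1 by omega] at e2
    rw [show N + 2 * t + 1 + 1 - N = 2 * t + 2 by omega] at e3
    have e4 : (N + 2 * t + 1 + 1).choose N ≤ (n - k - 1).choose (k - 1) := by
      rw [← Nat.choose_symm (show k - 1 ≤ n - k - 1 by omega),
        show n - k - 1 - (k - 1) = N by omega]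
      exact Nat.choose_le_choose _ (by omega)
    refine Nat.le_of_mul_le_mul_right (c := (n - k - 1).choose (k - 1)) ?_
      (Nat.choose_pos (by omega))
    calc _ = (n - k - 1 + 2 * t).choose (k - 1) * ((N + 2 * t + 1 + 1).choose N
          * ((2 * t + 1) * (2 * t + 2))) := by
          linear_combination ((N + 2 * t + 1) * (N + 2 * t + 2)) * e1
            + (n - k - 1 + 2 * t).choose (k - 1) * ((N + 2 * t + 2) * e2 + (2 * t + 1) * e3)
      _ ≤ (n - k - 1 + 2 * t).choose (k - 1) * ((n - k - 1).choose (k - 1)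
          * ((2 * t + 1) * (2 * t + 2))) := by gcongr
      _ = _ := by ring
  set M : ℝ := (((n - k - 1 + 2 * t).choose (k - 1) : ℕ) : ℝ) with hM
  have hM0 : 0 ≤ M := Nat.cast_nonneg _
  have hratR : ((n - k - 1 + 2 * t).choose (n - k - 1) : ℝ) * (((N : ℝ) + 2 * t + 1) * (N + 2 * t + 2))
      ≤ M * ((2 * t + 1) * (2 * t + 2)) := by rw [hM]; exact_mod_cast hrat
  have htR : (1 : ℝ) ≤ t := by exact_mod_cast ht1
  have hkR : (4 : ℝ) * t + 8 ≤ k := by exact_mod_cast htk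
  have hN0 : (0 : ℝ) ≤ N := N.cast_nonneg
  have hnR : (n : ℝ) = 2 * k + N := by exact_mod_cast hN
  have hP : (0 : ℝ) < N + 2 * t := by linarith
  have hNtR : ((t : ℝ) = 1 ∧ (5 : ℝ) ≤ N ∧ (35 : ℝ) ≤ k) ∨ ((2 : ℝ) ≤ t ∧ (14 : ℝ) * t ≤ N) := by
    rcases hNt with ⟨a, b, c⟩ | ⟨a, b⟩
    · exact Or.inl ⟨by exact_mod_cast a, by exact_mod_cast b, by exact_mod_cast c⟩
    · exact Or.inr ⟨by exact_mod_cast a, by exact_mod_cast b⟩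
  set x : ℝ := ((k : ℝ) - 1) / (N + 2 * t) with hx
  set ε : ℝ := 4 / 3 * (((2 * t + 1) * (2 * t + 2)) / (((N : ℝ) + 2 * t + 1) * (N + 2 * t + 2))) with hε
  have hx0 : 0 ≤ x := div_nonneg (by linarith) hP.le
  have hε1 : ε ≤ 0.23 := by
    rw [hε, ← mul_div_assoc, div_le_iff₀ (by positivity)]
    rcases hNtR with ⟨a, b, c⟩ | ⟨a, b⟩
    · rw [a]; norm_num; nlinarith
    · norm_num; nlinarith
  have hε2 : ε ≤ 0.12 * x := by
    rw [hε, hx, ← mul_div_assoc, ← mul_div_assoc, div_le_div_iff₀ (by positivity) hP]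
    have b1 : 4 / 3 * ((2 * (t : ℝ) + 1) * (2 * t + 2)) ≤ 0.12 * ((k - 1) * (N + 2 * t + 2)) := by
      rcases hNtR with ⟨a, b, c⟩ | ⟨a, b⟩
      · rw [a]; norm_num; nlinarith
      · have : (4 * (t : ℝ) + 7) * (16 * t + 2) ≤ (k - 1) * (N + 2 * t + 2) := by
          gcongr <;> linarith
        norm_num at this ⊢
        nlinarith
    have b2 : (0 : ℝ) ≤ 0.12 * ((k - 1) * (N + 2 * t + 2)) := by
      refine mul_nonneg (by norm_num) (mul_nonneg (by linarith) (by linarith))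
    calc _ ≤ 0.12 * (((k : ℝ) - 1) * (N + 2 * t + 2)) * (N + 2 * t + 1) :=
          mul_le_mul b1 (by linarith) hP.le b2
      _ = _ := by ring
  have hmain := one_add_le_sq_mul hx0 hε2 hε1
  have hρ : ((n : ℝ) - t) / (n - k - t) ≤ 1 + 1.07 * x := by
    have hd : (0 : ℝ) < n - k - t := by linarith
    have : ((n : ℝ) - t) / (n - k - t) = 1 + k / (n - k - t) := by field_simp; ring
    rw [this]
    have b1 : (k : ℝ) / (n - k - t) ≤ k / (N + 2 * t) := by
      gcongr
      linarith
    have b2 : (k : ℝ) / (N + 2 * t) ≤ 1.1 * x := by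
      rw [hx, ← mul_div_assoc]
      gcongr
      linarith
    have b3 : (k : ℝ) / (N + 2 * t) ≤ 1.07 * x ∨ (k : ℝ) < 16 := by
      by_cases hk16 : (k : ℝ) < 16
      · exact Or.inr hk16
      · left
        rw [hx, ← mul_div_assoc]
        gcongr
        push Not at hk16
        norm_num
        linarith
    rcases b3 with b3 | b3
    · linarith
    · rcases hNtR with ⟨a, b, c⟩ | ⟨a, b⟩ <;> linarith
  have hc0 : (0 : ℝ) < (k : ℝ) - t := by linarith
  have hc : (k : ℝ) / (k - t) ≤ 4 / 3 := by
    rw [div_le_div_iff₀ hc0 (by norm_num)]; linarith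
  -- the gain
  have hgain : M * (1 - ε) ≤ diversityGain n k t (n - k - 1 + 2 * t) := by
    have b1 : ((n - k - 1 + 2 * t).choose (n - k - 1) : ℝ) ≤
        M * (((2 * t + 1) * (2 * t + 2)) / (((N : ℝ) + 2 * t + 1) * (N + 2 * t + 2))) := by
      rw [← mul_div_assoc, le_div_iff₀ (by positivity)]
      exact hratR
    have b2 : (k : ℝ) / (k - t) * (n - k - 1 + 2 * t).choose (n - k - 1) ≤ 4 / 3 *
        (M * (((2 * t + 1) * (2 * t + 2)) / (((N : ℝ) + 2 * t + 1) * (N + 2 * t + 2)))) :=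
      mul_le_mul hc b1 (Nat.cast_nonneg _) (by norm_num)
    rw [diversityGain, ← hM, hε]
    linarith
  have hx1 : (((n - k - 1 + 2 * t : ℕ) : ℝ) - ((k - 1 : ℕ) : ℝ)) / ((n - k - 1 + 2 * t : ℕ) : ℝ)
      = (1 + x)⁻¹ := by
    have b1 : ((n - k - 1 + 2 * t : ℕ) : ℝ) = N + 2 * t + (k - 1) := by
      rw [show n - k - 1 + 2 * t = N + 2 * t + (k - 1) by omega]
      push_cast [Nat.cast_sub (show 1 ≤ k by omega)]
      ring
    rw [b1, Nat.cast_sub (by omega), hx, Nat.cast_one]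
    have : (N : ℝ) + 2 * t + (k - 1) ≠ 0 := by linarith
    field_simp
    ring
  rw [hx1] at h1
  set ρ₀ : ℝ := ((n : ℝ) - t) / (n - k - t) with hρ₀
  have hρ0 : 0 ≤ ρ₀ := div_nonneg (by linarith) (by linarith)
  have hr : ρ₀ / (1 + x) ^ 2 ≤ 1 - ε := by
    rw [div_le_iff₀ (by positivity), mul_comm]
    linarith
  have hε0 : 0 ≤ ε := by positivity
  have hr0 : 0 ≤ ρ₀ / (1 + x) ^ 2 := by positivity
  calc _ ≤ ρ₀ ^ t * (M * (1 + x)⁻¹ ^ (2 * t)) := by gcongr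
    _ = M * (ρ₀ / (1 + x) ^ 2) ^ t := by
        have : (ρ₀ / (1 + x) ^ 2) ^ t = ρ₀ ^ t / ((1 + x) ^ 2) ^ t := div_pow _ _ _
        rw [this, pow_mul, inv_pow, inv_pow]; ring
    _ ≤ M * (1 - ε) := by
        refine mul_le_mul_of_nonneg_left ?_ hM0
        exact (pow_le_of_le_one hr0 (by linarith) (by omega)).trans hr
    _ ≤ _ := hgain

theorem sq_add_le_mul_of_le {t N p E : ℝ} (ht : 2 ≤ t) (hN : 14 * t ≤ N) (hp : 4 * t + 7 ≤ p)
    (hE : p * (p - 1) ≤ 2 * E) : (N + p) ^ 2 ≤ (N + p + E) * (N - 4 / 3 * t) := by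
  have hE2 : 7 * p ≤ E := by nlinarith
  have hE3 : p ^ 2 ≤ 11 / 5 * E := by nlinarith
  have hEN : p ^ 2 ≤ E * N / 10 := by nlinarith
  have hpN : p * N ≤ E * N / 7 := by nlinarith
  have htN : t * N ≤ p * N / 4 := by nlinarith
  have htp : t * p ≤ p * N / 14 := by nlinarith
  have htE : t * E ≤ E * N / 14 := by nlinarith
  have hEN0 : 0 ≤ E * N := mul_nonneg (by linarith) (by linarith)
  linarith

theorem mul_sq_le_mul_of_admissible {t N k : ℝ} (h : (t = 1 ∧ 5 ≤ N ∧ 35 ≤ k) ∨ (2 ≤ t ∧ 14 * t ≤ N))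
    (hk : 4 * t + 8 ≤ k) :
    (k - t) * (N + k - 1) ^ 2
      ≤ (N + k - 1 + (k - 1 - 2 * t) * (k - 2)) * ((k - t) * N - t * (k - 1)) := by
  rcases h with ⟨rfl, b, c⟩ | ⟨a, b⟩
  · obtain ⟨u, rfl⟩ : ∃ u, N = u + 5 := ⟨N - 5, by ring⟩
    obtain ⟨v, rfl⟩ : ∃ v, k = v + 35 := ⟨k - 35, by ring⟩
    have hu : 0 ≤ u := by linarith
    have hv : 0 ≤ v := by linarith
    rw [← sub_nonneg]
    ring_nf
    positivity
  · set p : ℝ := k - 1 with hp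
    set E : ℝ := (p - 2 * t) * (k - 2) with hE
    have hE1 : p * (p - 1) ≤ 2 * E := by
      have : p - 1 = k - 2 := by rw [hp]; ring
      rw [hE, this, ← mul_assoc]
      exact mul_le_mul_of_nonneg_right (by linarith) (by linarith)
    have hE0 : 0 ≤ E := mul_nonneg (by linarith) (by linarith)
    have h1 := sq_add_le_mul_of_le a b (by linarith) hE1
    have h2 : (k - t) * (N - 4 / 3 * t) ≤ (k - t) * N - t * p := by nlinarith
    have hNp : N + k - 1 = N + p := by rw [hp]; ring
    rw [hNp]
    calc _ ≤ (k - t) * ((N + p + E) * (N - 4 / 3 * t)) := mul_le_mul_of_nonneg_left h1 (by linarith)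
      _ = (N + p + E) * ((k - t) * (N - 4 / 3 * t)) := by ring
      _ ≤ _ := mul_le_mul_of_nonneg_left h2 (by linarith)

theorem mul_le_two_mul_of_admissible {t N k : ℝ} (h : (t = 1 ∧ 5 ≤ N ∧ 35 ≤ k) ∨ (2 ≤ t ∧ 14 * t ≤ N))
    (hk : 4 * t + 8 ≤ k) :
    k * (N + k - 1) ≤ 2 * (k - 2) * (2 * k + N - k - t) := by
  rcases h with ⟨rfl, b, c⟩ | ⟨a, b⟩ <;> nlinarith

theorem sub_mul_nonneg_of_admissible {t N k : ℝ} (h : (t = 1 ∧ 5 ≤ N ∧ 35 ≤ k) ∨ (2 ≤ t ∧ 14 * t ≤ N))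
    (hk : 4 * t + 8 ≤ k) :
    0 ≤ (k - t) * N - t * (k - 1) := by
  rcases h with ⟨rfl, b, c⟩ | ⟨a, b⟩ <;> nlinarith

/-- Treated separately since monotonicity stops at n - 4. With 1 + y = (n-3)/(n-k-1), the binomials
differ by a factor at least (1+y)^(k-1); 2t of these powers absorb the left-hand base, and the rest
beat 1/ρ by Bernoulli. -/
theorem choose_mul_le_diversityGain_top {n k t : ℕ} (h : AdmissibleParams n k t) :
    (((n : ℝ) - t) / (n - k - t)) ^ t * (n - k - 1).choose (k - 1)
      ≤ diversityGain n k t (n - 3) := by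
  have ht1 : 1 ≤ t := by rcases h with h | h <;> omega
  have htk : 4 * t + 8 ≤ k := by rcases h with h | h <;> omega
  obtain ⟨N, hN⟩ : ∃ N, n = 2 * k + N := ⟨n - 2 * k, by rcases h with h | h <;> omega⟩
  have hNt : (t = 1 ∧ 5 ≤ N ∧ 35 ≤ k) ∨ (2 ≤ t ∧ 14 * t ≤ N) := by rcases h with h | h <;> omega
  have htR : (1 : ℝ) ≤ t := by exact_mod_cast ht1
  have hkR : (4 : ℝ) * t + 8 ≤ k := by exact_mod_cast htk
  have hN0 : (0 : ℝ) ≤ N := N.cast_nonneg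
  have hnR : (n : ℝ) = 2 * k + N := by exact_mod_cast hN
  have hNtR : ((t : ℝ) = 1 ∧ (5 : ℝ) ≤ N ∧ (35 : ℝ) ≤ k) ∨ ((2 : ℝ) ≤ t ∧ (14 : ℝ) * t ≤ N) := by
    rcases hNt with ⟨a, b, c⟩ | ⟨a, b⟩
    · exact Or.inl ⟨by exact_mod_cast a, by exact_mod_cast b, by exact_mod_cast c⟩
    · exact Or.inr ⟨by exact_mod_cast a, by exact_mod_cast b⟩
  have hc0 : (0 : ℝ) < (k : ℝ) - t := by linarith
  have hQ : (0 : ℝ) < (N : ℝ) + k - 1 := by linarith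
  set M : ℝ := (((n - 3).choose (k - 1) : ℕ) : ℝ) with hM
  have hM0 : 0 ≤ M := Nat.cast_nonneg _
  set ρ : ℝ := (((k : ℝ) - t) * N - t * (k - 1)) / ((k - t) * (N + k - 1)) with hρ
  have hgain : diversityGain n k t (n - 3) = M * ρ := by
    have e1 := Nat.choose_succ_right_eq (n - 3) (k - 2)
    rw [show k - 2 + 1 = k - 1 by omega, show n - 3 - (k - 2) = N + (k - 1) by omega,
      ← Nat.choose_symm (show k - 2 ≤ n - 3 by omega), show n - 3 - (k - 2) = n - k - 1 by omega] at e1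
    have e2 : M * ((k : ℝ) - 1) = (n - 3).choose (n - k - 1) * ((N : ℝ) + k - 1) := by
      have : ((k - 1 : ℕ) : ℝ) = (k : ℝ) - 1 := by rw [Nat.cast_sub (by omega), Nat.cast_one]
      rw [add_sub_assoc, ← this, hM]
      exact_mod_cast e1
    have e3 : ((n - 3).choose (n - k - 1) : ℝ) = M * ((k : ℝ) - 1) / ((N : ℝ) + k - 1) := by
      rw [e2]; field_simp
    rw [diversityGain, ← hM, e3, hρ]
    field_simp
    ring
  set y : ℝ := ((k : ℝ) - 2) / (N + k - 1) with hy
  have hy0 : 0 ≤ y := div_nonneg (by linarith) hQ.le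
  have hD : ((n - k - 1).choose (k - 1) : ℝ) * (1 + y) ^ (k - 1) ≤ M := by
    have e1 := choose_mul_pow_le_choose_mul_pow (show n - k - 1 ≤ n - 3 by omega) (k - 1)
    have c1 : ((n - k - 1 : ℕ) : ℝ) = N + k - 1 := by
      rw [show n - k - 1 = N + k - 1 by omega, Nat.cast_sub (by omega)]; push_cast; ring
    have c2 : ((n - 3 : ℕ) : ℝ) = (N + k - 1) * (1 + y) := by
      rw [Nat.cast_sub (by omega), hnR, hy]; push_cast; field_simp; ring
    have e2 : ((n - k - 1).choose (k - 1) : ℝ) * ((n - 3 : ℕ) : ℝ) ^ (k - 1) ≤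
        M * ((n - k - 1 : ℕ) : ℝ) ^ (k - 1) := by rw [hM]; exact_mod_cast e1
    rw [c1, c2, mul_pow] at e2
    refine le_of_mul_le_mul_right ?_ (pow_pos hQ (k - 1))
    linarith
  have hρ₀ : ((n : ℝ) - t) / (n - k - t) ≤ (1 + y) ^ 2 := by
    have hd : (0 : ℝ) < n - k - t := by linarith
    have : ((n : ℝ) - t) / (n - k - t) = 1 + k / (n - k - t) := by field_simp; ring
    have b1 : (k : ℝ) / (n - k - t) ≤ 2 * y := by
      rw [hy, ← mul_div_assoc, div_le_div_iff₀ hd hQ, hnR]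
      exact mul_le_two_mul_of_admissible hNtR hkR
    rw [this]
    nlinarith
  have hbern : 1 ≤ (1 + ((k : ℝ) - 1 - 2 * t) * y) * ρ := by
    have : (1 + ((k : ℝ) - 1 - 2 * t) * y) * ρ = ((N + k - 1 + (k - 1 - 2 * t) * (k - 2))
        * ((k - t) * N - t * (k - 1))) / ((k - t) * (N + k - 1) ^ 2) := by
      rw [hρ, hy]; field_simp
    rw [this, le_div_iff₀ (by positivity), one_mul]
    exact mul_sq_le_mul_of_admissible hNtR hkR
  have hρ1 : 0 ≤ ρ := by
    rw [hρ]
    exact div_nonneg (sub_mul_nonneg_of_admissible hNtR hkR) (by positivity)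
  have hexp : 1 ≤ (1 + y) ^ (k - 1 - 2 * t) * ρ := by
    have b1 := one_add_mul_le_pow (show (-2 : ℝ) ≤ y by linarith) (k - 1 - 2 * t)
    have c1 : ((k - 1 - 2 * t : ℕ) : ℝ) = (k : ℝ) - 1 - 2 * t := by
      rw [Nat.cast_sub (by omega), Nat.cast_sub (by omega)]; push_cast; ring
    rw [c1] at b1
    exact hbern.trans (mul_le_mul_of_nonneg_right b1 hρ1)
  set D : ℝ := (((n - k - 1).choose (k - 1) : ℕ) : ℝ) with hD'
  have hD0 : 0 ≤ D := Nat.cast_nonneg _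
  have hρ00 : 0 ≤ ((n : ℝ) - t) / (n - k - t) := div_nonneg (by linarith) (by linarith)
  rw [hgain]
  clear_value M D ρ y
  calc _ ≤ ((1 + y) ^ 2) ^ t * D :=
        mul_le_mul_of_nonneg_right (pow_le_pow_left₀ hρ00 hρ₀ t) hD0
    _ ≤ ((1 + y) ^ 2) ^ t * D * ((1 + y) ^ (k - 1 - 2 * t) * ρ) :=
        le_mul_of_one_le_right (by positivity) hexp
    _ = D * (1 + y) ^ (k - 1) * ρ := by
        rw [show k - 1 = 2 * t + (k - 1 - 2 * t) by omega, pow_add, ← pow_mul,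
          show 2 * t + (k - 1 - 2 * t) - 2 * t = k - 1 - 2 * t by omega]
        ring
    _ ≤ M * ρ := mul_le_mul_of_nonneg_right hD hρ1

theorem choose_mul_le_diversityGain {n k t m : ℕ} (h : AdmissibleParams n k t)
    (hm : n - k - 1 + 2 * t ≤ m) (hmn : m ≤ n - 3) :
    (((n : ℝ) - t) / (n - k - t)) ^ t * (n - k - 1).choose (k - 1)
      ≤ diversityGain n k t m := by
  rcases eq_or_lt_of_le hmn with rfl | hlt
  · exact choose_mul_le_diversityGain_top h
  · clear hmn
    induction m, hm using Nat.le_induction with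
    | base => exact choose_mul_le_diversityGain_base h
    | succ m hm ih => exact (ih (by omega)).trans (diversityGain_le_succ h (by omega))

end LargeDiversityNumerics

/-! ### Many members avoid `i`, and the conclusion. -/

section LargeDiversity

variable {n k t : ℕ} {F : Finset (Finset (Fin n))}

theorem exists_le_and_le_succ {f : ℕ → ℕ} {a b c : ℕ} (hab : a ≤ b) (ha : f a ≤ c) (hb : c < f b) :
    ∃ m, a ≤ m ∧ m < b ∧ f m ≤ c ∧ c ≤ f (m + 1) := by
  induction b, hab using Nat.le_induction with
  | base => omega
  | succ b hab ih =>
    rcases le_or_gt (f b) c with h | h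
    · exact ⟨b, hab, Nat.lt_succ_self b, h, hb.le⟩
    · obtain ⟨m, h1, h2, h3⟩ := ih h
      exact ⟨m, h1, by omega, h3⟩

/-- The upward shadow of the members avoiding `i` outweighs their number. -/
theorem add_le_card_upAt_of_admissibleParams (h : AdmissibleParams n k t)
    (hF : (F : Set (Finset (Fin n))).Sized k) {i : Fin n}
    (h1 : (n - k - 1 + 2 * t).choose (2 * t) ≤ #(F.filter fun A => i ∉ A))
    (h2 : #(F.filter fun A => i ∉ A) < (n - 3).choose (k - 2)) :
    (((n : ℝ) - t) / (n - k - t)) ^ t * (n - k - 1).choose (k - 1)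
        + (k : ℝ) / (k - t) * #(F.filter fun A => i ∉ A)
      ≤ #(upAt {i}ᶜ (n - k) (F.filter fun A => i ∉ A)) := by
  have ht1 : 1 ≤ t := by rcases h with h | h <;> omega
  have htk : 4 * t + 8 ≤ k := by rcases h with h | h <;> omega
  have hkn : 2 * k + 5 ≤ n := by rcases h with h | h <;> omega
  have hS : #({i}ᶜ : Finset (Fin n)) = n - 1 := by simp [card_compl]
  have hsub : (F.filter fun A => i ∉ A) ⊆ powersetCard k {i}ᶜ := by
    intro A hA
    obtain ⟨h1, h2⟩ := mem_filter.1 hA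
    exact mem_powersetCard.2 ⟨subset_compl_singleton.2 h2, hF h1⟩
  rw [← Nat.choose_symm (by omega), Nat.add_sub_cancel] at h1
  rw [← Nat.choose_symm (by omega), show n - 3 - (k - 2) = n - k - 1 by omega] at h2
  -- The size is bracketed between consecutive binomials. The chord bound and the claim are both
  -- linear in the position in between, so the gain estimates at `m` and `m + 1` suffice.
  obtain ⟨m, hm1, hm2, hm3, hm4⟩ := exists_le_and_le_succ
    (f := fun m => m.choose (n - k - 1)) (by omega) h1 h2
  have key := chord_le_card_upAt (j := n - k) (m := m) hsub (by omega) (by omega) (by omega)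
    (by omega) (by rw [hS, show n - 1 - k = n - k - 1 by omega]; exact hm3)
    (by rw [hS, show n - 1 - k = n - k - 1 by omega]; exact hm4)
  rw [hS, show n - 1 - k = n - k - 1 by omega, show n - 1 - (n - k) = k - 1 by omega,
    show k - 1 - 1 = k - 2 by omega] at key
  have g1 := choose_mul_le_diversityGain h hm1 (by omega)
  have g2 := choose_mul_le_diversityGain (m := m + 1) h (by omega) (by omega)
  rw [diversityGain] at g1 g2
  have e1 := Nat.choose_succ_succ' m (k - 2)
  have e2 := Nat.choose_succ_succ' m (n - k - 1 - 1)
  rw [show k - 2 + 1 = k - 1 by omega] at e1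
  rw [show n - k - 1 - 1 + 1 = n - k - 1 by omega] at e2
  rw [e2] at hm4
  rw [e1, e2] at g2
  have hβ : 0 < m.choose (n - k - 1 - 1) := Nat.choose_pos (by omega)
  obtain ⟨s, hs⟩ := Nat.exists_eq_add_of_le hm3
  rw [hs, Nat.add_sub_cancel_left] at key
  have hs2 : s ≤ m.choose (n - k - 1 - 1) := by omega
  rw [hs]
  generalize (((n : ℝ) - t) / (n - k - t)) ^ t * (n - k - 1).choose (k - 1) = g at *
  generalize (k : ℝ) / (k - t) = c at *
  generalize #(upAt {i}ᶜ (n - k) (F.filter fun A => i ∉ A)) = U at *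
  generalize m.choose (n - k - 1 - 1) = β at *
  generalize m.choose (n - k - 1) = a at *
  generalize m.choose (k - 2) = η at *
  generalize m.choose (k - 1) = e at *
  push_cast at g2 ⊢
  have keyR : (s : ℝ) * η + e * β ≤ U * β := by exact_mod_cast key
  have hβR : (0 : ℝ) < β := by exact_mod_cast hβ
  have hsR : (s : ℝ) ≤ β := by exact_mod_cast hs2
  refine le_of_mul_le_mul_right ?_ hβR
  have p1 := mul_nonneg (sub_nonneg.2 hsR) (sub_nonneg.2 g1)
  have p2 := mul_nonneg s.cast_nonneg (sub_nonneg.2 g2)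
  linarith

/-- If many members avoid `i`, then some `t`-set has at most the Hilton–Milner degree. -/
theorem exists_subsetDegree_add_le_of_choose_le (h : AdmissibleParams n k t)
    (hF : (F : Set (Finset (Fin n))).Sized k) (hint : (F : Set (Finset (Fin n))).Intersecting)
    {i : Fin n} (h1 : (n - k - 1 + 2 * t).choose (2 * t) ≤ #(F.filter fun A => i ∉ A))
    (h2 : #(F.filter fun A => i ∉ A) < (n - 3).choose (k - 2)) :
    ∃ T : Finset (Fin n), #T = t ∧ subsetDegree F T
      + (n - t - k - 1).choose (k - t - 1) ≤ (n - t - 1).choose (k - t - 1) := by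
  by_contra! hcon
  have ht1 : 1 ≤ t := by rcases h with h | h <;> omega
  have htk : 4 * t + 8 ≤ k := by rcases h with h | h <;> omega
  have hkn : 2 * k + 5 ≤ n := by rcases h with h | h <;> omega
  have htn : k + 1 + t ≤ n := by omega
  have hS : #({i}ᶜ : Finset (Fin n)) = n - 1 := by simp [card_compl]
  have hU := add_le_card_upAt_of_admissibleParams h hF h1 h2
  have hup := vertexDegree_upAt_add_le hint (j := k) (by omega) i (by omega)
  have hvd : vertexDegree F i ≤ vertexDegree (upAt univ k F) i := by
    refine card_le_card (filter_subset_filter _ fun A hA => ?_)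
    exact mem_upAt.2 ⟨⟨subset_univ _, hF hA⟩, A, hA, Subset.rfl⟩
  -- Summation over the `t`-sets avoiding `i`: a member through `i` is counted C(k-1,t) times, one
  -- avoiding `i` C(k,t) times. Their ratio is the factor k/(k-t) in `diversityGain`.
  have hsum : (n - 1).choose t * (n - t - 1).choose (k - t - 1) + (n - 1).choose t
      ≤ vertexDegree F i * (k - 1).choose t + #(F.filter fun A => i ∉ A) * k.choose t
        + (n - 1).choose t * (n - t - k - 1).choose (k - t - 1) := by
    have e1 : ∑ T ∈ powersetCard t {i}ᶜ, subsetDegree F T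
        = vertexDegree F i * (k - 1).choose t + #(F.filter fun A => i ∉ A) * k.choose t := by
      have := sum_card_filter_subset F {i}ᶜ t
      rw [← sum_filter_add_sum_filter_not F (fun G => i ∈ G)] at this
      refine this.trans (congrArg₂ (· + ·) ?_ ?_)
      · rw [vertexDegree, ← smul_eq_mul, ← sum_const]
        refine sum_congr rfl fun G hG => ?_
        obtain ⟨hG1, hG2⟩ := mem_filter.1 hG
        have : G ∩ {i}ᶜ = G.erase i := by ext; simp [and_comm]
        rw [this, card_erase_of_mem hG2, hF hG1]
      · rw [← smul_eq_mul, ← sum_const]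
        refine sum_congr rfl fun G hG => ?_
        obtain ⟨hG1, hG2⟩ := mem_filter.1 hG
        rw [inter_eq_left.2 (subset_compl_singleton.2 hG2), hF hG1]
    have e2 : ∑ T ∈ powersetCard t ({i}ᶜ : Finset (Fin n)), ((n - t - 1).choose (k - t - 1) + 1)
        ≤ ∑ T ∈ powersetCard t {i}ᶜ, (subsetDegree F T + (n - t - k - 1).choose (k - t - 1)) :=
      sum_le_sum fun T hT => hcon T (mem_powersetCard.1 hT).2
    rw [sum_const, sum_add_distrib, e1, sum_const, card_powersetCard, hS, smul_eq_mul, smul_eq_mul,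
      mul_add, mul_one] at e2
    exact e2
  have i1 := Nat.choose_mul (n := n - 1) (k := k - 1) (s := t) (by omega)
  have i2 := Nat.choose_mul (n := n - k - 1) (k := k - 1) (s := t) (by omega)
  rw [show n - 1 - t = n - t - 1 by omega, show k - 1 - t = k - t - 1 by omega] at i1
  rw [show n - k - 1 - t = n - t - k - 1 by omega, show k - 1 - t = k - t - 1 by omega] at i2
  have i3 := Nat.choose_mul_succ_eq (k - 1) t
  rw [show k - 1 + 1 = k by omega] at i3
  have hpos : 0 < (n - 1).choose t := Nat.choose_pos (by omega)
  have hkt : (0 : ℝ) < (k : ℝ) - t := by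
    rw [← Nat.cast_sub (by omega)]; exact_mod_cast (by omega : 0 < k - t)
  have i3R : (k.choose t : ℝ) = (k : ℝ) / (k - t) * (k - 1).choose t := by
    rw [div_mul_eq_mul_div, eq_div_iff hkt.ne', ← Nat.cast_sub (by omega), mul_comm (k : ℝ)]
    exact_mod_cast i3.symm
  have hratio := choose_le_choose_mul_pow_ratio htn
  rw [← i1] at hsum
  have hsumR : ((n - 1).choose (k - 1) : ℝ) * (k - 1).choose t + (n - 1).choose t
      ≤ vertexDegree F i * (k - 1).choose t + #(F.filter fun A => i ∉ A) * k.choose t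
        + (n - 1).choose t * (n - t - k - 1).choose (k - t - 1) := by exact_mod_cast hsum
  have hposR : (0 : ℝ) < (n - 1).choose t := by exact_mod_cast hpos
  have i2R : ((n - k - 1).choose (k - 1) : ℝ) * (k - 1).choose t
      = (n - k - 1).choose t * (n - t - k - 1).choose (k - t - 1) := by exact_mod_cast i2
  have hupR : (vertexDegree F i : ℝ) + #(upAt {i}ᶜ (n - k) (F.filter fun A => i ∉ A))
      ≤ (n - 1).choose (k - 1) := by exact_mod_cast (Nat.add_le_add_right hvd _).trans hup
  rw [i3R] at hsumR
  have q1 := mul_le_mul_of_nonneg_right (add_le_add_right hU (vertexDegree F i : ℝ) |>.trans hupR)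
    ((k - 1).choose t).cast_nonneg (α := ℝ)
  -- The subtracted Hilton–Milner term is averaged over C(n-1,t) sets, whereas rewriting it through
  -- C(n-k-1,k-1) produces C(n-k-1,t); the power of (n-t)/(n-k-t) bounds the quotient.
  have q2 := mul_le_mul_of_nonneg_right hratio ((n - t - k - 1).choose (k - t - 1)).cast_nonneg (α := ℝ)
  have q3 : ((n - k - 1).choose t : ℝ) * (((n : ℝ) - t) / (n - k - t)) ^ t
        * (n - t - k - 1).choose (k - t - 1)
      = (((n : ℝ) - t) / (n - k - t)) ^ t * (n - k - 1).choose (k - 1) * (k - 1).choose t := by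
    linear_combination -(((n : ℝ) - t) / (n - k - t)) ^ t * i2R
  linarith

/-- A non-trivial intersecting family has a `t`-set of at most the Hilton–Milner degree. -/
theorem exists_subsetDegree_add_le_of_nontrivialFamily (h : AdmissibleParams n k t)
    (hF : (F : Set (Finset (Fin n))).Sized k) (hint : (F : Set (Finset (Fin n))).Intersecting)
    (hnt : NontrivialFamily F) :
    ∃ T : Finset (Fin n), #T = t ∧ subsetDegree F T
      + (n - t - k - 1).choose (k - t - 1) ≤ (n - t - 1).choose (k - t - 1) := by
  by_contra! hcon
  obtain ⟨i, hi⟩ := exists_card_filter_notMem_lt h hF hint fun T hT =>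
    Nat.sub_le_iff_le_add.2 (hcon T hT).le
  have hpos : (F.filter fun A => i ∉ A).Nonempty := by
    rw [NontrivialFamily, not_exists] at hnt
    obtain ⟨A, hA⟩ := not_forall.1 (hnt i)
    rw [Classical.not_imp] at hA
    exact ⟨A, mem_filter.2 hA⟩
  have ⟨T, hT, hd⟩ : ∃ T : Finset (Fin n), #T = t ∧ subsetDegree F T
      + (n - t - k - 1).choose (k - t - 1) ≤ (n - t - 1).choose (k - t - 1) := by
    rcases le_or_gt ((n - k - 1 + 2 * t).choose (2 * t)) #(F.filter fun A => i ∉ A) with hc | hc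
    · exact exists_subsetDegree_add_le_of_choose_le h hF hint hc hi
    · refine exists_subsetDegree_add_le hF hint (by rcases h with h | h <;> omega)
        (by rcases h with h | h <;> omega) (by rcases h with h | h <;> omega) hpos ?_
      exact (Nat.mul_le_mul_right _ (by omega)).trans (choose_mul_choose_le_of_admissibleParams h)
  exact absurd hd (not_le.2 (hcon T hT))

end LargeDiversity

end HiltonMilnerDegree

theorem mainTheorem6 (n k t : ℕ)
    (h : (t = 1 ∧ 2 * k + 5 ≤ n ∧ 35 ≤ k) ∨
      (1 < t ∧ (t : ℝ) ≤ (k : ℝ) / 4 - 2 ∧ 2 * k + 14 * t ≤ n)) :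
    (∀ F : Finset (Finset (Fin n)),
      (F : Set (Finset (Fin n))).Sized k →
      (F : Set (Finset (Fin n))).Intersecting →
      NontrivialFamily F →
      (minDegree t F : ℤ) ≤
        (Nat.choose (n - t - 1) (k - t - 1) : ℤ) - (Nat.choose (n - t - k - 1) (k - t - 1) : ℤ)) ∧
    (minDegree t (hiltonMilner n k) : ℤ) =
      (Nat.choose (n - t - 1) (k - t - 1) : ℤ) - (Nat.choose (n - t - k - 1) (k - t - 1) : ℤ) := by
  have hadm : AdmissibleParams n k t := by
    rcases h with h | ⟨h1, h2, h3⟩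
    · exact Or.inl h
    · refine Or.inr ⟨h1, ?_, h3⟩
      have : 4 * (t : ℝ) + 8 ≤ k := by linarith
      exact_mod_cast this
  refine ⟨fun F hF hint hnt => ?_, ?_⟩
  · obtain ⟨T, hT, hd⟩ := exists_subsetDegree_add_le_of_nontrivialFamily hadm hF hint hnt
    have hmin : minDegree t F ≤ subsetDegree F T := Nat.sInf_le ⟨T, hT, rfl⟩
    rw [le_sub_iff_add_le]
    exact_mod_cast (Nat.add_le_add_right hmin _).trans hd
  · rw [eq_sub_iff_add_eq]
    exact_mod_cast minDegree_hiltonMilner (by rcases hadm with h | h <;> omega)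
      (by rcases hadm with h | h <;> omega) (by rcases hadm with h | h <;> omega)
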